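/- Let $d\ge 2$, $\alpha\in(0,d-1)$, $Q>0$ and $m>0$. For a Borel set $E\subset\mathbb R^d$ let $$P(E)=\sup\Big\{\int_E \operatorname{div}T\,dx:\ T\in C^1_c(\mathbb R^d;\mathbb R^d),\ |T|\le 1\Big\}\in[0,\infty]$$ be its perimeter, let $$\mathcal I_\alpha(E)=\inf\Big\{\int_{\mathbb R^d}\int_{\mathbb R^d}\frac{d\mu(x)\,d\mu(y)}{|x-y|^\alpha}:\ \mu \text{ a (nonnegative) Borel measure on } \mathbb R^d,\ \mu(E)=1\Big\}$$ be its Riesz potential energy, and let $\mathcal F(E)=P(E)+Q^2\,\mathcal I_\alpha(E)\in[0,\infty]$. Let $\mathcal A$ be either the class of all open subsets of $\mathbb R^d$ or the class of all compact subsets of $\mathbb R^d$. Then $\mathcal F$ has no local volume-constrained minimizer in $\mathcal A$ of volume $m$, neither in the $L^1$ topology nor in the Hausdorff topology. That is, for every $E\in\mathcal A$ with Lebesgue measure $|E|=m$ and every $\varepsilon>0$: 1. there is $E'\in\mathcal A$ with $|E'|=m$, $|E\,\triangle\,E'|<\varepsilon$ and $\mathcal F(E')<\mathcal F(E)$; 2.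 there is $E'\in\mathcal A$ with $|E'|=m$, Hausdorff distance $d_H(E,E')<\varepsilon$ and $\mathcal F(E')<\mathcal F(E)$. -/

import Mathlib

open MeasureTheory
open scoped ENNReal

noncomputable section

namespace ChargedDrop

/-- Euclidean space `ℝ^d`. -/
abbrev Space (d : ℕ) : Type := EuclideanSpace ℝ (Fin d)

/-- The divergence `∑ i, ∂ᵢ Tᵢ` of a vector field on `ℝ^d`. -/
def divergence {d : ℕ} (T : Space d → Space d) (x : Space d) : ℝ :=
  ∑ i : Fin d, (fderiv ℝ T x (EuclideanSpace.single i 1)) i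

/-- The perimeter of `E` (total variation of its characteristic function): the supremum of
`∫_E div T` over the `C¹` vector fields `T` with compact support and `|T| ≤ 1`. -/
def perimeter {d : ℕ} (E : Set (Space d)) : ℝ≥0∞ :=
  ⨆ (T : Space d → Space d) (_ : ContDiff ℝ 1 T) (_ : HasCompactSupport T)
    (_ : ∀ x, ‖T x‖ ≤ 1), ENNReal.ofReal (∫ x in E, divergence T x)

/-- The energy `∬ |x - y|^{-α} dμ(x) dμ(y) ∈ [0, ∞]` of a Borel measure; for `α > 0` the kernel
is `∞` on the diagonal. -/
def rieszEnergy {d : ℕ} (α : ℝ) (μ : Measure (Space d)) : ℝ≥0∞ :=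
  ∫⁻ x, ∫⁻ y, (edist x y) ^ (-α) ∂μ ∂μ

/-- The Riesz potential energy of a set `A`: the infimum of the energies of the Borel measures
`μ` with `μ(A) = 1`. -/
def setEnergy {d : ℕ} (α : ℝ) (A : Set (Space d)) : ℝ≥0∞ :=
  ⨅ (μ : Measure (Space d)) (_ : μ A = 1), rieszEnergy α μ

/-- The functional `P(E) + Q² I_α(E)`. -/
def energy {d : ℕ} (α Q : ℝ) (E : Set (Space d)) : ℝ≥0∞ :=
  perimeter E + ENNReal.ofReal (Q ^ 2) * setEnergy α E

/-- `E` minimizes the functional among the sets of the class `𝒜` that have the same volume `m`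
and are close to `E` in the `L¹` distance `|E ∆ E'|`. -/
def IsL1LocalMinimizer {d : ℕ} (𝒜 : Set (Set (Space d))) (α Q m : ℝ) (E : Set (Space d)) :
    Prop :=
  E ∈ 𝒜 ∧ volume E = ENNReal.ofReal m ∧
    ∃ ε : ℝ≥0∞, 0 < ε ∧ ∀ E' ∈ 𝒜, volume E' = ENNReal.ofReal m →
      volume (symmDiff E E') < ε → energy α Q E ≤ energy α Q E'

/-- `E` minimizes the functional among the sets of the class `𝒜` that have the same volume `m`
and are close to `E` in the Hausdorff distance. -/
def IsHausdorffLocalMinimizer {d : ℕ} (𝒜 : Set (Set (Space d))) (α Q m : ℝ)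
    (E : Set (Space d)) : Prop :=
  E ∈ 𝒜 ∧ volume E = ENNReal.ofReal m ∧
    ∃ ε : ℝ≥0∞, 0 < ε ∧ ∀ E' ∈ 𝒜, volume E' = ENNReal.ofReal m →
      Metric.hausdorffEDist E E' < ε → energy α Q E ≤ energy α Q E'

end ChargedDrop

end

noncomputable section

namespace ChargedDrop

open Metric Set Filter Topology

variable {d : ℕ} {α : ℝ}


/-! ### Divergence -/

/-! The competitors exploit a gap between exponents. A ball of radius r has perimeter of order
r^(d-1), while a unit charge spread over it has Riesz energy of order r^(-α). Since α < d-1, one may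
fix α < p < d-1 and spread a unit charge evenly over N ≈ r^(-p) balls of radius r. Their total
perimeter N r^(d-1) and their total self-energy r^(-α)/N both tend to 0. If the centres are sampled
from a probability measure μ, the mutual interaction is asymptotically at most the energy of μ
(`exists_balls_setEnergy_lt`). Adding these balls to E thus costs almost no perimeter or volume and
brings the Riesz energy down to roughly that of any chosen charge living near E.

If P(E) is finite and the Riesz energy is positive, some charge in an arbitrarily small
neighbourhood of E has strictly less energy than E (`exists_rieszEnergy_lt_thickening`): push a
nearly optimal charge forward by a distance-expanding map close to the identity. The gain is
quantitative because nearly optimal charges keep a quarter of their mass in one fixed ball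
(`exists_ball_measure_ge`).

Two degenerate cases remain. If P(E) is infinite, any nearby set of finite perimeter wins, since
positive finite volume makes the Riesz energy finite. If the Riesz energy vanishes, then E is
unbounded, which excludes compact sets. For open E the perimeter itself can then be lowered
(`exists_perimeter_lt_of_unbounded`): local minimality would make the tails of E almost minimal, and
De Giorgi's iteration would confine E to a ball. The new set is brought Hausdorff-close to E by a
dust of tiny balls with centres dense in E (`exists_dust`), and a few charged balls keep its Riesz
energy tiny.

Volume errors are repaired by a shear close to the identity, of size linear in the L¹ error, which
changes perimeter and Riesz energy by factors close to 1 (`exists_homeomorph_volume_eq`). The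
perimeter estimates come directly from the variational definition: fields are cut off by radial
functions, and a non-optimal isoperimetric inequality follows from averaging translations. Each
competitor is close to E both in L¹ and in the Hausdorff distance. -/

theorem continuous_divergence {T : Space d → Space d} (hT : ContDiff ℝ 1 T) :
    Continuous (divergence T) := by
  unfold divergence
  refine continuous_finsetSum _ fun i _ => ?_
  have h : Continuous fun x => fderiv ℝ T x (EuclideanSpace.single i 1) :=
    (hT.continuous_fderiv one_ne_zero).clm_apply continuous_const
  exact (EuclideanSpace.proj i : Space d →L[ℝ] ℝ).continuous.comp h

theorem hasCompactSupport_divergence {T : Space d → Space d} (hc : HasCompactSupport T) :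
    HasCompactSupport (divergence T) := by
  have h := hc.fderiv (𝕜 := ℝ)
  refine h.mono fun x hx => ?_
  contrapose hx
  simp only [Function.mem_support, not_not] at hx ⊢
  simp [divergence, hx]

theorem integrable_divergence {T : Space d → Space d} (hT : ContDiff ℝ 1 T)
    (hc : HasCompactSupport T) : Integrable (divergence T) :=
  (continuous_divergence hT).integrable_of_hasCompactSupport (hasCompactSupport_divergence hc)

theorem divergence_smul {η : Space d → ℝ} {T : Space d → Space d} {x : Space d}
    (hη : DifferentiableAt ℝ η x) (hT : DifferentiableAt ℝ T x) :
    divergence (fun y => η y • T y) x = η x * divergence T x + fderiv ℝ η x (T x) := by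
  have h2 : fderiv ℝ η x (T x) = ∑ i, T x i * fderiv ℝ η x (EuclideanSpace.single i 1) := by
    conv_lhs => rw [← (EuclideanSpace.basisFun (Fin d) ℝ).sum_repr (T x)]
    simp [map_sum]
  rw [h2]
  unfold divergence
  rw [fderiv_fun_smul hη hT, Finset.mul_sum, ← Finset.sum_add_distrib]
  refine Finset.sum_congr rfl fun i _ => ?_
  simp [mul_comm]

theorem divergence_add {T S : Space d → Space d} {x : Space d}
    (hT : DifferentiableAt ℝ T x) (hS : DifferentiableAt ℝ S x) :
    divergence (fun y => T y + S y) x = divergence T x + divergence S x := by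
  unfold divergence
  rw [fderiv_fun_add hT hS, ← Finset.sum_add_distrib]
  simp

theorem divergence_const (v x : Space d) : divergence (fun _ => v) x = 0 := by
  simp [divergence]

theorem integral_divergence_eq_zero {T : Space d → Space d} (hT : ContDiff ℝ 1 T)
    (hc : HasCompactSupport T) : ∫ x, divergence T x = 0 := by
  have hd : Differentiable ℝ T := hT.differentiable one_ne_zero
  have hcoord : ∀ (i : Fin d) x, fderiv ℝ T x (EuclideanSpace.single i 1) i
      = fderiv ℝ (fun y => T y i) x (EuclideanSpace.single i 1) := by
    intro i x
    have h := ((EuclideanSpace.proj i : Space d →L[ℝ] ℝ).hasFDerivAt.comp x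
      (hd x).hasFDerivAt).fderiv
    have h' : ((EuclideanSpace.proj i : Space d →L[ℝ] ℝ) : Space d → ℝ) ∘ T = fun y => T y i := rfl
    rw [h'] at h
    rw [h]; rfl
  have hTi : ∀ i : Fin d, ContDiff ℝ 1 fun y => T y i := fun i =>
    (EuclideanSpace.proj i : Space d →L[ℝ] ℝ).contDiff.comp hT
  have hci : ∀ i : Fin d, HasCompactSupport fun y => T y i := fun i =>
    hc.comp_left (g := fun v : Space d => v i) rfl
  have hintg : ∀ i : Fin d, Integrable fun x =>
      fderiv ℝ (fun y => T y i) x (EuclideanSpace.single i 1) := by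
    intro i
    refine Continuous.integrable_of_hasCompactSupport ?_ ?_
    · exact ((hTi i).continuous_fderiv one_ne_zero).clm_apply continuous_const
    · exact (hci i).fderiv_apply (𝕜 := ℝ) _
  unfold divergence
  simp_rw [hcoord]
  rw [integral_finsetSum _ fun i _ => hintg i]
  refine Finset.sum_eq_zero fun i _ => ?_
  -- Integration by parts against the constant function `1`.
  have h := integral_mul_fderiv_eq_neg_fderiv_mul_of_integrable (μ := (volume : Measure (Space d)))
    (f := fun _ => (1 : ℝ)) (g := fun y => T y i) (v := EuclideanSpace.single i 1)
    (by simp) (by simpa using hintg i)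
    (by simpa using (hTi i).continuous.integrable_of_hasCompactSupport (hci i))
    (fun x _ => differentiableAt_const _)
    (fun x _ => (hTi i).differentiable one_ne_zero x)
  simpa using h

/-! ### Perimeter -/

theorem ofReal_setIntegral_divergence_le {E : Set (Space d)} {T : Space d → Space d}
    (hT : ContDiff ℝ 1 T) (hc : HasCompactSupport T) (h1 : ∀ x, ‖T x‖ ≤ 1) :
    ENNReal.ofReal (∫ x in E, divergence T x) ≤ perimeter E := by
  unfold perimeter
  exact le_iSup_of_le T (le_iSup_of_le hT (le_iSup_of_le hc (le_iSup_of_le h1 le_rfl)))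

theorem setIntegral_divergence_le {E : Set (Space d)} (hE : perimeter E ≠ ∞)
    {T : Space d → Space d}
    (hT : ContDiff ℝ 1 T) (hc : HasCompactSupport T) (h1 : ∀ x, ‖T x‖ ≤ 1) :
    ∫ x in E, divergence T x ≤ (perimeter E).toReal :=
  (ENNReal.ofReal_le_iff_le_toReal hE).1 (ofReal_setIntegral_divergence_le hT hc h1)

theorem setIntegral_divergence_le_mul {E : Set (Space d)} (hE : perimeter E ≠ ∞)
    {T : Space d → Space d} (hT : ContDiff ℝ 1 T) (hc : HasCompactSupport T) {c : ℝ}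
    (hc0 : 0 ≤ c) (h1 : ∀ x, ‖T x‖ ≤ c) :
    ∫ x in E, divergence T x ≤ c * (perimeter E).toReal := by
  have hdiv : ∀ (a : ℝ) x, divergence (fun y => a • T y) x = a * divergence T x := by
    intro a x
    rw [divergence_smul (differentiableAt_const a) (hT.differentiable one_ne_zero x)]
    simp
  rcases hc0.eq_or_lt with rfl | hpos
  · have h0 : T = fun _ => 0 := funext fun x => norm_le_zero_iff.1 (h1 x)
    simp [h0, divergence_const]
  · have h := setIntegral_divergence_le (E := E) hE (T := fun y => c⁻¹ • T y)
      (by fun_prop) (hc.smul_left (f := fun _ => c⁻¹)) (fun x => by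
        rw [norm_smul, norm_inv, Real.norm_of_nonneg hpos.le, inv_mul_le_iff₀ hpos, mul_one]
        exact h1 x)
    simp_rw [hdiv] at h
    rw [integral_const_mul, inv_mul_le_iff₀ hpos] at h
    exact h

theorem perimeter_le_ofReal {E : Set (Space d)} {c : ℝ}
    (h : ∀ T : Space d → Space d, ContDiff ℝ 1 T → HasCompactSupport T → (∀ x, ‖T x‖ ≤ 1) →
      ∫ x in E, divergence T x ≤ c) : perimeter E ≤ ENNReal.ofReal c := by
  unfold perimeter
  exact iSup_le fun T => iSup_le fun hT => iSup_le fun hc => iSup_le fun h1 =>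
    ENNReal.ofReal_le_ofReal (h T hT hc h1)

/-- Used to exchange open and closed balls, whose boundary spheres are null. -/
theorem perimeter_congr_ae {E F : Set (Space d)} (h : E =ᵐ[volume] F) :
    perimeter E = perimeter F := by
  unfold perimeter
  simp_rw [setIntegral_congr_set h]

@[simp]
theorem perimeter_empty : perimeter (∅ : Set (Space d)) = 0 := by
  simp [perimeter]

/-! ### Radial cutoff functions -/

theorem exists_lipschitz_smoothTransition :
    ∃ C : NNReal, 0 < C ∧ LipschitzWith C Real.smoothTransition := by
  have hs : HasCompactSupport (deriv Real.smoothTransition) := by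
    refine HasCompactSupport.intro (isCompact_Icc (a := (0 : ℝ)) (b := 1)) fun x hx => ?_
    rw [mem_Icc, not_and_or, not_le, not_le] at hx
    rcases hx with hx | hx
    · have : Real.smoothTransition =ᶠ[𝓝 x] fun _ => 0 := by
        filter_upwards [Iio_mem_nhds hx] with y hy
        exact Real.smoothTransition.zero_of_nonpos (le_of_lt hy)
      rw [this.deriv_eq]; simp
    · have : Real.smoothTransition =ᶠ[𝓝 x] fun _ => 1 := by
        filter_upwards [Ioi_mem_nhds hx] with y hy
        exact Real.smoothTransition.one_of_one_le (le_of_lt hy)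
      rw [this.deriv_eq]; simp
  have hd : ContDiff ℝ 1 Real.smoothTransition := Real.smoothTransition.contDiff
  obtain ⟨C, hC⟩ := hs.exists_bound_of_continuous (hd.continuous_deriv le_rfl)
  refine ⟨Real.toNNReal (max C 1), by simp, ?_⟩
  refine lipschitzWith_of_nnnorm_deriv_le (hd.differentiable one_ne_zero) fun x => ?_
  rw [← NNReal.coe_le_coe, coe_nnnorm, Real.coe_toNNReal _ (by positivity)]
  exact (hC x).trans (le_max_left _ _)

/-- A cutoff function which vanishes in a ball, equals `1` off the ball of radius larger by `δ`
and whose gradient is at most `C / δ`. -/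
theorem exists_radial_cutoff (d : ℕ) : ∃ C : ℝ, 0 < C ∧ ∀ (c : Space d) (r δ : ℝ), 0 < r → 0 < δ →
    ∃ η : Space d → ℝ, ContDiff ℝ 1 η ∧ (∀ x, 0 ≤ η x ∧ η x ≤ 1) ∧
      (∀ x ∈ closedBall c r, η x = 0) ∧ (∀ x, x ∉ ball c (r + δ) → η x = 1) ∧
      (∀ x, ‖fderiv ℝ η x‖ ≤ (closedBall c (r + δ) \ ball c r).indicator (fun _ => C / δ) x) := by
  obtain ⟨C, hC0, hC⟩ := exists_lipschitz_smoothTransition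
  refine ⟨C, hC0, fun c r δ hr hδ => ?_⟩
  set η : Space d → ℝ := fun x => Real.smoothTransition ((‖x - c‖ - r) / δ) with hη
  have hzero : ∀ x, ‖x - c‖ ≤ r → η x = 0 := fun x hx =>
    Real.smoothTransition.zero_of_nonpos (div_nonpos_of_nonpos_of_nonneg (by linarith) hδ.le)
  have hone : ∀ x, r + δ ≤ ‖x - c‖ → η x = 1 := fun x hx =>
    Real.smoothTransition.one_of_one_le ((one_le_div hδ).2 (by linarith))
  have hcd : ContDiff ℝ 1 η := by
    rw [contDiff_iff_contDiffAt]
    intro x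
    by_cases hx : x = c
    · have : η =ᶠ[𝓝 x] fun _ => 0 := by
        filter_upwards [ball_mem_nhds x hr] with y hy
        subst hx
        exact hzero y (by rw [mem_ball, dist_eq_norm] at hy; exact hy.le)
      exact contDiffAt_const.congr_of_eventuallyEq this
    · have h1 : ContDiffAt ℝ 1 (fun x : Space d => ‖x - c‖) x :=
        (contDiffAt_norm ℝ (sub_ne_zero.2 hx)).comp x (contDiffAt_id.sub contDiffAt_const)
      exact Real.smoothTransition.contDiffAt.comp x ((h1.sub contDiffAt_const).div_const δ)
  have hlip : LipschitzWith (C * Real.toNNReal (1 / δ)) η := by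
    refine hC.comp (LipschitzWith.of_dist_le_mul fun x y => ?_)
    rw [Real.coe_toNNReal _ (by positivity), Real.dist_eq, ← sub_div, abs_div, abs_of_pos hδ,
      dist_eq_norm, one_div, inv_mul_eq_div]
    gcongr
    have := abs_norm_sub_norm_le (x - c) (y - c)
    simpa using this
  refine ⟨η, hcd, fun x => ⟨Real.smoothTransition.nonneg _, Real.smoothTransition.le_one _⟩,
    fun x hx => hzero x (by rwa [mem_closedBall, dist_eq_norm] at hx),
    fun x hx => hone x (by rw [mem_ball, dist_eq_norm, not_lt] at hx; exact hx), fun x => ?_⟩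
  by_cases hx : x ∈ closedBall c (r + δ) \ ball c r
  · rw [indicator_of_mem hx]
    refine (norm_fderiv_le_of_lipschitz ℝ hlip).trans (le_of_eq ?_)
    rw [NNReal.coe_mul, Real.coe_toNNReal _ (by positivity)]
    ring
  · rw [indicator_of_notMem hx, norm_le_zero_iff]
    have hcont : Continuous fun y : Space d => ‖y - c‖ := by fun_prop
    rw [Set.mem_sdiff, not_and_or, not_not, mem_closedBall, mem_ball, dist_eq_norm, not_le] at hx
    rcases hx with hx | hx
    · have : η =ᶠ[𝓝 x] fun _ => 1 := by
        filter_upwards [hcont.continuousAt.eventually (Ioi_mem_nhds hx)] with y hy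
        exact hone y (le_of_lt hy)
      rw [this.fderiv_eq]; simp
    · have : η =ᶠ[𝓝 x] fun _ => 0 := by
        filter_upwards [hcont.continuousAt.eventually (Iio_mem_nhds hx)] with y hy
        exact hzero y (le_of_lt hy)
      rw [this.fderiv_eq]; simp


/-! ### Unions with balls and truncations -/

theorem integrable_mul_divergence {η : Space d → ℝ} (hη : Continuous η) {T : Space d → Space d}
    (hT : ContDiff ℝ 1 T) (hc : HasCompactSupport T) :
    Integrable fun x => η x * divergence T x :=
  (hη.mul (continuous_divergence hT)).integrable_of_hasCompactSupport
    ((hasCompactSupport_divergence hc).mul_left)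

theorem integrable_fderiv_apply {η : Space d → ℝ} (hη : ContDiff ℝ 1 η) {T : Space d → Space d}
    (hT : ContDiff ℝ 1 T) (hc : HasCompactSupport T) :
    Integrable fun x => fderiv ℝ η x (T x) := by
  refine ((hη.continuous_fderiv one_ne_zero).clm_apply
    hT.continuous).integrable_of_hasCompactSupport (hc.mono fun x hx => ?_)
  contrapose hx
  simp only [Function.mem_support, not_not] at hx ⊢
  simp [hx]

theorem setIntegral_le_of_abs_le_indicator {f : Space d → ℝ} {A S : Set (Space d)}
    (hf : Integrable f) (hS : MeasurableSet S) (hSf : volume S ≠ ∞) {c : ℝ}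
    (h : ∀ x, |f x| ≤ S.indicator (fun _ => c) x) :
    ∫ x in A, f x ≤ c * volume.real (A ∩ S) := by
  have hi : IntegrableOn (S.indicator fun _ => c) A :=
    ((integrable_indicator_iff hS).2 (integrableOn_const hSf)).integrableOn
  calc ∫ x in A, f x ≤ ∫ x in A, S.indicator (fun _ => c) x :=
        integral_mono hf.integrableOn hi fun x => (le_abs_self _).trans (h x)
    _ = c * volume.real (A ∩ S) := by
        rw [setIntegral_indicator hS, setIntegral_const, smul_eq_mul, mul_comm]

theorem cutoff_apply_le {η : Space d → ℝ} {S : Set (Space d)} {c : ℝ}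
    (hg : ∀ x, ‖fderiv ℝ η x‖ ≤ S.indicator (fun _ => c) x) {v x : Space d} {b : ℝ}
    (hb : 0 ≤ b) (hv : ‖v‖ ≤ b) :
    |fderiv ℝ η x v| ≤ S.indicator (fun _ => c * b) x := by
  have h1 : |fderiv ℝ η x v| ≤ ‖fderiv ℝ η x‖ * b :=
    ((fderiv ℝ η x).le_opNorm v).trans (by gcongr)
  refine h1.trans ?_
  have := mul_le_mul_of_nonneg_right (hg x) hb
  refine this.trans (le_of_eq ?_)
  by_cases hx : x ∈ S <;> simp [hx]

/-- When `η` approaches the indicator of the complement of a ball, the left side becomes the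
integral over the union of `A` with that ball. Testing `A` with `η T` leaves the error `-∫_A ∇η·T`;
because the total divergence of `η T` vanishes, the second integral equals `∫ ∇η·T`, so only the
part of this error on the complement of `A` survives. -/
theorem cutoff_union_le {A : Set (Space d)} (hA : MeasurableSet A) (hP : perimeter A ≠ ∞)
    {η : Space d → ℝ} (hη : ContDiff ℝ 1 η) (h01 : ∀ x, 0 ≤ η x ∧ η x ≤ 1)
    {S : Set (Space d)} (hS : MeasurableSet S) (hSf : volume S ≠ ∞) {c : ℝ} (hc0 : 0 ≤ c)
    (hg : ∀ x, ‖fderiv ℝ η x‖ ≤ S.indicator (fun _ => c) x) {T : Space d → Space d}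
    (hT : ContDiff ℝ 1 T) (hc : HasCompactSupport T) (h1 : ∀ x, ‖T x‖ ≤ 1) :
    (∫ x in A, η x * divergence T x) + ∫ x, (1 - η x) * divergence T x
      ≤ (perimeter A).toReal + c * volume.real S := by
  have hηT : ContDiff ℝ 1 fun x => η x • T x := by fun_prop
  have hcT : HasCompactSupport fun x => η x • T x := hc.smul_left (f := η)
  have hdiv : ∀ x, divergence (fun x => η x • T x) x = η x * divergence T x + fderiv ℝ η x (T x) :=
    fun x => divergence_smul (hη.differentiable one_ne_zero x) (hT.differentiable one_ne_zero x)
  have hle := setIntegral_divergence_le hP hηT hcT fun x => by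
    rw [norm_smul, Real.norm_of_nonneg (h01 x).1]
    exact mul_le_one₀ (h01 x).2 (norm_nonneg _) (h1 x)
  have hzero := integral_divergence_eq_zero hηT hcT
  have hzero' := integral_divergence_eq_zero hT hc
  have i1 := integrable_mul_divergence hη.continuous hT hc
  have i2 := integrable_fderiv_apply hη hT hc
  simp_rw [hdiv] at hle hzero
  rw [integral_add i1 i2] at hzero
  rw [integral_add i1.integrableOn i2.integrableOn] at hle
  have h3 : ∫ x, (1 - η x) * divergence T x = -∫ x, η x * divergence T x := by
    simp_rw [sub_mul, one_mul]
    rw [integral_sub (integrable_divergence hT hc) i1, hzero', zero_sub]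
  have h4 : (∫ x in A, fderiv ℝ η x (T x)) + ∫ x in Aᶜ, fderiv ℝ η x (T x)
      = ∫ x, fderiv ℝ η x (T x) := integral_add_compl hA i2
  have h5 : ∫ x in Aᶜ, fderiv ℝ η x (T x) ≤ c * 1 * volume.real (Aᶜ ∩ S) :=
    setIntegral_le_of_abs_le_indicator i2 hS hSf
      (fun x => cutoff_apply_le hg zero_le_one (h1 x))
  rw [mul_one] at h5
  have h6 : volume.real (Aᶜ ∩ S) ≤ volume.real S := measureReal_mono inter_subset_right hSf
  have h7 : c * volume.real (Aᶜ ∩ S) ≤ c * volume.real S := by gcongr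
  rw [h3]
  generalize (∫ x in A, fderiv ℝ η x (T x)) = a at *
  generalize (∫ x in Aᶜ, fderiv ℝ η x (T x)) = b at *
  generalize (∫ x, fderiv ℝ η x (T x)) = e at *
  linarith

/-- The glued field `(1 - η) T + η U` is admissible for `A`. Its error is `∇η·(T - U)`, whence the
factor 2. Independent fields inside and outside allow both pieces of a truncated set to be tested at
once. -/
theorem cutoff_split_le {A : Set (Space d)} (hP : perimeter A ≠ ∞)
    {η : Space d → ℝ} (hη : ContDiff ℝ 1 η) (h01 : ∀ x, 0 ≤ η x ∧ η x ≤ 1)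
    {S : Set (Space d)} (hS : MeasurableSet S) (hSf : volume S ≠ ∞) {c : ℝ}
    (hg : ∀ x, ‖fderiv ℝ η x‖ ≤ S.indicator (fun _ => c) x) {T U : Space d → Space d}
    (hT : ContDiff ℝ 1 T) (hcT : HasCompactSupport T) (hT1 : ∀ x, ‖T x‖ ≤ 1)
    (hU : ContDiff ℝ 1 U) (hcU : HasCompactSupport U) (hU1 : ∀ x, ‖U x‖ ≤ 1) :
    (∫ x in A, (1 - η x) * divergence T x) + ∫ x in A, η x * divergence U x
      ≤ (perimeter A).toReal + 2 * c * volume.real (A ∩ S) := by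
  have hη' : ContDiff ℝ 1 fun x => 1 - η x := by fun_prop
  have dη := hη.differentiable one_ne_zero
  have dT := hT.differentiable one_ne_zero
  have dU := hU.differentiable one_ne_zero
  have hdiv : ∀ x, divergence (fun x => (1 - η x) • T x + η x • U x) x =
      ((1 - η x) * divergence T x + η x * divergence U x)
        - (fderiv ℝ η x (T x) - fderiv ℝ η x (U x)) := by
    intro x
    rw [divergence_add (T := fun x => (1 - η x) • T x) (S := fun x => η x • U x)
        (((hη'.differentiable one_ne_zero) x).smul (dT x)) ((dη x).smul (dU x)),
      divergence_smul ((hη'.differentiable one_ne_zero) x) (dT x), divergence_smul (dη x) (dU x)]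
    rw [fderiv_const_sub]
    simp only [neg_apply]
    ring
  have hle := setIntegral_divergence_le hP (T := fun x => (1 - η x) • T x + η x • U x)
    (by fun_prop) ((hcT.smul_left (f := fun x => 1 - η x)).add (hcU.smul_left (f := η))) fun x => by
    obtain ⟨h0, h1⟩ := h01 x
    have h2 := norm_add_le ((1 - η x) • T x) (η x • U x)
    rw [norm_smul, norm_smul, Real.norm_of_nonneg h0, Real.norm_of_nonneg (sub_nonneg.2 h1)] at h2
    have := hT1 x
    have := hU1 x
    nlinarith
  have i1 := integrable_mul_divergence hη'.continuous hT hcT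
  have i2 := integrable_mul_divergence hη.continuous hU hcU
  have i3 := integrable_fderiv_apply hη hT hcT
  have i4 := integrable_fderiv_apply hη hU hcU
  have i12 : Integrable fun x => (1 - η x) * divergence T x + η x * divergence U x := i1.add i2
  have i34 : Integrable fun x => fderiv ℝ η x (T x) - fderiv ℝ η x (U x) := i3.sub i4
  simp_rw [hdiv] at hle
  rw [integral_sub i12.integrableOn i34.integrableOn, integral_add i1.integrableOn i2.integrableOn] at hle
  have h5 := setIntegral_le_of_abs_le_indicator (A := A)
    (f := fun x => fderiv ℝ η x (T x) - fderiv ℝ η x (U x)) i34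
    hS hSf (c := c * 2) fun x => by
    rw [← map_sub]
    exact cutoff_apply_le hg zero_le_two
      ((norm_sub_le _ _).trans (by linarith [hT1 x, hU1 x]))
  linarith

theorem one_add_pow_le {s : ℝ} (hs : 0 ≤ s) (hs1 : s ≤ 1) (n : ℕ) :
    (1 + s) ^ n ≤ 1 + s * (2 ^ n - 1) := by
  induction n with
  | zero => simp
  | succ n ih =>
    have h2 : (1 : ℝ) ≤ 2 ^ n := one_le_pow₀ (by norm_num)
    calc (1 + s) ^ (n + 1) = (1 + s) ^ n * (1 + s) := pow_succ _ _
      _ ≤ (1 + s * (2 ^ n - 1)) * (1 + s) := by gcongr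
      _ ≤ 1 + s * (2 ^ (n + 1) - 1) := by
        have : s * s * (2 ^ n - 1) ≤ s * (2 ^ n - 1) := by nlinarith [mul_nonneg hs (sub_nonneg.2 h2)]
        rw [pow_succ]; nlinarith

/-- Adding a ball increases the perimeter at most by a multiple of `r ^ (d - 1)`. -/
theorem exists_perimeter_union_closedBall_le (hd : 1 ≤ d) : ∃ C : ℝ, 0 < C ∧
    ∀ A : Set (Space d), MeasurableSet A → ∀ (c : Space d) (r : ℝ), 0 < r →
      perimeter (A ∪ closedBall c r) ≤ perimeter A + ENNReal.ofReal (C * r ^ (d - 1)) := by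
  obtain ⟨C, hC, hcut⟩ := exists_radial_cutoff d
  set ω : ℝ := volume.real (ball (0 : Space d) 1)
  have hω0 : 0 ≤ ω := measureReal_nonneg
  have hK : 0 ≤ C * 2 ^ d * ω := by positivity
  refine ⟨C * 2 ^ d * ω + 1, by positivity, fun A hA c r hr => ?_⟩
  by_cases hP : perimeter A = ∞
  · simp [hP]
  rw [← ENNReal.ofReal_toReal hP, ← ENNReal.ofReal_add ENNReal.toReal_nonneg (by positivity)]
  refine perimeter_le_ofReal fun T hT hc h1 => ?_
  have hδ : ∀ n : ℕ, 0 < r * (1 / ((n : ℝ) + 1)) := fun n => by positivity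
  choose η hη h01 hin hout hg using fun n : ℕ => hcut c r (r * (1 / ((n : ℝ) + 1))) hr (hδ n)
  set B := closedBall c r
  have hlim : Tendsto (fun n => (∫ x in A, η n x * divergence T x)
      + ∫ x, (1 - η n x) * divergence T x) atTop (𝓝 (∫ x in A ∪ B, divergence T x)) := by
    have hT' := integrable_divergence hT hc
    have h2 : ∀ n, (∫ x in A, η n x * divergence T x) + ∫ x, (1 - η n x) * divergence T x
        = ∫ x, (A.indicator (fun x => η n x * divergence T x) x
          + (1 - η n x) * divergence T x) := by
      intro n
      rw [integral_add ((integrable_mul_divergence (hη n).continuous hT hc).indicator hA)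
        (integrable_mul_divergence (by have := (hη n).continuous; fun_prop) hT hc),
        integral_indicator hA]
    simp_rw [h2]
    rw [← integral_indicator (hA.union measurableSet_closedBall)]
    refine tendsto_integral_of_dominated_convergence (fun x => 2 * |divergence T x|) ?_
      (hT'.abs.const_mul 2) ?_ ?_
    · intro n
      exact (((integrable_mul_divergence (hη n).continuous hT hc).indicator hA).add
        (integrable_mul_divergence (by have := (hη n).continuous; fun_prop) hT hc)).aestronglyMeasurable
    · intro n
      refine Eventually.of_forall fun x => ?_
      obtain ⟨a, b⟩ := h01 n x
      have hD := abs_nonneg (divergence T x)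
      have e1 : |A.indicator (fun x => η n x * divergence T x) x| ≤ |divergence T x| := by
        by_cases hx : x ∈ A
        · rw [indicator_of_mem hx, abs_mul, abs_of_nonneg a]; nlinarith
        · simp [hx]
      have e2 : |(1 - η n x) * divergence T x| ≤ |divergence T x| := by
        rw [abs_mul, abs_of_nonneg (sub_nonneg.2 b)]; nlinarith
      rw [Real.norm_eq_abs]
      linarith [abs_add_le (A.indicator (fun x => η n x * divergence T x) x)
        ((1 - η n x) * divergence T x)]
    · refine Eventually.of_forall fun x => ?_
      refine tendsto_const_nhds.congr' ?_
      by_cases hx : x ∈ B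
      · refine Eventually.of_forall fun n => ?_
        have hxU : x ∈ A ∪ closedBall c r := Or.inr hx
        simp only [indicator_of_mem hxU]
        by_cases hxA : x ∈ A <;> simp [hxA, hin n x hx]
      · have hx' : r < dist x c := by simpa [B] using hx
        have hl : Tendsto (fun n : ℕ => r + r * (1 / ((n : ℝ) + 1))) atTop (𝓝 (r + r * 0)) :=
          (tendsto_one_div_add_atTop_nhds_zero_nat.const_mul r).const_add r
        filter_upwards [hl.eventually (p := fun y => y < dist x c) (Iio_mem_nhds (by simpa using hx'))] with n hn
        have h1 := hout n x (by simpa using hn.le)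
        by_cases hxA : x ∈ A <;> simp_all [B]
  refine le_of_tendsto hlim (Eventually.of_forall fun n => ?_)
  set s : ℝ := 1 / ((n : ℝ) + 1) with hs
  have hs0 : 0 < s := by positivity
  have hs1 : s ≤ 1 := by rw [hs, div_le_one (by positivity)]; linarith [(Nat.cast_nonneg n : (0:ℝ) ≤ n)]
  have hSf : volume (closedBall c (r + r * s) \ ball c r) ≠ ∞ :=
    ne_top_of_le_ne_top measure_closedBall_lt_top.ne (measure_mono sdiff_subset)
  refine (cutoff_union_le hA hP (hη n) (h01 n) (measurableSet_closedBall.diff measurableSet_ball)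
    hSf (by positivity) (hg n) hT hc h1).trans (add_le_add_right ?_ _)
  have hvol : volume.real (closedBall c (r + r * s) \ ball c r) = ((r + r * s) ^ d - r ^ d) * ω := by
    rw [measureReal_sdiff (ball_subset_closedBall.trans (closedBall_subset_closedBall
      (by nlinarith))) measurableSet_ball measure_closedBall_lt_top.ne,
      Measure.addHaar_real_closedBall _ _ (by positivity)]
    have : volume.real (ball c r) = r ^ d * ω := by
      rw [measureReal_def, Measure.addHaar_ball_of_pos _ _ hr, ENNReal.toReal_mul,
        ENNReal.toReal_ofReal (by positivity), finrank_euclideanSpace_fin]; rfl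
    rw [this, finrank_euclideanSpace_fin]; ring
  rw [hvol]
  have h3 : (r + r * s) ^ d - r ^ d ≤ r ^ d * (s * 2 ^ d) := by
    have := one_add_pow_le hs0.le hs1 d
    have e : (r + r * s) ^ d = r ^ d * (1 + s) ^ d := by rw [← mul_pow]; ring
    rw [e]
    have hrd : 0 < r ^ d := by positivity
    nlinarith
  have hrd : r ^ d = r * r ^ (d - 1) := by
    conv_lhs => rw [← Nat.sub_add_cancel hd, pow_succ, mul_comm]
  -- The gradient is of order `1 / (r * s)` and the shell has volume of order `r ^ d * s`; the
  -- relative width `s` cancels, so the bound is uniform as the cutoff sharpens.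
  calc C / (r * s) * (((r + r * s) ^ d - r ^ d) * ω)
      ≤ C / (r * s) * (r ^ d * (s * 2 ^ d) * ω) := by gcongr
    _ = C * 2 ^ d * ω * r ^ (d - 1) := by rw [hrd]; field_simp
    _ ≤ (C * 2 ^ d * ω + 1) * r ^ (d - 1) := by gcongr; linarith


theorem ball_ae_eq_closedBall (hd : 1 ≤ d) (c : Space d) (r : ℝ) :
    ball c r =ᵐ[volume] closedBall c r := by
  have : Nonempty (Fin d) := ⟨⟨0, hd⟩⟩
  refine ae_eq_set.2 ⟨by simp [sdiff_eq_empty.2 ball_subset_closedBall], ?_⟩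
  rw [closedBall_sdiff_ball]
  exact Measure.addHaar_sphere _ _ _

theorem perimeter_union_biUnion_closedBall_le {C : ℝ}
    (hC : ∀ A : Set (Space d), MeasurableSet A → ∀ (c : Space d) (r : ℝ), 0 < r →
      perimeter (A ∪ closedBall c r) ≤ perimeter A + ENNReal.ofReal (C * r ^ (d - 1)))
    {ι : Type*} (s : Finset ι) {A : Set (Space d)} (hA : MeasurableSet A) (c : ι → Space d)
    (r : ι → ℝ) (hr : ∀ i, 0 < r i) :
    perimeter (A ∪ ⋃ i ∈ s, closedBall (c i) (r i))
      ≤ perimeter A + ∑ i ∈ s, ENNReal.ofReal (C * r i ^ (d - 1)) := by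
  classical
  induction s using Finset.induction_on with
  | empty => simp
  | insert a s ha ih =>
    rw [Finset.set_biUnion_insert, Finset.sum_insert ha, union_comm (closedBall _ _),
      ← union_assoc, add_comm (ENNReal.ofReal _), ← add_assoc]
    refine (hC _ (hA.union (Finset.measurableSet_biUnion _ fun i _ =>
      measurableSet_closedBall)) _ _ (hr a)).trans ?_
    gcongr

/-- Adding countably many balls increases the perimeter at most by a multiple of
`∑ rᵢ ^ (d - 1)`. -/
theorem exists_perimeter_union_iUnion_ball_le (hd : 1 ≤ d) : ∃ C : ℝ, 0 < C ∧
    ∀ A : Set (Space d), MeasurableSet A → ∀ (c : ℕ → Space d) (r : ℕ → ℝ), (∀ i, 0 < r i) →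
      perimeter (A ∪ ⋃ i, ball (c i) (r i))
        ≤ perimeter A + ∑' i, ENNReal.ofReal (C * r i ^ (d - 1)) := by
  obtain ⟨C, hC0, hC⟩ := exists_perimeter_union_closedBall_le hd
  refine ⟨C, hC0, fun A hA c r hr => ?_⟩
  set S : ℕ → Set (Space d) := fun n => A ∪ ⋃ i ∈ Finset.range n, closedBall (c i) (r i)
  have hS : ∀ n, MeasurableSet (S n) := fun n =>
    hA.union (Finset.measurableSet_biUnion _ fun i _ => measurableSet_closedBall)
  have hmono : Monotone S := fun m n hmn => union_subset_union_right _
    (biUnion_subset_biUnion_left (Finset.range_mono hmn))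
  have hU : (⋃ n, S n) =ᵐ[volume] (A ∪ ⋃ i, ball (c i) (r i) : Set (Space d)) := by
    have h1 : ⋃ n, S n = A ∪ ⋃ i, closedBall (c i) (r i) := by
      ext x
      simp only [S, mem_iUnion, mem_union, Finset.mem_range, exists_prop]
      constructor
      · rintro ⟨n, h | ⟨i, -, h⟩⟩
        exacts [Or.inl h, Or.inr ⟨i, h⟩]
      · rintro (h | ⟨i, h⟩)
        exacts [⟨0, Or.inl h⟩, ⟨i + 1, Or.inr ⟨i, Nat.lt_succ_self i, h⟩⟩]
    rw [h1]
    exact (ae_eq_refl A).union (Filter.EventuallyEq.countable_iUnion fun i =>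
      (ball_ae_eq_closedBall hd _ _).symm)
  rw [← perimeter_congr_ae hU]
  unfold perimeter
  refine iSup_le fun T => iSup_le fun hT => iSup_le fun hc => iSup_le fun h1 => ?_
  -- Lower semicontinuity of the perimeter along the increasing finite unions: for each fixed field
  -- the integrals converge.
  have hl := tendsto_setIntegral_of_monotone hS hmono
    (integrable_divergence hT hc).integrableOn
  refine le_of_tendsto (ENNReal.tendsto_ofReal hl) (Eventually.of_forall fun n => ?_)
  refine (ofReal_setIntegral_divergence_le hT hc h1).trans ?_
  refine (perimeter_union_biUnion_closedBall_le hC _ hA c r hr).trans ?_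
  exact add_le_add le_rfl (ENNReal.sum_le_tsum _)

/-! ### Truncation by balls -/

/-- A monotone function is differentiable almost everywhere and the integral of its derivative is at
most its increment, so some point has derivative at most the average slope. -/
theorem exists_deriv_le_slope {W : ℝ → ℝ} (hW : Monotone W) {a b : ℝ} (hab : a < b) :
    ∃ r ∈ Ioo a b, ∃ w, HasDerivAt W w r ∧ w ≤ (W b - W a) / (b - a) := by
  have h1 := (hW.monotoneOn (uIcc a b)).intervalIntegrable_deriv
  have h2 := (hW.monotoneOn (uIcc a b)).intervalIntegral_deriv_mem_uIcc
  rw [uIcc_of_le (sub_nonneg.2 (hW hab.le))] at h2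
  have hintg : IntegrableOn (deriv W) (Ioo a b) :=
    ((intervalIntegrable_iff_integrableOn_Ioc_of_le hab.le).1 h1).mono_set Ioo_subset_Ioc_self
  have hnull : (volume.restrict (Ioo a b)) {x | ¬(DifferentiableAt ℝ W x ∧ x ∈ Ioo a b)} = 0 := by
    have : ∀ᵐ x ∂(volume.restrict (Ioo a b)), DifferentiableAt ℝ W x ∧ x ∈ Ioo a b :=
      (ae_restrict_of_ae hW.ae_differentiableAt).and (ae_restrict_mem measurableSet_Ioo)
    exact this
  have : NeZero (volume.restrict (Ioo a b)) := ⟨by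
    rw [Ne, Measure.restrict_eq_zero, Real.volume_Ioo]; simpa using hab⟩
  obtain ⟨r, hr, hle⟩ := exists_notMem_null_le_average (NeZero.ne _) hintg hnull
  simp only [mem_ofPred_eq, not_not] at hr
  refine ⟨r, hr.2, deriv W r, hr.1.hasDerivAt, hle.trans ?_⟩
  have : ∫ x in Ioo a b, deriv W x = ∫ x in a..b, deriv W x := by
    rw [intervalIntegral.integral_of_le hab.le, integral_Ioc_eq_integral_Ioo]
  rw [setAverage_eq, this, Real.volume_real_Ioo_of_le hab.le, smul_eq_mul, inv_mul_eq_div]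
  have := sub_pos.2 hab
  gcongr
  exact h2.2

/-- Some sphere of radius between `R` and `R + h` splits `E` into two sets of controlled
perimeter. -/
theorem exists_perimeter_truncation_le (hd : 1 ≤ d) : ∃ C : ℝ, 0 < C ∧
    ∀ E : Set (Space d), MeasurableSet E → volume E ≠ ∞ → perimeter E ≠ ∞ →
      ∀ R h : ℝ, 0 < R → 0 < h → ∃ r ∈ Ioo R (R + h),
        perimeter (E ∩ ball 0 r) ≠ ∞ ∧ perimeter (E \ ball 0 r) ≠ ∞ ∧
        (perimeter (E ∩ ball 0 r)).toReal + (perimeter (E \ ball 0 r)).toReal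
          ≤ (perimeter E).toReal + C * (volume.real (E \ ball 0 R) / h) := by
  obtain ⟨C, hC, hcut⟩ := exists_radial_cutoff d
  refine ⟨2 * C, by positivity, fun E hE hEv hP R h hR hh => ?_⟩
  set W : ℝ → ℝ := fun r => volume.real (E ∩ ball 0 r)
  have hfin : ∀ s : Set (Space d), volume (E ∩ s) ≠ ∞ := fun s =>
    ne_top_of_le_ne_top hEv (measure_mono inter_subset_left)
  have hW : Monotone W := fun a b hab =>
    measureReal_mono (inter_subset_inter_right _ (ball_subset_ball hab)) (hfin _)
  -- The growth rate `w` of the volume of `E ∩ ball 0 r` plays the role of the area of the slice of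
  -- `E` by the sphere; the radius is chosen so that this slice is no larger than average.
  obtain ⟨r, hr, w, hw, hwle⟩ := exists_deriv_le_slope hW (lt_add_of_pos_right R hh)
  have hr0 : 0 < r := hR.trans hr.1
  have hwle' : w ≤ volume.real (E \ ball 0 R) / h := by
    refine hwle.trans ?_
    rw [add_sub_cancel_left]
    gcongr
    have : W R + volume.real (E \ ball 0 R) = volume.real E :=
      measureReal_inter_add_sdiff measurableSet_ball hEv
    have h2 : W (R + h) ≤ volume.real E := measureReal_mono inter_subset_left hEv
    linarith
  -- Cutoffs across a shell of width `1 / (n + 1)` give an error proportional to the volume of `E`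
  -- in the shell divided by its width, which tends to `w`.
  have key : ∀ T U : Space d → Space d, ContDiff ℝ 1 T → HasCompactSupport T → (∀ x, ‖T x‖ ≤ 1) →
      ContDiff ℝ 1 U → HasCompactSupport U → (∀ x, ‖U x‖ ≤ 1) →
      (∫ x in E ∩ ball 0 r, divergence T x) + ∫ x in E \ ball 0 r, divergence U x
        ≤ (perimeter E).toReal + 2 * C * w := by
    intro T U hT hcT hT1 hU hcU hU1
    have hδ : ∀ n : ℕ, 0 < 1 / ((n : ℝ) + 1) := fun n => by positivity
    have hδl : Tendsto (fun n : ℕ => 1 / ((n : ℝ) + 1)) atTop (𝓝 0) :=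
      tendsto_one_div_add_atTop_nhds_zero_nat
    choose η hη h01 hin hout hg using fun n : ℕ => hcut (0 : Space d) r (1 / ((n : ℝ) + 1)) hr0 (hδ n)
    have hptw : ∀ x, Tendsto (fun n => η n x) atTop
        (𝓝 ((closedBall (0 : Space d) r)ᶜ.indicator 1 x)) := by
      intro x
      refine tendsto_const_nhds.congr' ?_
      by_cases hx : x ∈ closedBall (0 : Space d) r
      · exact Eventually.of_forall fun n => by simp [hin n x hx, hx]
      · have hx' : r < dist x 0 := by simpa using hx
        have hl := hδl.const_add r
        filter_upwards [hl.eventually (p := fun y => y < dist x 0)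
          (Iio_mem_nhds (by simpa using hx'))] with n hn
        rw [hout n x (by simpa using hn.le)]
        rw [indicator_of_mem hx]; rfl
    have lim2 : Tendsto (fun n => ∫ x in E, η n x * divergence U x) atTop
        (𝓝 (∫ x in E \ ball 0 r, divergence U x)) := by
      have e : ∫ x in E \ ball 0 r, divergence U x
          = ∫ x in E, (closedBall (0 : Space d) r)ᶜ.indicator 1 x * divergence U x := by
        have e1 : ∀ x, (closedBall (0 : Space d) r)ᶜ.indicator 1 x * divergence U x
            = (closedBall (0 : Space d) r)ᶜ.indicator (divergence U) x := by
          intro x; by_cases hx : x ∈ (closedBall (0 : Space d) r)ᶜ <;> simp [indicator, hx]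
        simp_rw [e1]
        rw [setIntegral_indicator measurableSet_closedBall.compl]
        refine setIntegral_congr_set ?_
        exact (ae_eq_refl E).inter (ball_ae_eq_closedBall hd 0 r).compl
      rw [e]
      refine tendsto_integral_of_dominated_convergence (fun x => |divergence U x|)
        (fun n => (integrable_mul_divergence (hη n).continuous hU hcU).integrableOn.aestronglyMeasurable)
        (integrable_divergence hU hcU).abs.integrableOn (fun n => Eventually.of_forall fun x => ?_)
        (Eventually.of_forall fun x => (hptw x).mul_const _)
      rw [norm_mul, Real.norm_of_nonneg (h01 n x).1]
      exact mul_le_of_le_one_left (norm_nonneg _) (h01 n x).2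
    have lim1 : Tendsto (fun n => ∫ x in E, (1 - η n x) * divergence T x) atTop
        (𝓝 (∫ x in E ∩ ball 0 r, divergence T x)) := by
      have e : ∫ x in E ∩ ball 0 r, divergence T x
          = ∫ x in E, (1 - (closedBall (0 : Space d) r)ᶜ.indicator 1 x) * divergence T x := by
        have e1 : ∀ x, (1 - (closedBall (0 : Space d) r)ᶜ.indicator 1 x) * divergence T x
            = (closedBall (0 : Space d) r).indicator (divergence T) x := by
          intro x; by_cases hx : x ∈ closedBall (0 : Space d) r <;> simp [indicator, hx]
        simp_rw [e1]
        rw [setIntegral_indicator measurableSet_closedBall]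
        refine setIntegral_congr_set ?_
        exact (ae_eq_refl E).inter (ball_ae_eq_closedBall hd 0 r)
      rw [e]
      refine tendsto_integral_of_dominated_convergence (fun x => |divergence T x|)
        (fun n => (integrable_mul_divergence (η := fun x => 1 - η n x)
          (by have := (hη n).continuous; fun_prop) hT hcT).integrableOn.aestronglyMeasurable)
        (integrable_divergence hT hcT).abs.integrableOn (fun n => Eventually.of_forall fun x => ?_)
        (Eventually.of_forall fun x => ((hptw x).const_sub 1).mul_const _)
      obtain ⟨a, b⟩ := h01 n x
      rw [norm_mul, Real.norm_of_nonneg (sub_nonneg.2 b)]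
      exact mul_le_of_le_one_left (norm_nonneg _) (by linarith)
    have hslope : Tendsto (fun n : ℕ => (1 / ((n : ℝ) + 1))⁻¹ *
        (W (r + 1 / ((n : ℝ) + 1)) - W r)) atTop (𝓝 w) := by
      have h3 := hw.tendsto_slope_zero_right
      have h4 : Tendsto (fun n : ℕ => 1 / ((n : ℝ) + 1)) atTop (𝓝[>] 0) :=
        tendsto_nhdsWithin_iff.2 ⟨hδl, Eventually.of_forall hδ⟩
      exact h3.comp h4
    refine le_of_tendsto_of_tendsto' (lim1.add lim2) ((hslope.const_mul (2 * C)).const_add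
      (perimeter E).toReal) fun n => ?_
    set δ : ℝ := 1 / ((n : ℝ) + 1)
    have hδ0 : 0 < δ := hδ n
    have hSf : volume (closedBall (0 : Space d) (r + δ) \ ball 0 r) ≠ ∞ :=
      ne_top_of_le_ne_top measure_closedBall_lt_top.ne (measure_mono sdiff_subset)
    refine (cutoff_split_le hP (hη n) (h01 n) (measurableSet_closedBall.diff measurableSet_ball)
      hSf (hg n) hT hcT hT1 hU hcU hU1).trans (le_of_eq ?_)
    have hvol : volume.real (E ∩ (closedBall (0 : Space d) (r + δ) \ ball 0 r)) = W (r + δ) - W r := by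
      have e1 : volume.real (E ∩ (closedBall (0 : Space d) (r + δ) \ ball 0 r))
          = volume.real (E ∩ (ball (0 : Space d) (r + δ) \ ball 0 r)) :=
        measureReal_congr ((ae_eq_refl E).inter
          ((ball_ae_eq_closedBall hd 0 (r + δ)).symm.diff (ae_eq_refl _)))
      rw [e1, inter_sdiff_distrib_left, measureReal_sdiff (inter_subset_inter_right _
        (ball_subset_ball (by linarith))) (hE.inter measurableSet_ball) (hfin _)]
    rw [hvol]
    ring
  -- In `key` the fields `T` and `U` are independent: taking the supremum over `T` first and over
  -- `U` afterwards turns it into a bound on the sum of the two perimeters. The zero field supplies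
  -- finiteness and nonnegativity.
  set c := (perimeter E).toReal + 2 * C * w with hc
  have z1 : ContDiff ℝ 1 (fun _ : Space d => (0 : Space d)) := contDiff_const
  have z2 : HasCompactSupport (fun _ : Space d => (0 : Space d)) := HasCompactSupport.zero
  have z3 : ∀ x : Space d, ‖(fun _ : Space d => (0 : Space d)) x‖ ≤ 1 := by simp
  have hp1 : ∀ U : Space d → Space d, ContDiff ℝ 1 U → HasCompactSupport U → (∀ x, ‖U x‖ ≤ 1) →
      perimeter (E ∩ ball 0 r) ≤ ENNReal.ofReal (c - ∫ x in E \ ball 0 r, divergence U x) := by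
    intro U hU hcU hU1
    refine perimeter_le_ofReal fun T hT hcT hT1 => ?_
    linarith [key T U hT hcT hT1 hU hcU hU1]
  have hf1 : perimeter (E ∩ ball 0 r) ≠ ∞ := ne_top_of_le_ne_top ENNReal.ofReal_ne_top (hp1 _ z1 z2 z3)
  have hp1' : ∀ U : Space d → Space d, ContDiff ℝ 1 U → HasCompactSupport U → (∀ x, ‖U x‖ ≤ 1) →
      (perimeter (E ∩ ball 0 r)).toReal ≤ c - ∫ x in E \ ball 0 r, divergence U x := by
    intro U hU hcU hU1
    refine ENNReal.toReal_le_of_le_ofReal ?_ (hp1 U hU hcU hU1)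
    have := key _ U z1 z2 z3 hU hcU hU1
    simp only [divergence_const, integral_zero] at this
    linarith
  have h2 : perimeter (E \ ball 0 r) ≤ ENNReal.ofReal (c - (perimeter (E ∩ ball 0 r)).toReal) := by
    refine perimeter_le_ofReal fun U hU hcU hU1 => ?_
    linarith [hp1' U hU hcU hU1]
  have h3 : (perimeter (E ∩ ball 0 r)).toReal ≤ c := by
    have := hp1' _ z1 z2 z3
    simpa only [divergence_const, integral_zero, sub_zero] using this
  refine ⟨r, hr, hf1, ne_top_of_le_ne_top ENNReal.ofReal_ne_top h2, ?_⟩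
  have h4 := ENNReal.toReal_le_of_le_ofReal (sub_nonneg.2 h3) h2
  have h5 : 2 * C * w ≤ 2 * C * (volume.real (E \ ball 0 R) / h) := by gcongr
  linarith


/-! ### The isoperimetric inequality -/

/-- The derivative in `s` of the integral over `A` of `ψ (x + s • h)` is the integral of the
divergence of `ψ (x + s • h) • h`, a field of norm at most `‖h‖`; the mean value inequality on [0,
1] concludes. -/
theorem setIntegral_translate_sub_le {A : Set (Space d)} (hAf : volume A ≠ ∞)
    (hP : perimeter A ≠ ∞) {ψ : Space d → ℝ} (hψ : ContDiff ℝ 1 ψ) (hc : HasCompactSupport ψ)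
    (h1 : ∀ x, |ψ x| ≤ 1) (h : Space d) :
    (∫ x in A, ψ (x + h)) - ∫ x in A, ψ x ≤ ‖h‖ * (perimeter A).toReal := by
  have : IsFiniteMeasure (volume.restrict A) := ⟨by simpa using hAf.lt_top⟩
  obtain ⟨M, hM⟩ := (hc.fderiv_apply (𝕜 := ℝ) h).exists_bound_of_continuous
    ((hψ.continuous_fderiv one_ne_zero).clm_apply continuous_const)
  have hder : ∀ s : ℝ, HasDerivAt (fun s : ℝ => ∫ x in A, ψ (x + s • h))
      (∫ x in A, fderiv ℝ ψ (x + s • h) h) s := by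
    intro s
    refine (hasDerivAt_integral_of_dominated_loc_of_deriv_le (bound := fun _ => M)
      (F' := fun s x => fderiv ℝ ψ (x + s • h) h) univ_mem ?_ ?_ ?_ ?_ ?_ ?_).2
    · exact Eventually.of_forall fun s => (hψ.continuous.comp (by fun_prop)).aestronglyMeasurable
    · refine Integrable.of_bound (hψ.continuous.comp (by fun_prop)).aestronglyMeasurable 1
        (Eventually.of_forall fun x => h1 _)
    · exact (((hψ.continuous_fderiv one_ne_zero).comp (by fun_prop)).clm_apply
        continuous_const).aestronglyMeasurable
    · exact Eventually.of_forall fun x s _ => hM _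
    · exact integrable_const _
    · refine Eventually.of_forall fun x s _ => ?_
      have h2 : HasDerivAt (fun s : ℝ => x + s • h) h s := by
        simpa using ((hasDerivAt_id s).smul_const h).const_add x
      exact (hψ.differentiable one_ne_zero _).hasFDerivAt.comp_hasDerivAt s h2
  have hle : ∀ s : ℝ, deriv (fun s : ℝ => ∫ x in A, ψ (x + s • h)) s
      ≤ ‖h‖ * (perimeter A).toReal := by
    intro s
    rw [(hder s).deriv]
    have hsm : ContDiff ℝ 1 fun x : Space d => ψ (x + s • h) := by fun_prop
    have hcs : HasCompactSupport fun x : Space d => ψ (x + s • h) :=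
      hc.comp_homeomorph (Homeomorph.addRight (s • h))
    have h3 := setIntegral_divergence_le_mul hP (T := fun x => ψ (x + s • h) • h) (by fun_prop)
      (hcs.smul_right (f' := fun _ => h)) (norm_nonneg h) fun x => by
        rw [norm_smul]
        exact mul_le_of_le_one_left (norm_nonneg _) (h1 _)
    refine le_of_eq_of_le (integral_congr_ae (Eventually.of_forall fun x => ?_)) h3
    simp only
    rw [divergence_smul (hsm.differentiable one_ne_zero x) (differentiableAt_const h),
      divergence_const, mul_zero, zero_add, fderiv_comp_add_right]
  have h4 := image_sub_le_mul_sub_of_deriv_le (fun s => (hder s).differentiableAt) hle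
    (zero_le_one (α := ℝ))
  simpa using h4

theorem exists_bump_of_compact {K U : Set (Space d)} (hK : IsCompact K) (hU : IsOpen U)
    (hKU : K ⊆ U) : ∃ ψ : Space d → ℝ, ContDiff ℝ 1 ψ ∧ HasCompactSupport ψ ∧
      (∀ x, 0 ≤ ψ x ∧ ψ x ≤ 1) ∧ (∀ x ∈ K, ψ x = 1) ∧ ∀ x ∉ U, ψ x = 0 := by
  obtain ⟨R, hR⟩ := hK.isBounded.subset_ball (0 : Space d)
  obtain ⟨f, hf, hr, hs, h1⟩ := exists_contMDiff_support_eq_eq_one_iff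
    (modelWithCornersSelf ℝ (Space d)) (n := 1) (hU.inter isOpen_ball) hK.isClosed
    (subset_inter hKU hR)
  refine ⟨f, contMDiff_iff_contDiff.1 hf, ?_, fun x => hr (mem_range_self x),
    fun x hx => (h1 x).1 hx, fun x hx => ?_⟩
  · exact HasCompactSupport.of_support_subset_isCompact (isCompact_closedBall 0 R)
      (hs.le.trans (inter_subset_right.trans ball_subset_closedBall))
  · by_contra hne
    have : x ∈ Function.support f := hne
    rw [hs] at this
    exact hx this.1

/-- A set differs from its translates by at most its perimeter times the length of the
translation. -/
theorem volume_translate_sdiff_le {A : Set (Space d)} (hA : MeasurableSet A) (hAf : volume A ≠ ∞)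
    (hP : perimeter A ≠ ∞) (h : Space d) :
    volume {x | x ∈ A ∧ x + h ∉ A} ≤ ENNReal.ofReal ‖h‖ * perimeter A := by
  set D : Set (Space d) := {x | x - h ∈ A ∧ x ∉ A} with hD
  have hmD : MeasurableSet D := (measurable_sub_const h hA).inter hA.compl
  have e : {x | x ∈ A ∧ x + h ∉ A} = (fun x => x + h) ⁻¹' D := by
    ext x; simp [hD]
  rw [e, measure_preimage_add_right]
  have hDf : volume D ≠ ∞ := by
    refine ne_top_of_le_ne_top hAf ?_
    rw [← measure_preimage_add_right volume h D]
    exact measure_mono fun x hx => by simpa [hD] using hx.1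
  refine ENNReal.le_of_forall_pos_le_add fun δ hδ _ => ?_
  have hδ2 : (0 : ℝ≥0∞) < δ / 2 := ENNReal.div_pos (by exact_mod_cast hδ.ne') (by simp)
  -- The bump `ψ` imitates the indicator of `D`: it is 1 on the compact `K ⊆ D` and 0 off an open
  -- `U` barely larger than `K`. In the difference of the integrals over the translate `A'` and over
  -- `A` the common part cancels, leaving `|K|` up to `|U \ K|`.
  obtain ⟨K, hKD, hK, hKv⟩ := hmD.exists_isCompact_lt_add hDf hδ2.ne'
  obtain ⟨U, hKU, hU, hUv⟩ := K.exists_isOpen_lt_add (μ := volume) hK.measure_lt_top.ne hδ2.ne'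
  obtain ⟨ψ, hψ, hcψ, h01, hψ1, hψ0⟩ := exists_bump_of_compact hK hU hKU
  have hkey := setIntegral_translate_sub_le hAf hP hψ hcψ
    (fun x => abs_le.2 ⟨by linarith [(h01 x).1], (h01 x).2⟩) h
  set A' : Set (Space d) := (fun x => x - h) ⁻¹' A with hA'
  have hmA' : MeasurableSet A' := measurable_sub_const h hA
  have hshift : ∫ x in A, ψ (x + h) = ∫ x in A', ψ x := by
    rw [← integral_indicator hA, ← integral_indicator hmA',
      ← integral_add_right_eq_self (fun x => A'.indicator ψ x) h]
    refine integral_congr_ae (Eventually.of_forall fun x => ?_)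
    by_cases hx : x ∈ A <;> simp [indicator, hA', hx]
  have hψi : Integrable ψ := hψ.continuous.integrable_of_hasCompactSupport hcψ
  have hUf : volume U ≠ ∞ := (hUv.trans (ENNReal.add_lt_top.2 ⟨hK.measure_lt_top, by
    exact ENNReal.div_lt_top (by simp) (by simp)⟩)).ne
  have hlow : ∫ x in A', ψ x ≥ volume.real K + ∫ x in A' ∩ A, ψ x := by
    have h1 : ∫ x in A', ψ x = (∫ x in A' ∩ A, ψ x) + ∫ x in A' \ A, ψ x := by
      rw [integral_inter_add_sdiff hA hψi.integrableOn]
    have h2 : volume.real K = ∫ x in K, ψ x := by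
      rw [setIntegral_congr_fun hK.measurableSet (g := fun _ => (1 : ℝ)) fun x hx => hψ1 x hx]
      simp
    have h3 : ∫ x in K, ψ x ≤ ∫ x in A' \ A, ψ x :=
      setIntegral_mono_set hψi.integrableOn (Eventually.of_forall fun x => (h01 x).1)
        (LE.le.eventuallyLE hKD)
    linarith
  have hup : ∫ x in A, ψ x ≤ (∫ x in A' ∩ A, ψ x) + volume.real (U \ K) := by
    have h1 : ∫ x in A, ψ x = (∫ x in A ∩ A', ψ x) + ∫ x in A \ A', ψ x := by
      rw [integral_inter_add_sdiff hmA' hψi.integrableOn]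
    have h2 : ∫ x in A \ A', ψ x ≤ ∫ x in A \ A', (U \ K).indicator (fun _ => (1 : ℝ)) x := by
      refine setIntegral_mono_on hψi.integrableOn ?_ (hA.diff hmA') fun x hx => ?_
      · exact ((integrable_indicator_iff (hU.measurableSet.diff hK.measurableSet)).2
          (integrableOn_const (ne_top_of_le_ne_top hUf (measure_mono sdiff_subset)))).integrableOn
      · by_cases hxU : x ∈ U
        · have : x ∈ U \ K := ⟨hxU, fun hxK => (hKD hxK).2 hx.1⟩
          rw [indicator_of_mem this]
          exact (h01 x).2
        · rw [hψ0 x hxU]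
          exact indicator_nonneg (fun _ _ => zero_le_one) x
    rw [setIntegral_indicator (hU.measurableSet.diff hK.measurableSet), setIntegral_const,
      smul_eq_mul, mul_one] at h2
    have h3 : volume.real (A \ A' ∩ (U \ K)) ≤ volume.real (U \ K) :=
      measureReal_mono inter_subset_right (ne_top_of_le_ne_top hUf (measure_mono sdiff_subset))
    rw [inter_comm A' A]
    linarith
  rw [hshift] at hkey
  have hUK : volume (U \ K) ≤ δ / 2 := by
    rw [measure_sdiff hKU hK.measurableSet.nullMeasurableSet hK.measure_lt_top.ne,
      tsub_le_iff_left]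
    exact hUv.le
  have h5 : volume.real K ≤ ‖h‖ * (perimeter A).toReal + volume.real (U \ K) := by linarith
  have h6 : volume K ≤ ENNReal.ofReal ‖h‖ * perimeter A + volume (U \ K) := by
    have hUKf : volume (U \ K) ≠ ∞ := ne_top_of_le_ne_top hUf (measure_mono sdiff_subset)
    rw [← ENNReal.ofReal_toReal hK.measure_lt_top.ne, ← ENNReal.ofReal_toReal hUKf,
      ← ENNReal.ofReal_toReal hP, ← ENNReal.ofReal_mul (norm_nonneg _),
      ← ENNReal.ofReal_add (by positivity) (by positivity)]
    exact ENNReal.ofReal_le_ofReal h5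
  calc volume D ≤ volume K + δ / 2 := hKv.le
    _ ≤ ENNReal.ofReal ‖h‖ * perimeter A + δ / 2 + δ / 2 := by gcongr; exact h6.trans (by gcongr)
    _ = _ := by rw [add_assoc, ENNReal.add_halves]

/-- The isoperimetric inequality, with a non-optimal constant. -/
theorem volume_le_mul_perimeter {A : Set (Space d)} (hA : MeasurableSet A)
    (hAf : volume A ≠ ∞) (hP : perimeter A ≠ ∞) {ρ : ℝ} (hρ : 0 < ρ)
    (hball : 2 * volume A ≤ volume (ball (0 : Space d) ρ)) :
    volume A ≤ 2 * ENNReal.ofReal ρ * perimeter A := by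
  set B := ball (0 : Space d) ρ
  have hB0 : volume B ≠ 0 := (measure_ball_pos volume 0 hρ).ne'
  have hBf : volume B ≠ ∞ := measure_ball_lt_top.ne
  -- Here `f h x` records that the translation by `h` takes `x` out of `A`. Averaging over `h` in
  -- the ball bounds the double integral above by the perimeter. It is also bounded below: by
  -- `hball`, each point leaves `A` for at least half of all `h`.
  set f : Space d → Space d → ℝ≥0∞ := fun h x => Aᶜ.indicator 1 (x + h)
  have hup : ∫⁻ h in B, ∫⁻ x in A, f h x ≤ volume B * (ENNReal.ofReal ρ * perimeter A) := by
    have h1 : ∀ h ∈ B, ∫⁻ x in A, f h x ≤ ENNReal.ofReal ρ * perimeter A := by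
      intro h hh
      have hm : MeasurableSet ((fun x : Space d => x + h) ⁻¹' Aᶜ) := measurable_add_const h hA.compl
      have e : ∫⁻ x in A, f h x = volume {x | x ∈ A ∧ x + h ∉ A} := by
        have e2 : ∀ x, f h x = ((fun x : Space d => x + h) ⁻¹' Aᶜ).indicator 1 x := fun x => by
          by_cases hx : x + h ∈ A <;> simp [f, indicator, hx]
        simp_rw [e2]
        rw [lintegral_indicator_one hm, Measure.restrict_apply hm, inter_comm]
        rfl
      rw [e]
      refine (volume_translate_sdiff_le hA hAf hP h).trans ?_
      gcongr
      simpa [B] using (mem_ball_zero_iff.1 hh).le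
    calc ∫⁻ h in B, ∫⁻ x in A, f h x ≤ ∫⁻ h in B, ENNReal.ofReal ρ * perimeter A :=
          setLIntegral_mono measurable_const h1
      _ = _ := by rw [setLIntegral_const, mul_comm]
  have hlow : volume A * (volume B / 2) ≤ ∫⁻ h in B, ∫⁻ x in A, f h x := by
    have hmeas : Measurable (Function.uncurry f) :=
      (measurable_const.indicator hA.compl).comp (measurable_snd.add measurable_fst)
    rw [lintegral_lintegral_swap hmeas.aemeasurable]
    have h1 : ∀ x, volume B / 2 ≤ ∫⁻ h in B, f h x := by
      intro x
      have hm : MeasurableSet ((fun h : Space d => x + h) ⁻¹' A) := measurable_const_add x hA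
      have e2 : ∀ h, f h x = ((fun h : Space d => x + h) ⁻¹' A)ᶜ.indicator 1 h := fun h => by
        by_cases hx : x + h ∈ A <;> simp [f, indicator, hx]
      simp_rw [e2]
      rw [lintegral_indicator_one hm.compl, Measure.restrict_apply hm.compl]
      have h2 : volume ((fun h : Space d => x + h) ⁻¹' A) = volume A := measure_preimage_add _ _ _
      have h3 : volume B ≤ volume A + volume (((fun h : Space d => x + h) ⁻¹' A)ᶜ ∩ B) := by
        rw [← h2]
        refine (measure_mono fun y hy => ?_).trans (measure_union_le _ _)
        by_cases hyA : y ∈ (fun h : Space d => x + h) ⁻¹' A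
        exacts [Or.inl hyA, Or.inr ⟨hyA, hy⟩]
      have h4 : volume A ≤ volume B / 2 := by
        rw [ENNReal.le_div_iff_mul_le (by simp) (by simp), mul_comm]; exact hball
      have h5 : volume B / 2 + volume B / 2
          ≤ volume B / 2 + volume (((fun h : Space d => x + h) ⁻¹' A)ᶜ ∩ B) := by
        rw [ENNReal.add_halves]
        exact h3.trans (by gcongr)
      exact (ENNReal.add_le_add_iff_left (ENNReal.div_ne_top hBf (by simp))).1 h5
    calc volume A * (volume B / 2) = ∫⁻ x in A, volume B / 2 := by
          rw [setLIntegral_const, mul_comm]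
      _ ≤ _ := lintegral_mono h1
  have h := hlow.trans hup
  have h2 : volume B * (volume A / 2) ≤ volume B * (ENNReal.ofReal ρ * perimeter A) := by
    refine le_of_eq_of_le ?_ h
    rw [div_eq_mul_inv, div_eq_mul_inv]; ring
  rw [ENNReal.mul_le_mul_iff_right hB0 hBf, ENNReal.div_le_iff (by simp) (by simp)] at h2
  exact h2.trans (le_of_eq (by ring))


/-! ### Shear maps -/

/-- The map which moves the coordinate `i` from `s` to `s + t * arctan s`. -/
def shear (i : Fin d) (t : ℝ) (x : Space d) : Space d :=
  x + (t * Real.arctan (x i)) • EuclideanSpace.single i (1 : ℝ)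

/-- The weight `1 / (1 + xᵢ²)`, the derivative of the displacement of the shear map. -/
def shearWeight (i : Fin d) (x : Space d) : ℝ := 1 / (1 + x i ^ 2)

theorem shearWeight_pos (i : Fin d) (x : Space d) : 0 < shearWeight i x := by
  unfold shearWeight; positivity

theorem shearWeight_le_one (i : Fin d) (x : Space d) : shearWeight i x ≤ 1 := by
  unfold shearWeight
  rw [div_le_one (by positivity)]
  nlinarith [sq_nonneg (x i)]

theorem contDiff_coord (i : Fin d) : ContDiff ℝ 1 fun x : Space d => x i :=
  (EuclideanSpace.proj i : Space d →L[ℝ] ℝ).contDiff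

theorem contDiff_shearWeight (i : Fin d) : ContDiff ℝ 1 (shearWeight i) :=
  contDiff_const.div (contDiff_const.add ((contDiff_coord i).pow 2)) fun x => by positivity

theorem abs_mul_shearWeight_le (i : Fin d) (t : ℝ) (x : Space d) : |t * shearWeight i x| ≤ |t| := by
  rw [abs_mul, abs_of_pos (shearWeight_pos i x)]
  exact mul_le_of_le_one_right (abs_nonneg _) (shearWeight_le_one i x)

theorem one_add_mul_shearWeight_pos (i : Fin d) {t : ℝ} (ht : |t| < 1) (x : Space d) :
    0 < 1 + t * shearWeight i x := by
  have := (abs_le.1 (abs_mul_shearWeight_le i t x)).1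
  linarith

theorem contDiff_shear (i : Fin d) (t : ℝ) : ContDiff ℝ 1 (shear i t) := by
  have h : ContDiff ℝ 1 fun x : Space d => t * Real.arctan (x i) :=
    contDiff_const.mul (Real.contDiff_arctan.comp (contDiff_coord i))
  exact contDiff_id.add (h.smul contDiff_const)

theorem hasFDerivAt_coord (i : Fin d) (x : Space d) :
    HasFDerivAt (fun x : Space d => x i) (EuclideanSpace.proj i : Space d →L[ℝ] ℝ) x :=
  (EuclideanSpace.proj i : Space d →L[ℝ] ℝ).hasFDerivAt

/-- The derivative of the shear map. -/
def shearDeriv (i : Fin d) (t : ℝ) (x : Space d) : Space d →L[ℝ] Space d :=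
  ContinuousLinearMap.id ℝ (Space d) + ((t * shearWeight i x) •
    (EuclideanSpace.proj i : Space d →L[ℝ] ℝ)).smulRight (EuclideanSpace.single i (1 : ℝ))

theorem hasFDerivAt_shear (i : Fin d) (t : ℝ) (x : Space d) :
    HasFDerivAt (shear i t) (shearDeriv i t x) x := by
  have h1 : HasFDerivAt (fun x : Space d => t * Real.arctan (x i))
      ((t * shearWeight i x) • (EuclideanSpace.proj i : Space d →L[ℝ] ℝ)) x := by
    have h := ((Real.hasDerivAt_arctan (x i)).const_mul t).comp_hasFDerivAt x (hasFDerivAt_coord i x)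
    exact h
  exact (hasFDerivAt_id x).add (h1.smul_const _)

theorem shearDeriv_apply (i : Fin d) (t : ℝ) (x v : Space d) :
    shearDeriv i t x v = v + (t * shearWeight i x * v i) • EuclideanSpace.single i (1 : ℝ) := by
  simp [shearDeriv]

/-- The derivative is a transvection, a rank-one perturbation of the identity. -/
theorem det_shearDeriv (i : Fin d) (t : ℝ) (x : Space d) :
    (shearDeriv i t x).det = 1 + t * shearWeight i x := by
  have h : ((shearDeriv i t x : Space d →L[ℝ] Space d) : Space d →ₗ[ℝ] Space d)
      = LinearMap.transvection ((t * shearWeight i x) •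
        ((EuclideanSpace.proj i : Space d →L[ℝ] ℝ) : Space d →ₗ[ℝ] ℝ))
        (EuclideanSpace.single i (1 : ℝ)) := by
    ext v j
    simp [shearDeriv, LinearMap.transvection.apply]
  rw [ContinuousLinearMap.det, h, LinearMap.transvection.det]
  simp

theorem norm_single_one (i : Fin d) : ‖(EuclideanSpace.single i (1 : ℝ) : Space d)‖ = 1 := by simp

theorem dist_shear_self_le (i : Fin d) (t : ℝ) (x : Space d) : dist (shear i t x) x ≤ 2 * |t| := by
  rw [dist_eq_norm, shear, add_sub_cancel_left, norm_smul, norm_single_one, mul_one, norm_mul,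
    Real.norm_eq_abs, Real.norm_eq_abs, mul_comm]
  have h1 := Real.arctan_lt_pi_div_two (x i)
  have h2 := Real.neg_pi_div_two_lt_arctan (x i)
  have h3 := Real.pi_lt_four
  gcongr
  exact abs_le.2 ⟨by linarith, by linarith⟩

theorem abs_arctan_sub_le (a b : ℝ) : |Real.arctan a - Real.arctan b| ≤ |a - b| := by
  have h : LipschitzWith 1 Real.arctan := by
    refine lipschitzWith_of_nnnorm_deriv_le Real.differentiable_arctan fun x => ?_
    rw [← NNReal.coe_le_coe, coe_nnnorm, Real.deriv_arctan, Real.norm_of_nonneg (by positivity),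
      NNReal.coe_one, div_le_one (by positivity)]
    nlinarith [sq_nonneg x]
  have := h.dist_le_mul a b
  simpa [Real.dist_eq] using this

theorem abs_coord_le (i : Fin d) (x : Space d) : |x i| ≤ ‖x‖ := by
  simpa using PiLp.norm_apply_le x i

/-- The displacement is `|t|`-Lipschitz because `arctan` is 1-Lipschitz. For `|t| < 1` this
perturbation of the identity is injective, a homeomorphism, and contracts distances by a factor no
smaller than `1 - |t|`. -/
theorem norm_shear_sub_sub_le (i : Fin d) (t : ℝ) (x y : Space d) :
    ‖shear i t x - shear i t y - (x - y)‖ ≤ |t| * ‖x - y‖ := by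
  have e : shear i t x - shear i t y - (x - y)
      = (t * (Real.arctan (x i) - Real.arctan (y i))) • EuclideanSpace.single i (1 : ℝ) := by
    simp only [shear, mul_sub, sub_smul]; abel
  rw [e, norm_smul, norm_single_one, mul_one, norm_mul, Real.norm_eq_abs, Real.norm_eq_abs]
  gcongr
  refine (abs_arctan_sub_le _ _).trans ?_
  simpa using abs_coord_le i (x - y)

theorem le_dist_shear (i : Fin d) (t : ℝ) (x y : Space d) :
    (1 - |t|) * dist x y ≤ dist (shear i t x) (shear i t y) := by
  have h := norm_shear_sub_sub_le i t x y
  rw [norm_sub_rev] at h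
  have h2 := norm_sub_norm_le (x - y) (shear i t x - shear i t y)
  rw [dist_eq_norm, dist_eq_norm]
  linarith

theorem injective_shear (i : Fin d) {t : ℝ} (ht : |t| < 1) : Function.Injective (shear i t) := by
  intro x y hxy
  have h := le_dist_shear i t x y
  rw [hxy, dist_self] at h
  have : 0 < 1 - |t| := by linarith
  exact dist_le_zero.1 (by nlinarith [dist_nonneg (x := x) (y := y)])

/-- Small shears are homeomorphisms. -/
theorem exists_homeomorph_shear (i : Fin d) {t : ℝ} (ht : |t| < 1) :
    ∃ φ : Space d ≃ₜ Space d, ⇑φ = shear i t := by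
  have hap : ApproximatesLinearOn (shear i t)
      ((ContinuousLinearEquiv.refl ℝ (Space d) : Space d ≃L[ℝ] Space d) : Space d →L[ℝ] Space d)
      univ (Real.nnabs t) := by
    intro x _ y _
    exact norm_shear_sub_sub_le i t x y
  refine ⟨hap.toHomeomorph _ (Or.inr ?_), rfl⟩
  have : Nonempty (Fin d) := ⟨i⟩
  have h2 : ‖((ContinuousLinearEquiv.refl ℝ (Space d)).symm : Space d →L[ℝ] Space d)‖₊ = 1 := by
    rw [← NNReal.coe_inj]
    exact ContinuousLinearMap.norm_id
  rw [h2, inv_one, ← NNReal.coe_lt_coe]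
  simpa using ht

theorem measurableSet_shear_image (i : Fin d) {t : ℝ} (ht : |t| < 1) {A : Set (Space d)}
    (hA : MeasurableSet A) : MeasurableSet (shear i t '' A) := by
  obtain ⟨φ, hφ⟩ := exists_homeomorph_shear i ht
  rw [← hφ]
  exact φ.measurableEmbedding.measurableSet_image.2 hA

theorem volume_shear_image (i : Fin d) {t : ℝ} (ht : |t| < 1) {A : Set (Space d)}
    (hA : MeasurableSet A) :
    volume (shear i t '' A) = ∫⁻ x in A, ENNReal.ofReal (1 + t * shearWeight i x) := by
  rw [← lintegral_abs_det_fderiv_eq_addHaar_image volume hA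
    (fun x _ => (hasFDerivAt_shear i t x).hasFDerivWithinAt) (injective_shear i ht).injOn]
  refine lintegral_congr fun x => ?_
  rw [det_shearDeriv, abs_of_pos (one_add_mul_shearWeight_pos i ht x)]

theorem volume_shear_image_le (i : Fin d) {t : ℝ} (ht : |t| < 1) {A : Set (Space d)}
    (hA : MeasurableSet A) : volume (shear i t '' A) ≤ ENNReal.ofReal (1 + |t|) * volume A := by
  rw [volume_shear_image i ht hA, ← setLIntegral_const]
  refine lintegral_mono fun x => ENNReal.ofReal_le_ofReal ?_
  linarith [(abs_le.1 (abs_mul_shearWeight_le i t x)).2]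

theorem le_volume_shear_image (i : Fin d) {t : ℝ} (ht : |t| < 1) {A : Set (Space d)}
    (hA : MeasurableSet A) : ENNReal.ofReal (1 - |t|) * volume A ≤ volume (shear i t '' A) := by
  rw [volume_shear_image i ht hA, ← setLIntegral_const]
  refine lintegral_mono fun x => ENNReal.ofReal_le_ofReal ?_
  linarith [(abs_le.1 (abs_mul_shearWeight_le i t x)).1]

theorem integrableOn_shearWeight (i : Fin d) {A : Set (Space d)} (hAf : volume A ≠ ∞) :
    IntegrableOn (shearWeight i) A := by
  have : IsFiniteMeasure (volume.restrict A) := ⟨by simpa using hAf.lt_top⟩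
  refine Integrable.of_bound (contDiff_shearWeight i).continuous.aestronglyMeasurable 1
    (Eventually.of_forall fun x => ?_)
  rw [Real.norm_of_nonneg (shearWeight_pos i x).le]
  exact shearWeight_le_one i x

/-- The Jacobian determinant is affine in `t`, hence so is the volume, and a prescribed volume is
reached by solving a linear equation. -/
theorem volume_real_shear_image (i : Fin d) {t : ℝ} (ht : |t| < 1) {A : Set (Space d)}
    (hA : MeasurableSet A) (hAf : volume A ≠ ∞) :
    volume.real (shear i t '' A) = volume.real A + t * ∫ x in A, shearWeight i x := by
  have hi := integrableOn_shearWeight i hAf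
  have : IsFiniteMeasure (volume.restrict A) := ⟨by simpa using hAf.lt_top⟩
  rw [measureReal_def, volume_shear_image i ht hA,
    ← integral_eq_lintegral_of_nonneg_ae
      (Eventually.of_forall fun x => (one_add_mul_shearWeight_pos i ht x).le)
      (continuous_const.add (continuous_const.mul
        (contDiff_shearWeight i).continuous)).aestronglyMeasurable,
    integral_add (integrable_const _) (hi.const_mul t), integral_const_mul]
  simp

/-! ### Perimeter of sheared sets -/

theorem norm_sub_coord_smul_le (i : Fin d) (v : Space d) :
    ‖v - v i • EuclideanSpace.single i (1 : ℝ)‖ ≤ ‖v‖ := by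
  rw [EuclideanSpace.norm_eq, EuclideanSpace.norm_eq]
  refine Real.sqrt_le_sqrt (Finset.sum_le_sum fun j _ => ?_)
  by_cases hj : j = i
  · subst hj; simpa using sq_nonneg (v j)
  · simp [hj]

/-- The vector field which pulls back the flux of `T` under the shear map. -/
def shearField (i : Fin d) (t : ℝ) (T : Space d → Space d) (x : Space d) : Space d :=
  T (shear i t x) + ((t * shearWeight i x) • T (shear i t x) +
    (-(t * shearWeight i x * T (shear i t x) i)) • EuclideanSpace.single i (1 : ℝ))

theorem divergence_comp_shear (i : Fin d) (t : ℝ) {T : Space d → Space d} (hT : ContDiff ℝ 1 T)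
    (x : Space d) :
    divergence (fun y => T (shear i t y)) x = divergence T (shear i t x) + t * shearWeight i x *
      fderiv ℝ T (shear i t x) (EuclideanSpace.single i 1) i := by
  have hd : HasFDerivAt (fun y => T (shear i t y))
      ((fderiv ℝ T (shear i t x)).comp (shearDeriv i t x)) x :=
    (hT.differentiable one_ne_zero _).hasFDerivAt.comp x (hasFDerivAt_shear i t x)
  unfold divergence
  rw [hd.fderiv]
  have : ∀ j : Fin d, ((fderiv ℝ T (shear i t x)).comp (shearDeriv i t x)
        (EuclideanSpace.single j 1)) j
      = fderiv ℝ T (shear i t x) (EuclideanSpace.single j 1) j +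
        if j = i then t * shearWeight i x * fderiv ℝ T (shear i t x) (EuclideanSpace.single i 1) i
        else 0 := by
    intro j
    rw [ContinuousLinearMap.comp_apply, shearDeriv_apply]
    by_cases hj : j = i
    · subst hj; simp
    · have hj' : i ≠ j := fun h => hj h.symm
      simp [hj, hj']
  rw [Finset.sum_congr rfl fun j _ => this j, Finset.sum_add_distrib]
  simp

theorem contDiff_shearField (i : Fin d) (t : ℝ) {T : Space d → Space d} (hT : ContDiff ℝ 1 T) :
    ContDiff ℝ 1 (shearField i t T) := by
  have h1 : ContDiff ℝ 1 fun y => T (shear i t y) := hT.comp (contDiff_shear i t)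
  have h2 : ContDiff ℝ 1 fun y => T (shear i t y) i := (contDiff_coord i).comp h1
  have h3 : ContDiff ℝ 1 fun x => t * shearWeight i x := contDiff_const.mul (contDiff_shearWeight i)
  exact h1.add ((h3.smul h1).add ((h3.mul h2).neg.smul contDiff_const))

/-- Piola's identity. The field is `T ∘ shear` with every component except the `i`-th multiplied by
the determinant. That factor depends on `x i` alone, so differentiating the other components never
hits it, while the `i`-th component acquires it from the chain rule. -/
theorem divergence_shearField (i : Fin d) (t : ℝ) {T : Space d → Space d} (hT : ContDiff ℝ 1 T)
    (x : Space d) :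
    divergence (shearField i t T) x = (1 + t * shearWeight i x) * divergence T (shear i t x) := by
  have h1 : ContDiff ℝ 1 fun y => T (shear i t y) := hT.comp (contDiff_shear i t)
  have h2 : ContDiff ℝ 1 fun y => T (shear i t y) i := (contDiff_coord i).comp h1
  have h3 : ContDiff ℝ 1 fun x => t * shearWeight i x := contDiff_const.mul (contDiff_shearWeight i)
  have h4 : ContDiff ℝ 1 fun x => -(t * shearWeight i x * T (shear i t x) i) := (h3.mul h2).neg
  have h5 : ContDiff ℝ 1 fun x => (t * shearWeight i x) • T (shear i t x) := h3.smul h1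
  have h6 : ContDiff ℝ 1 fun x => (-(t * shearWeight i x * T (shear i t x) i)) •
    (EuclideanSpace.single i (1 : ℝ) : Space d) := h4.smul contDiff_const
  have d1 := h1.differentiable one_ne_zero x
  have d2 := h2.differentiable one_ne_zero x
  have d3 := h3.differentiable one_ne_zero x
  have d4 := h4.differentiable one_ne_zero x
  have d5 := h5.differentiable one_ne_zero x
  have d6 := h6.differentiable one_ne_zero x
  have e : shearField i t T = fun x => T (shear i t x) + ((t * shearWeight i x) • T (shear i t x) +
    (-(t * shearWeight i x * T (shear i t x) i)) • EuclideanSpace.single i (1 : ℝ)) := rfl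
  have d56 : DifferentiableAt ℝ (fun x => (t * shearWeight i x) • T (shear i t x) +
    (-(t * shearWeight i x * T (shear i t x) i)) • (EuclideanSpace.single i (1 : ℝ) : Space d)) x :=
    d5.add d6
  -- the weight depends on the coordinate `i` only
  have hw : ∃ w : ℝ, ∀ v, fderiv ℝ (fun x => t * shearWeight i x) x v = w * v i := by
    have hdq : DifferentiableAt ℝ (fun s : ℝ => t * (1 / (1 + s ^ 2))) (x i) :=
      (differentiableAt_const _).mul ((differentiableAt_const _).div
        ((differentiableAt_const _).add (differentiableAt_id.pow 2)) (by positivity))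
    have hc := hdq.hasDerivAt.comp_hasFDerivAt x (hasFDerivAt_coord i x)
    have hc' : fderiv ℝ (fun x => t * shearWeight i x) x
      = deriv (fun s : ℝ => t * (1 / (1 + s ^ 2))) (x i) • (EuclideanSpace.proj i) := hc.fderiv
    exact ⟨_, fun v => by rw [hc']; rfl⟩
  obtain ⟨w, hw⟩ := hw
  have hcoord : fderiv ℝ (fun y => T (shear i t y) i) x (EuclideanSpace.single i 1)
      = (1 + t * shearWeight i x) * fderiv ℝ T (shear i t x) (EuclideanSpace.single i 1) i := by
    have hd : HasFDerivAt (fun y => T (shear i t y))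
        ((fderiv ℝ T (shear i t x)).comp (shearDeriv i t x)) x :=
      (hT.differentiable one_ne_zero _).hasFDerivAt.comp x (hasFDerivAt_shear i t x)
    have hd2 := ((hasFDerivAt_coord i (T (shear i t x))).comp x hd).fderiv
    have hd3 : fderiv ℝ (fun y => T (shear i t y) i) x = _ := hd2
    rw [hd3]
    simp only [ContinuousLinearMap.comp_apply, shearDeriv_apply, map_add, map_smul]
    simp
    ring
  rw [e, divergence_add d1 d56, divergence_add d5 d6, divergence_smul d3 d1,
    divergence_smul d4 (differentiableAt_const _), divergence_const, divergence_comp_shear i t hT,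
    fderiv_fun_neg, fderiv_fun_mul d3 d2, hw]
  simp only [neg_apply, add_apply, smul_apply, hcoord, hw, smul_eq_mul]
  simp
  ring

theorem norm_shearField_le (i : Fin d) (t : ℝ) {T : Space d → Space d} (h1 : ∀ x, ‖T x‖ ≤ 1)
    (x : Space d) : ‖shearField i t T x‖ ≤ 1 + |t| := by
  have e : shearField i t T x = T (shear i t x) + (t * shearWeight i x) •
      (T (shear i t x) - T (shear i t x) i • EuclideanSpace.single i (1 : ℝ)) := by
    rw [shearField, smul_sub, smul_smul, neg_smul, ← sub_eq_add_neg]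
  rw [e]
  refine (norm_add_le _ _).trans (add_le_add (h1 _) ?_)
  rw [norm_smul]
  calc _ ≤ |t| * 1 := by
        gcongr
        · exact abs_mul_shearWeight_le i t x
        · exact (norm_sub_coord_smul_le i _).trans (h1 _)
    _ = |t| := mul_one _

/-- A change of variables turns the flux of `T` through the image into the flux of the pulled back
field `shearField` through `A`, whose norm is at most `1 + |t|`. -/
theorem perimeter_shear_image_le (i : Fin d) {t : ℝ} (ht : |t| < 1) {A : Set (Space d)}
    (hA : MeasurableSet A) : perimeter (shear i t '' A) ≤ ENNReal.ofReal (1 + |t|) * perimeter A := by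
  by_cases hP : perimeter A = ∞
  · have : ENNReal.ofReal (1 + |t|) ≠ 0 := by
      rw [Ne, ENNReal.ofReal_eq_zero, not_le]; positivity
    rw [hP, ENNReal.mul_top this]; exact le_top
  rw [← ENNReal.ofReal_toReal hP, ← ENNReal.ofReal_mul (by positivity)]
  refine perimeter_le_ofReal fun T hT hc h1 => ?_
  obtain ⟨φ, hφ⟩ := exists_homeomorph_shear i ht
  have hcomp : HasCompactSupport fun y => T (shear i t y) := by
    rw [← hφ]; exact hc.comp_homeomorph φ
  have hcs : HasCompactSupport (shearField i t T) := by
    refine hcomp.mono fun x hx => ?_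
    contrapose hx
    simp only [Function.mem_support, not_not] at hx ⊢
    simp [shearField, hx]
  have h := setIntegral_divergence_le_mul hP (contDiff_shearField i t hT) hcs (by positivity)
    (norm_shearField_le i t h1)
  refine le_of_eq_of_le ?_ h
  rw [integral_image_eq_integral_abs_det_fderiv_smul volume hA
    (fun x _ => (hasFDerivAt_shear i t x).hasFDerivWithinAt) (injective_shear i ht).injOn]
  refine integral_congr_ae (Eventually.of_forall fun x => ?_)
  simp only
  rw [divergence_shearField i t hT, det_shearDeriv,
    abs_of_pos (one_add_mul_shearWeight_pos i ht x), smul_eq_mul]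


/-! ### Correcting the volume -/

/-- Inner and outer regularity: points move by at most `2 * |t|`, so a compact core of `E` stays
inside an open set barely larger than it, and volumes change by factors between `1 - |t|` and `1 +
|t|`. -/
theorem exists_volume_symmDiff_shear_le (i : Fin d) {E : Set (Space d)} (hE : MeasurableSet E)
    (hEf : volume E ≠ ∞) {ε : ℝ≥0∞} (hε : ε ≠ 0) :
    ∃ t₀ : ℝ, 0 < t₀ ∧ t₀ < 1 ∧ ∀ t, |t| ≤ t₀ → volume (symmDiff E (shear i t '' E)) ≤ ε := by
  wlog hεf : ε ≠ ∞ generalizing ε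
  · obtain ⟨t₀, h0, h1, h⟩ := this one_ne_zero ENNReal.one_ne_top
    rw [not_not.1 hεf]
    exact ⟨t₀, h0, h1, fun t _ => le_top⟩
  -- The four pieces of the symmetric difference in `hsub` cost δ, 2δ, 2δ and δ.
  set δ : ℝ := ε.toReal / 6
  have hδ : 0 < δ := div_pos (ENNReal.toReal_pos hε hεf) (by norm_num)
  have hδ' : ENNReal.ofReal δ ≠ 0 := by simpa using hδ
  obtain ⟨K, hKE, hK, hKv⟩ := hE.exists_isCompact_lt_add hEf hδ'
  have hKf := hK.measure_lt_top (μ := volume).ne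
  obtain ⟨U, hKU, hU, hUv⟩ := K.exists_isOpen_lt_add (μ := volume) hKf hδ'
  have hUf : volume U ≠ ∞ := (hUv.trans (ENNReal.add_lt_top.2 ⟨hKf.lt_top, by simp⟩)).ne
  obtain ⟨η, hη, hηU⟩ := hK.exists_thickening_subset_open hU hKU
  set κ := volume.real K
  have hκ : 0 ≤ κ := measureReal_nonneg
  refine ⟨min (1 / 2) (min (η / 4) (δ / (κ + 1))), by positivity,
    (min_le_left _ _).trans_lt (by norm_num), fun t ht => ?_⟩
  have ht1 : |t| ≤ 1 / 2 := ht.trans (min_le_left _ _)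
  have ht2 : |t| ≤ η / 4 := ht.trans ((min_le_right _ _).trans (min_le_left _ _))
  have ht3 : |t| * κ ≤ δ := by
    have h := ht.trans ((min_le_right _ _).trans (min_le_right _ _))
    rw [le_div_iff₀ (by positivity)] at h
    nlinarith [abs_nonneg t]
  have htl : |t| < 1 := by linarith
  set φ := shear i t
  have hφK : φ '' K ⊆ U := by
    rintro _ ⟨x, hx, rfl⟩
    refine hηU (mem_thickening_iff.2 ⟨x, hx, ?_⟩)
    exact (dist_shear_self_le i t x).trans_lt (by linarith)
  have hmK : MeasurableSet (φ '' K) := measurableSet_shear_image i htl hK.measurableSet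
  have hφKf : volume (φ '' K) ≠ ∞ := ne_top_of_le_ne_top hUf (measure_mono hφK)
  have b1 : volume.real (E \ K) ≤ δ := by
    rw [measureReal_sdiff hKE hK.measurableSet hEf, sub_le_iff_le_add']
    have := ENNReal.toReal_mono (by simp [hKf]) hKv.le
    rwa [ENNReal.toReal_add hKf (by simp), ENNReal.toReal_ofReal hδ.le] at this
  have bU : volume.real U ≤ κ + δ := by
    have := ENNReal.toReal_mono (by simp [hKf]) hUv.le
    rwa [ENNReal.toReal_add hKf (by simp), ENNReal.toReal_ofReal hδ.le] at this
  have b2 : volume.real (U \ K) ≤ δ := by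
    rw [measureReal_sdiff hKU hK.measurableSet hUf, sub_le_iff_le_add']
    exact bU
  have b3 : volume.real (U \ φ '' K) ≤ 2 * δ := by
    rw [measureReal_sdiff hφK hmK hUf, sub_le_iff_le_add']
    have h := ENNReal.toReal_mono hφKf (le_volume_shear_image i htl hK.measurableSet)
    rw [ENNReal.toReal_mul, ENNReal.toReal_ofReal (by linarith)] at h
    have h' : (1 - |t|) * κ ≤ volume.real (φ '' K) := h
    nlinarith
  have hEKf : volume (E \ K) ≠ ∞ := ne_top_of_le_ne_top hEf (measure_mono sdiff_subset)
  have b4 : volume.real (φ '' (E \ K)) ≤ 2 * δ := by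
    have h := ENNReal.toReal_mono (ENNReal.mul_ne_top (by simp) hEKf)
      (volume_shear_image_le i htl (hE.diff hK.measurableSet))
    rw [ENNReal.toReal_mul, ENNReal.toReal_ofReal (by positivity)] at h
    have h' : volume.real (φ '' (E \ K)) ≤ (1 + |t|) * volume.real (E \ K) := h
    nlinarith [measureReal_nonneg (μ := volume) (s := E \ K)]
  have hsub : symmDiff E (φ '' E)
      ⊆ ((E \ K) ∪ (U \ φ '' K)) ∪ (φ '' (E \ K) ∪ (U \ K)) := by
    rintro x (⟨hx, hx'⟩ | ⟨⟨y, hy, rfl⟩, hx'⟩)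
    · by_cases hxK : x ∈ K
      · exact Or.inl (Or.inr ⟨hKU hxK, fun h => hx' (image_mono hKE h)⟩)
      · exact Or.inl (Or.inl ⟨hx, hxK⟩)
    · by_cases hyK : y ∈ K
      · exact Or.inr (Or.inr ⟨hφK ⟨y, hyK, rfl⟩, fun h => hx' (hKE h)⟩)
      · exact Or.inr (Or.inl ⟨y, ⟨hy, hyK⟩, rfl⟩)
  have hf1 : volume (φ '' (E \ K)) ≠ ∞ := ne_top_of_le_ne_top (ENNReal.mul_ne_top (by simp) hEKf)
    (volume_shear_image_le i htl (hE.diff hK.measurableSet))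
  have hf2 : ∀ S : Set (Space d), volume (U \ S) ≠ ∞ := fun S =>
    ne_top_of_le_ne_top hUf (measure_mono sdiff_subset)
  have hfin : volume (((E \ K) ∪ (U \ φ '' K)) ∪ (φ '' (E \ K) ∪ (U \ K))) ≠ ∞ :=
    measure_union_ne_top (measure_union_ne_top hEKf (hf2 _)) (measure_union_ne_top hf1 (hf2 _))
  refine (measure_mono hsub).trans ?_
  rw [← ENNReal.toReal_le_toReal hfin hεf]
  have := measureReal_union_le (μ := volume) ((E \ K) ∪ (U \ φ '' K)) (φ '' (E \ K) ∪ (U \ K))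
  have := measureReal_union_le (μ := volume) (E \ K) (U \ φ '' K)
  have := measureReal_union_le (μ := volume) (φ '' (E \ K)) (U \ K)
  change volume.real _ ≤ _
  have : 6 * δ = ε.toReal := by simp only [δ]; ring
  linarith

theorem abs_setIntegral_sub_le {E A : Set (Space d)} (hE : MeasurableSet E) (hA : MeasurableSet A)
    (hEf : volume E ≠ ∞) (hAf : volume A ≠ ∞) {w : Space d → ℝ} (hw : Continuous w)
    (h01 : ∀ x, 0 ≤ w x ∧ w x ≤ 1) :
    |(∫ x in E, w x) - ∫ x in A, w x| ≤ volume.real (symmDiff A E) := by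
  have hintg : ∀ S : Set (Space d), volume S ≠ ∞ → IntegrableOn w S := fun S hS => by
    have : IsFiniteMeasure (volume.restrict S) := ⟨by simpa using hS.lt_top⟩
    refine Integrable.of_bound hw.aestronglyMeasurable 1 (Eventually.of_forall fun x => ?_)
    rw [Real.norm_of_nonneg (h01 x).1]
    exact (h01 x).2
  have e1 : (∫ x in E ∩ A, w x) + ∫ x in E \ A, w x = ∫ x in E, w x :=
    integral_inter_add_sdiff hA (hintg E hEf)
  have e2 : (∫ x in A ∩ E, w x) + ∫ x in A \ E, w x = ∫ x in A, w x :=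
    integral_inter_add_sdiff hE (hintg A hAf)
  rw [inter_comm] at e2
  have hb : ∀ S : Set (Space d), MeasurableSet S → volume S ≠ ∞ →
      0 ≤ ∫ x in S, w x ∧ ∫ x in S, w x ≤ volume.real S := fun S hS hSf => by
    refine ⟨integral_nonneg fun x => (h01 x).1, ?_⟩
    calc ∫ x in S, w x ≤ ∫ x in S, (1 : ℝ) :=
          setIntegral_mono (hintg S hSf) (integrableOn_const hSf) fun x => (h01 x).2
      _ = volume.real S := by simp
  have hEA : volume (E \ A) ≠ ∞ := ne_top_of_le_ne_top hEf (measure_mono sdiff_subset)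
  have hAE : volume (A \ E) ≠ ∞ := ne_top_of_le_ne_top hAf (measure_mono sdiff_subset)
  obtain ⟨a1, a2⟩ := hb _ (hE.diff hA) hEA
  obtain ⟨b1, b2⟩ := hb _ (hA.diff hE) hAE
  have hs : volume.real (symmDiff A E) = volume.real (A \ E) + volume.real (E \ A) :=
    measureReal_union disjoint_sdiff_sdiff (hE.diff hA) hAE hEA
  have p1 : 0 ≤ volume.real (A \ E) := measureReal_nonneg
  have p2 : 0 ≤ volume.real (E \ A) := measureReal_nonneg
  rw [hs, abs_le]
  constructor <;> linarith

/-- A set which is close to `E` in `L¹` can be given the volume of `E` by a shear whose size is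
controlled linearly by the `L¹` distance. -/
theorem exists_shear_volume_eq (i : Fin d) {E : Set (Space d)} (hE : MeasurableSet E)
    (hEf : volume E ≠ ∞) (hE0 : volume E ≠ 0) : ∃ C : ℝ, 0 < C ∧
    ∀ A : Set (Space d), MeasurableSet A → volume A ≠ ∞ →
      C * volume.real (symmDiff A E) ≤ 1 / 2 →
      ∃ t, |t| ≤ C * volume.real (symmDiff A E) ∧ volume (shear i t '' A) = volume E := by
  set κ := ∫ x in E, shearWeight i x
  have hκ : 0 < κ := by
    refine (setIntegral_pos_iff_support_of_nonneg_ae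
      (Eventually.of_forall fun x => (shearWeight_pos i x).le) (integrableOn_shearWeight i hEf)).2 ?_
    have : Function.support (shearWeight i) = univ :=
      eq_univ_of_forall fun x => (shearWeight_pos i x).ne'
    rw [this, univ_inter]
    exact pos_iff_ne_zero.2 hE0
  -- `κ` is the rate of change of the volume of `E` under the shear. The smallness assumption says
  -- that the L¹ distance is at most `κ / 4`, so the corresponding rate for `A` is still at least `κ
  -- / 2`.
  refine ⟨2 / κ, by positivity, fun A hA hAf hs => ?_⟩
  set s := volume.real (symmDiff A E)
  have hs0 : 0 ≤ s := measureReal_nonneg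
  have hsκ : s ≤ κ / 4 := by
    rw [div_mul_eq_mul_div, div_le_iff₀ hκ] at hs
    linarith
  have h1 := abs_setIntegral_sub_le hE hA hEf hAf (contDiff_shearWeight i).continuous
    fun x => ⟨(shearWeight_pos i x).le, shearWeight_le_one i x⟩
  have h2 := abs_setIntegral_sub_le hE hA hEf hAf (w := fun _ => 1) continuous_const
    fun x => ⟨zero_le_one, le_rfl⟩
  simp only [setIntegral_const, smul_eq_mul, mul_one] at h2
  have hA2 : κ / 2 ≤ ∫ x in A, shearWeight i x := by
    have := (abs_le.1 h1).2
    simp only [κ] at hsκ ⊢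
    linarith
  set a := ∫ x in A, shearWeight i x
  have ha : 0 < a := by linarith
  have htb : |(volume.real E - volume.real A) / a| ≤ 2 / κ * s := by
    rw [abs_div, abs_of_pos ha, div_le_iff₀ ha]
    calc |volume.real E - volume.real A| ≤ s := h2
      _ = 2 / κ * s * (κ / 2) := by field_simp
      _ ≤ 2 / κ * s * a := by gcongr
  have htl : |(volume.real E - volume.real A) / a| < 1 := by linarith
  refine ⟨(volume.real E - volume.real A) / a, htb, ?_⟩
  have h3 := volume_real_shear_image i htl hA hAf
  have h4 : volume.real (shear i ((volume.real E - volume.real A) / a) '' A) = volume.real E := by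
    rw [h3, div_mul_cancel₀ _ ha.ne']; ring
  have hf := ne_top_of_le_ne_top (ENNReal.mul_ne_top (by simp) hAf) (volume_shear_image_le i htl hA)
  exact (ENNReal.toReal_eq_toReal_iff' hf hEf).1 h4

theorem volume_symmDiff_shear_image_le (i : Fin d) {t : ℝ} (ht : |t| < 1) {A E : Set (Space d)}
    (hA : MeasurableSet A) (hE : MeasurableSet E) :
    volume (symmDiff E (shear i t '' A))
      ≤ volume (symmDiff E (shear i t '' E)) + 2 * volume (symmDiff A E) := by
  refine (measure_symmDiff_le E (shear i t '' E) _).trans (add_le_add le_rfl ?_)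
  rw [← image_symmDiff (injective_shear i ht), symmDiff_comm E A]
  refine (volume_shear_image_le i ht (hA.symmDiff hE)).trans ?_
  gcongr
  rw [show (2 : ℝ≥0∞) = ENNReal.ofReal 2 by simp]
  exact ENNReal.ofReal_le_ofReal (by linarith)

/-! ### Unbounded sets do not minimize the perimeter -/

theorem tendsto_volume_sdiff_ball {E : Set (Space d)} (hE : MeasurableSet E)
    (hEf : volume E ≠ ∞) :
    Tendsto (fun n : ℕ => volume.real (E \ ball 0 (n : ℝ))) atTop (𝓝 0) := by
  have h := tendsto_measure_iInter_atTop (μ := volume) (s := fun n : ℕ => E \ ball 0 (n : ℝ))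
    (fun n => (hE.diff measurableSet_ball).nullMeasurableSet)
    (fun m n hmn => sdiff_subset_sdiff_right (ball_subset_ball (by exact_mod_cast hmn)))
    ⟨0, ne_top_of_le_ne_top hEf (measure_mono sdiff_subset)⟩
  have e : ⋂ n : ℕ, E \ ball (0 : Space d) (n : ℝ) = ∅ := by
    refine eq_empty_of_forall_notMem fun x hx => ?_
    obtain ⟨n, hn⟩ := exists_nat_gt ‖x‖
    exact ((mem_iInter.1 hx) n).2 (mem_ball_zero_iff.2 hn)
  rw [e, measure_empty] at h
  have := (ENNReal.tendsto_toReal ENNReal.zero_ne_top).comp h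
  rw [ENNReal.toReal_zero] at this
  exact this

/-- De Giorgi's iteration: if the tails of `E` satisfy the almost-minimality inequality, then `E`
is essentially contained in a ball. -/
theorem volume_sdiff_ball_eq_zero_of_tail_le (hd : 1 ≤ d) {E : Set (Space d)} (hE : MeasurableSet E)
    (hEf : volume E ≠ ∞) {M R₀ ρ : ℝ} (hM : 0 < M) (hρ : 0 < ρ)
    (hρM : 4 * ρ * M ≤ (1 / 2) ^ d)
    (hstart : 2 * volume.real (E \ ball 0 R₀) ≤ volume.real (ball (0 : Space d) ρ))
    (htail : ∀ R h : ℝ, R₀ ≤ R → 0 < h → h ≤ 1 → ∃ r ∈ Ioo R (R + h),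
      perimeter (E \ ball 0 r) ≠ ∞ ∧
        (perimeter (E \ ball 0 r)).toReal ≤ M * (volume.real (E \ ball 0 R) / h)) :
    volume (E \ ball 0 (R₀ + 1)) = 0 := by
  have hfin : ∀ s : Set (Space d), volume (E \ s) ≠ ∞ := fun s =>
    ne_top_of_le_ne_top hEf (measure_mono sdiff_subset)
  set V : ℝ → ℝ := fun r => volume.real (E \ ball 0 r)
  have hV0 : ∀ r, 0 ≤ V r := fun r => measureReal_nonneg
  have hVmono : ∀ {a b : ℝ}, a ≤ b → V b ≤ V a := fun hab =>
    measureReal_mono (sdiff_subset_sdiff_right (ball_subset_ball hab)) (hfin _)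
  have hvol : ∀ k : ℕ, volume.real (ball (0 : Space d) (ρ * (1 / 2) ^ k))
      = ((1 / 2) ^ d) ^ k * volume.real (ball (0 : Space d) ρ) := by
    intro k
    simp only [measureReal_def]
    rw [Measure.addHaar_ball_of_pos _ _ (by positivity), Measure.addHaar_ball_of_pos _ _ hρ,
      ENNReal.toReal_mul, ENNReal.toReal_mul, ENNReal.toReal_ofReal (by positivity),
      ENNReal.toReal_ofReal (by positivity), finrank_euclideanSpace_fin, mul_pow, ← pow_mul,
      ← pow_mul, mul_comm k d]
    ring
  -- The radii increase to `R₀ + 1` with gaps `(1 / 2) ^ (k + 1)`. The claimed decay matches the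
  -- volume of balls of radius `ρ * (1 / 2) ^ k`, so the isoperimetric constant gains a factor `(1 /
  -- 2) ^ k` that compensates the shrinking gap; `hρM` then makes every step contract by `(1 / 2) ^
  -- d`.
  have key : ∀ k : ℕ, V (R₀ + 1 - (1 / 2) ^ k) ≤ ((1 / 2) ^ d) ^ k * V R₀ := by
    intro k
    induction k with
    | zero => simp
    | succ k ih =>
      set R := R₀ + 1 - (1 / 2 : ℝ) ^ k with hR
      have hk1 : (1 / 2 : ℝ) ^ k ≤ 1 := pow_le_one₀ (by norm_num) (by norm_num)
      obtain ⟨r, hr, hPf, hP⟩ := htail R ((1 / 2) ^ (k + 1)) (by simp only [hR]; linarith)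
        (by positivity) (pow_le_one₀ (by norm_num) (by norm_num))
      have hRR : R + (1 / 2) ^ (k + 1) = R₀ + 1 - (1 / 2) ^ (k + 1) := by
        rw [hR, pow_succ]; ring
      have h1 : V (R₀ + 1 - (1 / 2) ^ (k + 1)) ≤ V r := hVmono (by linarith [hr.2])
      have h2 : V r ≤ V R := hVmono hr.1.le
      have hball : 2 * volume (E \ ball 0 r) ≤ volume (ball (0 : Space d) (ρ * (1 / 2) ^ k)) := by
        rw [← ENNReal.toReal_le_toReal (ENNReal.mul_ne_top (by simp) (hfin _))
          measure_ball_lt_top.ne, ENNReal.toReal_mul]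
        change 2 * V r ≤ volume.real _
        rw [hvol]
        calc 2 * V r ≤ 2 * (((1 / 2) ^ d) ^ k * V R₀) := by linarith
          _ = ((1 / 2) ^ d) ^ k * (2 * V R₀) := by ring
          _ ≤ _ := by gcongr
      have hiso := volume_le_mul_perimeter (hE.diff measurableSet_ball) (hfin _) hPf
        (by positivity) hball
      have hiso' : V r ≤ 2 * (ρ * (1 / 2) ^ k) * (perimeter (E \ ball 0 r)).toReal := by
        have := ENNReal.toReal_mono (ENNReal.mul_ne_top (ENNReal.mul_ne_top (by simp) (by simp))
          hPf) hiso
        rw [ENNReal.toReal_mul, ENNReal.toReal_mul, ENNReal.toReal_ofReal (by positivity)] at this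
        exact this
      calc V (R₀ + 1 - (1 / 2) ^ (k + 1)) ≤ V r := h1
        _ ≤ 2 * (ρ * (1 / 2) ^ k) * (perimeter (E \ ball 0 r)).toReal := hiso'
        _ ≤ 2 * (ρ * (1 / 2) ^ k) * (M * (V R / (1 / 2) ^ (k + 1))) := by gcongr
        _ = 4 * ρ * M * V R := by rw [pow_succ]; field_simp; ring
        _ ≤ (1 / 2) ^ d * (((1 / 2) ^ d) ^ k * V R₀) := by gcongr
        _ = ((1 / 2) ^ d) ^ (k + 1) * V R₀ := by ring
  have hlim : Tendsto (fun k : ℕ => ((1 / 2 : ℝ) ^ d) ^ k * V R₀) atTop (𝓝 (0 * V R₀)) :=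
    (tendsto_pow_atTop_nhds_zero_of_lt_one (by positivity)
      (pow_lt_one₀ (by norm_num) (by norm_num) (by omega))).mul_const _
  have hle : V (R₀ + 1) ≤ 0 * V R₀ := ge_of_tendsto' hlim fun k =>
    (hVmono (by linarith [show (0 : ℝ) < (1 / 2) ^ k by positivity])).trans (key k)
  rw [zero_mul] at hle
  have := le_antisymm hle (hV0 _)
  rwa [measureReal_eq_zero_iff (hfin _)] at this

/-- An unbounded open set is not a local volume-constrained minimizer of the perimeter. -/
theorem exists_perimeter_lt_of_unbounded (hd : 1 ≤ d) {E : Set (Space d)} (hE : IsOpen E)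
    (hEf : volume E ≠ ∞) (hE0 : volume E ≠ 0) (hP : perimeter E ≠ ∞)
    (hub : ¬ Bornology.IsBounded E) {ε : ℝ≥0∞} (hε : 0 < ε) {ζ : ℝ} (hζ : 0 < ζ) :
    ∃ F : Set (Space d), IsOpen F ∧ volume F = volume E ∧ volume (symmDiff E F) < ε ∧
      (∀ x ∈ F, ∃ y ∈ E, dist x y ≤ ζ) ∧ perimeter F < perimeter E := by
  -- Without a better competitor, removing the tail of `E` outside a ball of radius r and restoring
  -- the volume by a shear of size at most `C * V r` cannot reduce the perimeter. Combined with the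
  -- truncation inequality, this bounds the perimeter of the tail by a multiple of `V R / h`, the
  -- hypothesis of De Giorgi's iteration.
  by_contra! hcon
  set i : Fin d := ⟨0, hd⟩
  have hEm := hE.measurableSet
  obtain ⟨C, hC, hcorr⟩ := exists_shear_volume_eq i hEm hEf hE0
  obtain ⟨C', hC', htrunc⟩ := exists_perimeter_truncation_le hd
  obtain ⟨ε', hε', hε'ε⟩ := exists_between hε
  obtain ⟨t₀, ht₀, ht₁, ht₂, hL1⟩ : ∃ t₀ : ℝ, 0 < t₀ ∧ t₀ < 1 ∧ 2 * t₀ ≤ ζ ∧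
      ∀ t, |t| ≤ t₀ → volume (symmDiff E (shear i t '' E)) ≤ ε' / 2 := by
    obtain ⟨t₀, ht₀, ht₁, hL1⟩ := exists_volume_symmDiff_shear_le i hEm hEf
      (ENNReal.half_pos hε'.ne').ne'
    exact ⟨min t₀ (ζ / 2), by positivity, (min_le_left _ _).trans_lt ht₁,
      by linarith [min_le_right t₀ (ζ / 2)], fun t ht => hL1 t (ht.trans (min_le_left _ _))⟩
  set p := (perimeter E).toReal
  have hp : 0 ≤ p := ENNReal.toReal_nonneg
  set M := C * p + C'
  have hM : 0 < M := by positivity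
  have hfin : ∀ s : Set (Space d), volume (E \ s) ≠ ∞ := fun s =>
    ne_top_of_le_ne_top hEf (measure_mono sdiff_subset)
  set V : ℝ → ℝ := fun r => volume.real (E \ ball 0 r)
  have hV0 : ∀ r, 0 ≤ V r := fun r => measureReal_nonneg
  have hVmono : ∀ {a b : ℝ}, a ≤ b → V b ≤ V a := fun hab =>
    measureReal_mono (sdiff_subset_sdiff_right (ball_subset_ball hab)) (hfin _)
  set ρ : ℝ := (1 / 2) ^ d / (4 * M)
  have hρ : 0 < ρ := by positivity
  have hω : 0 < volume.real (ball (0 : Space d) ρ) :=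
    ENNReal.toReal_pos (measure_ball_pos volume 0 hρ).ne' measure_ball_lt_top.ne
  have hε'r : 0 < (min ε' 1).toReal := ENNReal.toReal_pos (by simp [hε'.ne'])
    (ne_top_of_le_ne_top ENNReal.one_ne_top (min_le_right _ _))
  -- In order, the bounds keep the shear below `t₀`, make the volume correction applicable, start
  -- the iteration, and keep the removed tail small in L¹.
  set τ : ℝ := min (min (t₀ / C) (1 / (2 * C)))
    (min (volume.real (ball (0 : Space d) ρ) / 2) ((min ε' 1).toReal / 4))
  have hτ : 0 < τ := by positivity
  obtain ⟨n, hn, hn1⟩ := (((tendsto_volume_sdiff_ball hEm hEf).eventually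
    (Iio_mem_nhds hτ)).and (eventually_ge_atTop 1)).exists
  set R₀ : ℝ := (n : ℝ)
  have hR₀ : 0 < R₀ := by simp only [R₀]; exact_mod_cast hn1
  have hVR : V R₀ < τ := hn
  have hlow : ∀ r, R₀ ≤ r → perimeter (E ∩ ball 0 r) ≠ ∞ →
      p - (perimeter (E ∩ ball 0 r)).toReal ≤ C * V r * p := by
    intro r hr hPr
    have hVr : V r < τ := (hVmono hr).trans_lt hVR
    have hm : MeasurableSet (E ∩ ball 0 r) := hEm.inter measurableSet_ball
    have hsd : symmDiff (E ∩ ball 0 r) E = E \ ball 0 r := by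
      ext x; simp only [mem_symmDiff, mem_inter_iff, Set.mem_sdiff]; tauto
    have hsV : volume.real (symmDiff (E ∩ ball 0 r) E) = V r := by rw [hsd]
    have hCV : C * V r ≤ min t₀ (1 / 2) := by
      have h1 := hVr.le.trans ((min_le_left _ _).trans (min_le_left _ _))
      have h2 := hVr.le.trans ((min_le_left _ _).trans (min_le_right _ _))
      rw [le_div_iff₀ hC] at h1
      rw [le_div_iff₀ (by positivity)] at h2
      exact le_min (by linarith) (by linarith)
    obtain ⟨t, ht, hvol⟩ := hcorr (E ∩ ball 0 r) hm
      (ne_top_of_le_ne_top hEf (measure_mono inter_subset_left))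
      (by rw [hsV]; exact hCV.trans (min_le_right _ _))
    rw [hsV] at ht
    have htt : |t| ≤ t₀ := ht.trans (hCV.trans (min_le_left _ _))
    have ht1 : |t| < 1 := htt.trans_lt ht₁
    obtain ⟨φ, hφ⟩ := exists_homeomorph_shear i ht1
    have hopen : IsOpen (shear i t '' (E ∩ ball 0 r)) := by
      rw [← hφ]; exact φ.isOpenMap _ (hE.inter isOpen_ball)
    have hclose : volume (symmDiff E (shear i t '' (E ∩ ball 0 r))) < ε := by
      refine (volume_symmDiff_shear_image_le i ht1 hm hEm).trans_lt (lt_of_le_of_lt ?_ hε'ε)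
      rw [hsd, ← ENNReal.add_halves ε']
      refine add_le_add (hL1 t htt) ?_
      have h4 := hVr.le.trans ((min_le_right _ _).trans (min_le_right _ _))
      have h5 : volume (E \ ball 0 r) ≤ min ε' 1 / 4 := by
        have h6 := ENNReal.ofReal_le_ofReal h4
        rw [ENNReal.ofReal_div_of_pos (by norm_num), ENNReal.ofReal_toReal
          (ne_top_of_le_ne_top ENNReal.one_ne_top (min_le_right _ _))] at h6
        simp only [V] at h6
        rw [ofReal_measureReal (hfin _)] at h6
        simpa using h6
      calc 2 * volume (E \ ball 0 r) ≤ 2 * (ε' / 4) := by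
            gcongr; exact h5.trans (by gcongr; exact min_le_left _ _)
        _ = ε' / 2 := by
            rw [show (4 : ℝ≥0∞) = 2 * 2 by norm_num, div_eq_mul_inv, div_eq_mul_inv,
              ENNReal.mul_inv (by simp) (by simp)]
            rw [show (2 : ℝ≥0∞) * (ε' * (2⁻¹ * 2⁻¹)) = ε' * 2⁻¹ * (2 * 2⁻¹) by ring,
              ENNReal.mul_inv_cancel (by simp) (by simp), mul_one]
    have hnear : ∀ x ∈ shear i t '' (E ∩ ball 0 r), ∃ y ∈ E, dist x y ≤ ζ := by
      rintro _ ⟨y, hy, rfl⟩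
      exact ⟨y, hy.1, (dist_shear_self_le i t y).trans (by linarith)⟩
    have h7 := (hcon _ hopen hvol hclose hnear).trans (perimeter_shear_image_le i ht1 hm)
    have h8 : p ≤ (1 + |t|) * (perimeter (E ∩ ball 0 r)).toReal := by
      have := ENNReal.toReal_mono (ENNReal.mul_ne_top (by simp) hPr) h7
      rwa [ENNReal.toReal_mul, ENNReal.toReal_ofReal (by positivity)] at this
    set q := (perimeter (E ∩ ball 0 r)).toReal
    have hq : 0 ≤ q := ENNReal.toReal_nonneg
    rcases le_or_gt q p with hqp | hqp
    · have h9 : |t| * q ≤ C * V r * p := by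
        have := hV0 r
        gcongr
      linarith
    · have : 0 ≤ C * V r * p := by have := hV0 r; positivity
      linarith
  have hzero := volume_sdiff_ball_eq_zero_of_tail_le hd hEm hEf (M := M) (R₀ := R₀) (ρ := ρ) hM hρ
    (by simp only [ρ]; field_simp; exact le_rfl)
    (by
      have h := hVR.le.trans ((min_le_right _ _).trans (min_le_left _ _))
      simp only [V] at h
      linarith)
    (by
      intro R h hR hh hh1
      obtain ⟨r, hr, hf1, hf2, hle⟩ := htrunc E hEm hEf hP R h (hR₀.trans_le hR) hh
      refine ⟨r, hr, hf2, ?_⟩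
      have h1 := hlow r (hR.trans hr.1.le) hf1
      have h2 : C * V r * p ≤ C * p * (V R / h) := by
        have h3 : V r ≤ V R := hVmono hr.1.le
        have h4 : V R ≤ V R / h := by
          rw [le_div_iff₀ hh]
          exact mul_le_of_le_one_right (hV0 R) hh1
        calc C * V r * p = C * p * V r := by ring
          _ ≤ C * p * (V R / h) := by gcongr; exact h3.trans h4
      have h5 : M * (V R / h) = C * p * (V R / h) + C' * (V R / h) := by simp only [M]; ring
      simp only [V] at h2 h5
      rw [h5]
      linarith)
  -- Openness enters here: the part of `E` outside the closed ball is open and null, hence empty.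
  refine hub ((isBounded_closedBall (x := (0 : Space d)) (r := R₀ + 1)).subset fun x hx => ?_)
  by_contra hx'
  have hop : IsOpen (E \ closedBall 0 (R₀ + 1)) := hE.sdiff isClosed_closedBall
  have h0 : volume (E \ closedBall 0 (R₀ + 1)) = 0 :=
    measure_mono_null (sdiff_subset_sdiff_right ball_subset_closedBall) hzero
  exact (hop.measure_pos volume ⟨x, hx, hx'⟩).ne' h0


/-! ### Riesz energy -/

theorem measurable_kernel (α : ℝ) :
    Measurable fun p : Space d × Space d => edist p.1 p.2 ^ (-α) :=
  measurable_edist.pow_const _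

theorem measurable_kernel_right (α : ℝ) (x : Space d) :
    Measurable fun y : Space d => edist x y ^ (-α) :=
  (measurable_edist_right).pow_const _

theorem rpow_neg_anti (hα : 0 ≤ α) {a b : ℝ≥0∞} (hab : a ≤ b) : b ^ (-α) ≤ a ^ (-α) := by
  rw [ENNReal.rpow_neg, ENNReal.rpow_neg]
  exact ENNReal.inv_le_inv.2 (ENNReal.rpow_le_rpow hab hα)

theorem rieszEnergy_mono {μ ν : Measure (Space d)} (h : μ ≤ ν) :
    rieszEnergy α μ ≤ rieszEnergy α ν := by
  unfold rieszEnergy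
  exact lintegral_mono' h fun x => lintegral_mono' h fun y => le_rfl

theorem rieszEnergy_smul (c : ℝ≥0∞) (hc : c ≠ ∞) (μ : Measure (Space d)) :
    rieszEnergy α (c • μ) = c ^ 2 * rieszEnergy α μ := by
  unfold rieszEnergy
  simp_rw [lintegral_smul_measure, smul_eq_mul]
  rw [lintegral_const_mul' _ _ hc]
  ring

theorem setEnergy_le {μ : Measure (Space d)} {A : Set (Space d)} (h : μ A = 1) :
    setEnergy α A ≤ rieszEnergy α μ :=
  iInf₂_le μ h

/-- Measures admitted in `setEnergy` may charge the complement of `A`; restricting them to `A` only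
lowers the energy and gives probability measures. -/
theorem exists_rieszEnergy_lt {A : Set (Space d)} (hA : MeasurableSet A) {v : ℝ≥0∞}
    (h : setEnergy α A < v) : ∃ μ : Measure (Space d), IsProbabilityMeasure μ ∧ μ Aᶜ = 0 ∧
      rieszEnergy α μ < v := by
  unfold setEnergy at h
  obtain ⟨μ, h⟩ := iInf_lt_iff.1 h
  obtain ⟨hμ, h⟩ := iInf_lt_iff.1 h
  refine ⟨μ.restrict A, ⟨by simpa using hμ⟩, by rw [Measure.restrict_apply hA.compl]; simp,
    (rieszEnergy_mono Measure.restrict_le_self).trans_lt h⟩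

/-- The energy is quadratic in the charge, so one normalises by the mass on `A`. This form also
serves charges of mass different from 1. -/
theorem sq_mul_setEnergy_le {A : Set (Space d)} (μ : Measure (Space d)) (hA : μ A ≠ ∞) :
    μ A ^ 2 * setEnergy α A ≤ rieszEnergy α μ := by
  by_cases h0 : μ A = 0
  · simp [h0]
  have h1 : ((μ A)⁻¹ • μ) A = 1 := by
    rw [Measure.smul_apply, smul_eq_mul, ENNReal.inv_mul_cancel h0 hA]
  have h2 := setEnergy_le (α := α) h1
  rw [rieszEnergy_smul _ (ENNReal.inv_ne_top.2 h0)] at h2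
  calc μ A ^ 2 * setEnergy α A ≤ μ A ^ 2 * ((μ A)⁻¹ ^ 2 * rieszEnergy α μ) := by gcongr
    _ = rieszEnergy α μ := by
      rw [← mul_assoc, ← mul_pow, ENNReal.mul_inv_cancel h0 hA, one_pow, one_mul]

theorem setEnergy_anti {A B : Set (Space d)} (hA : MeasurableSet A) (hAB : A ⊆ B) :
    setEnergy α B ≤ setEnergy α A := by
  refine le_of_forall_gt fun v hv => ?_
  obtain ⟨μ, hμ, h0, hv⟩ := exists_rieszEnergy_lt hA hv
  have h1 : μ B = 1 := (prob_compl_eq_zero_iff₀ (by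
    exact NullMeasurableSet.of_compl (NullMeasurableSet.of_null
      (measure_mono_null (compl_subset_compl.2 hAB) h0)))).1
    (measure_mono_null (compl_subset_compl.2 hAB) h0)
  exact (setEnergy_le h1).trans_lt hv

theorem rieszEnergy_map {φ : Space d → Space d} (hφ : Measurable φ) (μ : Measure (Space d))
    [SFinite μ] :
    rieszEnergy α (μ.map φ) = ∫⁻ x, ∫⁻ y, edist (φ x) (φ y) ^ (-α) ∂μ ∂μ := by
  unfold rieszEnergy
  have h1 : ∀ x, ∫⁻ y, edist x y ^ (-α) ∂(μ.map φ) = ∫⁻ y, edist x (φ y) ^ (-α) ∂μ := fun x =>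
    lintegral_map (measurable_kernel_right α x) hφ
  rw [lintegral_congr h1]
  have hm : Measurable fun p : Space d × Space d => edist p.1 (φ p.2) ^ (-α) :=
    (measurable_fst.edist (hφ.comp measurable_snd)).pow_const _
  have h2 : Measurable fun x : Space d => ∫⁻ y, edist x (φ y) ^ (-α) ∂μ :=
    hm.lintegral_prod_right'
  rw [lintegral_map h2 hφ]

/-- Push a charge on `A` forward: distances shrink by a factor no smaller than `c`, so the kernel
grows by at most `c ^ (-α)`. -/
theorem setEnergy_image_le (hα : 0 ≤ α) {φ : Space d → Space d} (hφ : Measurable φ)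
    {c : ℝ} (hc : 0 < c) (hexp : ∀ x y, c * dist x y ≤ dist (φ x) (φ y)) {A : Set (Space d)}
    (hA : MeasurableSet A) (hφA : MeasurableSet (φ '' A)) :
    setEnergy α (φ '' A) ≤ ENNReal.ofReal (c ^ (-α)) * setEnergy α A := by
  have hc0 : ENNReal.ofReal (c ^ (-α)) ≠ 0 := by
    rw [Ne, ENNReal.ofReal_eq_zero, not_le]; positivity
  rw [mul_comm, ← ENNReal.div_le_iff hc0 ENNReal.ofReal_ne_top]
  refine le_of_forall_gt fun v hv => ?_
  obtain ⟨μ, hμ, h0, hv⟩ := exists_rieszEnergy_lt hA hv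
  have h1 : (μ.map φ) (φ '' A) = 1 := by
    rw [Measure.map_apply hφ hφA]
    have : μ A = 1 := (prob_compl_eq_zero_iff hA).1 h0
    exact le_antisymm prob_le_one (this ▸ measure_mono (subset_preimage_image φ A))
  refine lt_of_le_of_lt ?_ hv
  rw [ENNReal.div_le_iff hc0 ENNReal.ofReal_ne_top, mul_comm]
  refine (setEnergy_le h1).trans ?_
  rw [rieszEnergy_map hφ, rieszEnergy, ← lintegral_const_mul' _ _ ENNReal.ofReal_ne_top]
  refine lintegral_mono fun x => ?_
  simp only
  rw [← lintegral_const_mul' _ _ ENNReal.ofReal_ne_top]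
  refine lintegral_mono fun y => ?_
  simp only
  have h2 : ENNReal.ofReal c * edist x y ≤ edist (φ x) (φ y) := by
    rw [edist_dist, edist_dist, ← ENNReal.ofReal_mul hc.le]
    exact ENNReal.ofReal_le_ofReal (hexp x y)
  refine (rpow_neg_anti hα h2).trans (le_of_eq ?_)
  rw [ENNReal.mul_rpow_of_ne_top ENNReal.ofReal_ne_top (edist_ne_top _ _),
    ENNReal.ofReal_rpow_of_pos hc]

theorem setEnergy_shear_image_le (hα : 0 ≤ α) (i : Fin d) {t : ℝ} (ht : |t| < 1)
    {A : Set (Space d)} (hA : MeasurableSet A) :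
    setEnergy α (shear i t '' A) ≤ ENNReal.ofReal ((1 - |t|) ^ (-α)) * setEnergy α A :=
  setEnergy_image_le hα (contDiff_shear i t).continuous.measurable (by linarith)
    (le_dist_shear i t) hA (measurableSet_shear_image i ht hA)

/-- The kernel is bounded below on pairs of points of a bounded set. Consequently vanishing energy
forces unboundedness and never occurs for compact sets. -/
theorem setEnergy_pos_of_isBounded (hα : 0 ≤ α) {E : Set (Space d)} (hE : MeasurableSet E)
    (hb : Bornology.IsBounded E) : 0 < setEnergy α E := by
  obtain ⟨R, hR0, hR⟩ := hb.subset_ball_lt 0 (0 : Space d)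
  have hpos : 0 < ENNReal.ofReal (2 * R) ^ (-α) :=
    ENNReal.rpow_pos (by simpa using hR0) ENNReal.ofReal_ne_top
  refine hpos.trans_le (le_iInf₂ fun μ hμ => ?_)
  unfold rieszEnergy
  have h1 : ∀ x ∈ E, ENNReal.ofReal (2 * R) ^ (-α) ≤ ∫⁻ y, edist x y ^ (-α) ∂μ := by
    intro x hx
    calc ENNReal.ofReal (2 * R) ^ (-α) = ∫⁻ y in E, ENNReal.ofReal (2 * R) ^ (-α) ∂μ := by
          rw [setLIntegral_const, hμ, mul_one]
      _ ≤ ∫⁻ y in E, edist x y ^ (-α) ∂μ := by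
          refine setLIntegral_mono (measurable_kernel_right α x) fun y hy => ?_
          refine rpow_neg_anti hα ?_
          rw [edist_dist]
          refine ENNReal.ofReal_le_ofReal ?_
          have hx := mem_ball.1 (hR hx)
          have hy := mem_ball'.1 (hR hy)
          linarith [dist_triangle x 0 y]
      _ ≤ _ := setLIntegral_le_lintegral _ _
  calc ENNReal.ofReal (2 * R) ^ (-α) = ∫⁻ x in E, ENNReal.ofReal (2 * R) ^ (-α) ∂μ := by
        rw [setLIntegral_const, hμ, mul_one]
    _ ≤ ∫⁻ x in E, ∫⁻ y, edist x y ^ (-α) ∂μ ∂μ := setLIntegral_mono' hE h1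
    _ ≤ _ := setLIntegral_le_lintegral _ _

/-! ### Potentials of balls -/

/-- In polar coordinates the integrand is a power with exponent `d - 1 - α > -1`. -/
theorem lintegral_kernel_unitBall_ne_top (hd : 1 ≤ d) (hα : α < d) :
    ∫⁻ z in ball (0 : Space d) 1, ‖z‖ₑ ^ (-α) ≠ ∞ := by
  have : Nonempty (Fin d) := ⟨⟨0, hd⟩⟩
  have h1 : IntegrableOn (fun z : Space d => (fun s : ℝ => s ^ (-α)) ‖z‖) (ball 0 1) := by
    refine (integrableOn_fun_norm_addHaar volume (f := fun s : ℝ => s ^ (-α))).2 ?_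
    rw [finrank_euclideanSpace_fin]
    have h2 : IntegrableOn (fun y : ℝ => y ^ ((d : ℝ) - 1 - α)) (Ioo 0 1) :=
      (intervalIntegral.integrableOn_Ioo_rpow_iff one_pos).2 (by linarith)
    refine h2.congr_fun (fun y hy => ?_) measurableSet_Ioo
    simp only [smul_eq_mul]
    rw [sub_eq_add_neg, Real.rpow_add hy.1, ← Nat.cast_one, ← Nat.cast_sub hd, Real.rpow_natCast]
  refine ne_of_lt (lt_of_le_of_lt (le_of_eq ?_) h1.lintegral_lt_top)
  refine setLIntegral_congr_fun_ae measurableSet_ball ?_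
  have hae : ∀ᵐ z : Space d, z ≠ 0 := by
    rw [ae_iff]; simp
  filter_upwards [hae] with z hz _
  rw [← ENNReal.ofReal_rpow_of_pos (norm_pos_iff.2 hz), ofReal_norm]

theorem exists_lintegral_kernel_ball_le (hd : 1 ≤ d) (hα : α < d) : ∃ J : ℝ≥0∞, J ≠ ∞ ∧
    ∀ (x : Space d) (r : ℝ), 0 < r → ∫⁻ y in ball x r, edist x y ^ (-α)
      ≤ J * ENNReal.ofReal r ^ (-α) * volume (ball (0 : Space d) r) := by
  set J₀ := ∫⁻ z in ball (0 : Space d) 1, ‖z‖ₑ ^ (-α) with hJ₀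
  have hJ₀f : J₀ ≠ ∞ := lintegral_kernel_unitBall_ne_top hd hα
  set ω := volume (ball (0 : Space d) 1)
  have hω0 : ω ≠ 0 := (measure_ball_pos volume 0 one_pos).ne'
  have hωf : ω ≠ ∞ := measure_ball_lt_top.ne
  refine ⟨J₀ * ω⁻¹, ENNReal.mul_ne_top hJ₀f (ENNReal.inv_ne_top.2 hω0), fun x r hr => le_of_eq ?_⟩
  have himg : ball x r = (fun z : Space d => x + r • z) '' ball 0 1 := by
    have := image_comp (fun z : Space d => x + z) (fun z => r • z) (ball (0 : Space d) 1)
    rw [show (fun z : Space d => x + r • z) = (fun z => x + z) ∘ fun z => r • z from rfl, this,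
      image_smul, _root_.smul_ball hr.ne']
    simp [abs_of_pos hr]
  have hder : ∀ z ∈ ball (0 : Space d) 1, HasFDerivWithinAt (fun z : Space d => x + r • z)
      (r • ContinuousLinearMap.id ℝ (Space d)) (ball 0 1) z := fun z _ =>
    (((hasFDerivAt_id z).const_smul r).const_add x).hasFDerivWithinAt
  have hinj : InjOn (fun z : Space d => x + r • z) (ball 0 1) := fun a _ b _ hab =>
    smul_right_injective _ hr.ne' (add_left_cancel hab)
  have hdet : (r • ContinuousLinearMap.id ℝ (Space d)).det = r ^ d := by
    rw [ContinuousLinearMap.det]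
    simp
  rw [himg, lintegral_image_eq_lintegral_abs_det_fderiv_mul volume measurableSet_ball hder hinj,
    hdet, abs_of_pos (by positivity)]
  have hk : ∀ z : Space d, edist x (x + r • z) ^ (-α) = ENNReal.ofReal r ^ (-α) * ‖z‖ₑ ^ (-α) := by
    intro z
    rw [edist_eq_enorm_sub, sub_add_cancel_left, enorm_neg, enorm_smul,
      ENNReal.mul_rpow_of_ne_top enorm_ne_top enorm_ne_top, Real.enorm_of_nonneg hr.le]
  simp_rw [hk]
  have hrα : ENNReal.ofReal r ^ (-α) ≠ ∞ := by
    rw [ENNReal.ofReal_rpow_of_pos hr]; exact ENNReal.ofReal_ne_top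
  rw [lintegral_const_mul' _ _ ENNReal.ofReal_ne_top, lintegral_const_mul' _ _ hrα, ← hJ₀,
    Measure.addHaar_ball_of_pos _ _ hr, finrank_euclideanSpace_fin]
  change _ = _ * (_ * ω)
  rw [show J₀ * ω⁻¹ * ENNReal.ofReal r ^ (-α) * (ENNReal.ofReal (r ^ d) * ω)
    = ENNReal.ofReal (r ^ d) * (ENNReal.ofReal r ^ (-α) * J₀) * (ω * ω⁻¹) by ring,
    ENNReal.mul_inv_cancel hω0 hωf, mul_one]

/-- The singular part is majorised by the whole ball around `z`, which makes the bound uniform in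
`z`; outside it the kernel is at most `r ^ (-α)`. -/
theorem lintegral_kernel_le_add (hα : 0 ≤ α) (z : Space d) (r : ℝ) {A : Set (Space d)}
    (hA : MeasurableSet A) :
    ∫⁻ y in A, edist z y ^ (-α) ≤ (∫⁻ y in ball z r, edist z y ^ (-α))
      + ENNReal.ofReal r ^ (-α) * volume A := by
  have hsub : A ⊆ ball z r ∪ (A \ ball z r) := fun y hy => by
    by_cases h : y ∈ ball z r
    exacts [Or.inl h, Or.inr ⟨hy, h⟩]
  refine (lintegral_mono_set hsub).trans ((lintegral_union_le _ _ _).trans (add_le_add le_rfl ?_))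
  calc ∫⁻ y in A \ ball z r, edist z y ^ (-α)
      ≤ ∫⁻ y in A \ ball z r, ENNReal.ofReal r ^ (-α) := by
        refine setLIntegral_mono' (hA.diff measurableSet_ball) fun y hy => rpow_neg_anti hα ?_
        rw [edist_dist]
        refine ENNReal.ofReal_le_ofReal ?_
        have := hy.2
        rwa [mem_ball', not_lt] at this
    _ ≤ _ := by
        rw [setLIntegral_const]
        gcongr
        exact sdiff_subset

/-- Lebesgue measure on `A` has bounded potential, hence finite energy. -/
theorem setEnergy_ne_top (hd : 1 ≤ d) (hα₀ : 0 ≤ α) (hα : α < d) {A : Set (Space d)}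
    (hA : MeasurableSet A) (hA0 : volume A ≠ 0) (hAf : volume A ≠ ∞) : setEnergy α A ≠ ∞ := by
  obtain ⟨J, hJ, hball⟩ := exists_lintegral_kernel_ball_le hd hα
  set c := J * ENNReal.ofReal 1 ^ (-α) * volume (ball (0 : Space d) 1)
    + ENNReal.ofReal 1 ^ (-α) * volume A
  have hc : c ≠ ∞ := by
    simp only [c, ENNReal.ofReal_one, ENNReal.one_rpow, mul_one, one_mul]
    exact ENNReal.add_ne_top.2 ⟨ENNReal.mul_ne_top hJ measure_ball_lt_top.ne, hAf⟩
  have h := sq_mul_setEnergy_le (α := α) (A := A) (volume.restrict A) (by simpa using hAf)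
  have hle : rieszEnergy α (volume.restrict A) ≤ c * volume A := by
    unfold rieszEnergy
    rw [← setLIntegral_const]
    exact lintegral_mono fun x => (lintegral_kernel_le_add hα₀ x 1 hA).trans
      (add_le_add (hball x 1 one_pos) le_rfl)
  intro htop
  rw [htop, ENNReal.mul_top (by simpa using hA0)] at h
  exact ENNReal.mul_ne_top hc hAf (top_le_iff.1 (h.trans hle))


/-! ### Enlarging a set strictly decreases its Riesz energy -/

theorem measurable_potential (α : ℝ) (μ : Measure (Space d)) [SFinite μ] :
    Measurable fun x : Space d => ∫⁻ y, edist x y ^ (-α) ∂μ :=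
  (measurable_kernel α).lintegral_prod_right'

theorem rieszEnergy_add (μ ν : Measure (Space d)) [SFinite μ] [SFinite ν] :
    rieszEnergy α (μ + ν) = rieszEnergy α μ + rieszEnergy α ν
      + ((∫⁻ x, ∫⁻ y, edist x y ^ (-α) ∂ν ∂μ) + ∫⁻ x, ∫⁻ y, edist x y ^ (-α) ∂μ ∂ν) := by
  unfold rieszEnergy
  simp_rw [lintegral_add_measure]
  rw [lintegral_add_left (measurable_potential α μ), lintegral_add_left (measurable_potential α μ)]
  ring

theorem lintegral_restrict_kernel_le (hα : 0 ≤ α) {μ ν : Measure (Space d)}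
    (hμ : μ univ ≤ 1) (hν : ν univ ≤ 1) {A B : Set (Space d)} (hA : MeasurableSet A)
    (hB : MeasurableSet B) {L : ℝ} (h : ∀ x ∈ A, ∀ y ∈ B, L ≤ dist x y) :
    ∫⁻ x in A, ∫⁻ y in B, edist x y ^ (-α) ∂ν ∂μ ≤ ENNReal.ofReal L ^ (-α) := by
  have h1 : ∀ x ∈ A, ∫⁻ y in B, edist x y ^ (-α) ∂ν ≤ ENNReal.ofReal L ^ (-α) := by
    intro x hx
    calc ∫⁻ y in B, edist x y ^ (-α) ∂ν ≤ ∫⁻ y in B, ENNReal.ofReal L ^ (-α) ∂ν := by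
          refine setLIntegral_mono' hB fun y hy => rpow_neg_anti hα ?_
          rw [edist_dist]
          exact ENNReal.ofReal_le_ofReal (h x hx y hy)
      _ = ENNReal.ofReal L ^ (-α) * ν B := setLIntegral_const _ _
      _ ≤ ENNReal.ofReal L ^ (-α) * 1 := by gcongr; exact (measure_mono (subset_univ _)).trans hν
      _ = _ := mul_one _
  calc _ ≤ ∫⁻ x in A, ENNReal.ofReal L ^ (-α) ∂μ := setLIntegral_mono' hA h1
    _ = ENNReal.ofReal L ^ (-α) * μ A := setLIntegral_const _ _
    _ ≤ ENNReal.ofReal L ^ (-α) * 1 := by gcongr; exact (measure_mono (subset_univ _)).trans hμ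
    _ = _ := mul_one _

/-- Nearly optimal charge distributions do not escape to infinity. -/
theorem exists_ball_measure_ge (hα : 0 < α) {E : Set (Space d)} (hE : MeasurableSet E)
    (h0 : setEnergy α E ≠ 0) (hf : setEnergy α E ≠ ∞) : ∃ R : ℝ, 0 < R ∧
    ∀ μ : Measure (Space d), IsProbabilityMeasure μ → μ Eᶜ = 0 →
      rieszEnergy α μ ≤ ENNReal.ofReal (9 / 8 * (setEnergy α E).toReal) →
      1 / 4 ≤ μ.real (ball 0 R) := by
  set I := (setEnergy α E).toReal with hI
  have hI0 : 0 < I := ENNReal.toReal_pos h0 hf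
  have hIE : setEnergy α E = ENNReal.ofReal I := (ENNReal.ofReal_toReal hf).symm
  obtain ⟨μ₀, hμ₀, hμ₀E, hμ₀e⟩ := exists_rieszEnergy_lt (α := α) (v := ENNReal.ofReal (9 / 8 * I)) hE
    (by rw [hIE]; exact (ENNReal.ofReal_lt_ofReal_iff (by positivity)).2 (by linarith))
  obtain ⟨n, hn⟩ : ∃ n : ℕ, 19 / 20 < μ₀.real (ball (0 : Space d) n) := by
    have h1 := tendsto_measure_iUnion_atTop (μ := μ₀) (s := fun n : ℕ => ball (0 : Space d) (n : ℝ))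
      (fun m n hmn => ball_subset_ball (by exact_mod_cast hmn))
    rw [iUnion_ball_nat, measure_univ] at h1
    have h2 := (ENNReal.tendsto_toReal ENNReal.one_ne_top).comp h1
    rw [ENNReal.toReal_one] at h2
    exact (h2.eventually (p := fun y => 19 / 20 < y) (Ioi_mem_nhds (by norm_num))).exists
  obtain ⟨L, hL0, hL⟩ : ∃ L : ℝ, 0 < L ∧ L ^ (-α) < I / 4 := by
    have h1 := (tendsto_rpow_neg_atTop hα).eventually (p := fun y => y < I / 4)
      (Iio_mem_nhds (by positivity))
    obtain ⟨L, h1, h2⟩ := (h1.and (eventually_gt_atTop 0)).exists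
    exact ⟨L, h2, h1⟩
  refine ⟨n + L, by positivity, fun μ hμ hμE hμe => ?_⟩
  by_contra! hsmall
  set B := ball (0 : Space d) (n : ℝ)
  set B' := ball (0 : Space d) (n + L)
  -- If `μ` had little mass in `B'`, the mixture `σ` would be too efficient. Its two parts are at
  -- distance at least `L`, so its energy is at most (9/8 + 9/8 + 1/4 + 1/4) I = (11/4) I. Its mass
  -- is at least 19/20 + 3/4 = 17/10, which requires energy at least (17/10)² I = 2.89 I.
  set σ := μ₀.restrict B + μ.restrict B'ᶜ with hσ
  have hsep : ∀ x ∈ B, ∀ y ∈ B'ᶜ, L ≤ dist x y := by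
    intro x hx y hy
    have h1 : dist x 0 < n := hx
    have h2 : n + L ≤ dist y 0 := not_lt.1 hy
    have := dist_triangle_left y 0 x
    linarith
  have hσE : σ E = μ₀ B + μ B'ᶜ := by
    have h1 : ∀ (ν : Measure (Space d)) (S : Set (Space d)), ν Eᶜ = 0 → ν (E ∩ S) = ν S := by
      intro ν S hν
      refine measure_congr ?_
      have : E =ᵐ[ν] univ := eventuallyEq_univ.2 (by simpa [mem_ae_iff] using hν)
      simpa using this.inter (ae_eq_refl S)
    rw [hσ, Measure.add_apply, Measure.restrict_apply hE, Measure.restrict_apply hE,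
      h1 μ₀ B hμ₀E, h1 μ _ hμE]
  have hσf : σ E ≠ ∞ := by rw [hσE]; exact ENNReal.add_ne_top.2 ⟨measure_ne_top _ _, measure_ne_top _ _⟩
  have hmass : 17 / 10 ≤ (σ E).toReal := by
    rw [hσE, ENNReal.toReal_add (measure_ne_top _ _) (measure_ne_top _ _)]
    have h1 : μ.real B'ᶜ = 1 - μ.real B' := probReal_compl_eq_one_sub measurableSet_ball
    change _ ≤ μ₀.real B + μ.real B'ᶜ
    rw [h1]
    linarith
  have hen := sq_mul_setEnergy_le (α := α) σ hσf
  have hup : rieszEnergy α σ ≤ ENNReal.ofReal (11 / 4 * I) := by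
    rw [hσ, rieszEnergy_add]
    have m1 := lintegral_restrict_kernel_le hα.le (μ := μ₀) (ν := μ) (by simp) (by simp)
      (measurableSet_ball (x := (0 : Space d)) (ε := (n : ℝ)))
      (measurableSet_ball (x := (0 : Space d)) (ε := (n : ℝ) + L)).compl hsep
    have m2 := lintegral_restrict_kernel_le hα.le (μ := μ) (ν := μ₀) (by simp) (by simp)
      (measurableSet_ball (x := (0 : Space d)) (ε := (n : ℝ) + L)).compl
      (measurableSet_ball (x := (0 : Space d)) (ε := (n : ℝ)))
      (fun y hy x hx => (hsep x hx y hy).trans_eq (dist_comm _ _))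
    have hLI : ENNReal.ofReal L ^ (-α) ≤ ENNReal.ofReal (I / 4) := by
      rw [ENNReal.ofReal_rpow_of_pos hL0]
      exact ENNReal.ofReal_le_ofReal hL.le
    calc _ ≤ ENNReal.ofReal (9 / 8 * I) + ENNReal.ofReal (9 / 8 * I)
          + (ENNReal.ofReal (I / 4) + ENNReal.ofReal (I / 4)) := by
          refine add_le_add (add_le_add ?_ ?_) (add_le_add (m1.trans hLI) (m2.trans hLI))
          · exact (rieszEnergy_mono Measure.restrict_le_self).trans hμ₀e.le
          · exact (rieszEnergy_mono Measure.restrict_le_self).trans hμe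
      _ = ENNReal.ofReal (11 / 4 * I) := by
          rw [← ENNReal.ofReal_add (by positivity) (by positivity),
            ← ENNReal.ofReal_add (by positivity) (by positivity),
            ← ENNReal.ofReal_add (by positivity) (by positivity)]
          congr 1; ring
  have h3 := ENNReal.toReal_mono ENNReal.ofReal_ne_top (hen.trans hup)
  rw [ENNReal.toReal_mul, ENNReal.toReal_pow, ENNReal.toReal_ofReal (by positivity), ← hI] at h3
  have h4 := le_of_mul_le_mul_right h3 hI0
  nlinarith

/-- A map which expands distances and strictly expands distances in balls. -/
def expansion (t : ℝ) (x : Space d) : Space d :=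
  x + t • ∑ i, Real.arctan (x i) • EuclideanSpace.single i (1 : ℝ)

theorem expansion_apply (t : ℝ) (x : Space d) (i : Fin d) :
    expansion t x i = x i + t * Real.arctan (x i) := by
  simp [expansion, Finset.sum_apply, Pi.single_apply]

theorem continuous_expansion (t : ℝ) : Continuous (expansion t : Space d → Space d) := by
  have h : ∀ i : Fin d, Continuous fun x : Space d => Real.arctan (x i) := fun i =>
    Real.continuous_arctan.comp (contDiff_coord i).continuous
  unfold expansion
  have h2 : ∀ i : Fin d, Continuous fun x : Space d =>
      Real.arctan (x i) • (EuclideanSpace.single i (1 : ℝ) : Space d) := fun i =>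
    (h i).smul continuous_const
  exact continuous_id.add ((continuous_finsetSum _ fun i _ => h2 i).const_smul t)

theorem dist_expansion_self_le {t : ℝ} (ht : 0 ≤ t) (x : Space d) :
    dist (expansion t x) x ≤ t * (2 * d) := by
  rw [dist_eq_norm, expansion, add_sub_cancel_left, norm_smul, Real.norm_of_nonneg ht]
  gcongr
  refine (norm_sum_le _ _).trans ?_
  calc ∑ i, ‖Real.arctan (x i) • (EuclideanSpace.single i (1 : ℝ) : Space d)‖
      ≤ ∑ _i : Fin d, (2 : ℝ) := by
        refine Finset.sum_le_sum fun i _ => ?_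
        rw [norm_smul, norm_single_one, mul_one, Real.norm_eq_abs]
        have h1 := Real.arctan_lt_pi_div_two (x i)
        have h2 := Real.neg_pi_div_two_lt_arctan (x i)
        have h3 := Real.pi_lt_four
        exact abs_le.2 ⟨by linarith, by linarith⟩
    _ = 2 * d := by simp [mul_comm]

theorem dist_le_of_coord_le {c : ℝ} (hc : 0 ≤ c) {x y x' y' : Space d}
    (h : ∀ i, c * |x i - y i| ≤ |x' i - y' i|) : c * dist x y ≤ dist x' y' := by
  rw [EuclideanSpace.dist_eq, EuclideanSpace.dist_eq]
  refine Real.le_sqrt_of_sq_le ?_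
  rw [mul_pow, Real.sq_sqrt (Finset.sum_nonneg fun i _ => sq_nonneg _), Finset.mul_sum]
  refine Finset.sum_le_sum fun i _ => ?_
  rw [← mul_pow, Real.dist_eq, Real.dist_eq]
  exact pow_le_pow_left₀ (by positivity) (h i) 2

theorem mul_abs_sub_le_of_le {t c a b : ℝ} (ht : 0 ≤ t)
    (h : a ≤ b → c * (b - a) ≤ Real.arctan b - Real.arctan a)
    (h' : b ≤ a → c * (a - b) ≤ Real.arctan a - Real.arctan b) :
    (1 + t * c) * |a - b| ≤ |a + t * Real.arctan a - (b + t * Real.arctan b)| := by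
  rcases le_total a b with hab | hab
  · rw [abs_sub_comm, abs_sub_comm (a + _), abs_of_nonneg (sub_nonneg.2 hab)]
    refine le_trans ?_ (le_abs_self _)
    nlinarith [mul_le_mul_of_nonneg_left (h hab) ht]
  · rw [abs_of_nonneg (sub_nonneg.2 hab)]
    refine le_trans ?_ (le_abs_self _)
    nlinarith [mul_le_mul_of_nonneg_left (h' hab) ht]

theorem dist_le_dist_expansion {t : ℝ} (ht : 0 ≤ t) (x y : Space d) :
    dist x y ≤ dist (expansion t x) (expansion t y) := by
  have h : (1 + t * 0) * dist x y ≤ dist (expansion t x) (expansion t y) := by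
    refine dist_le_of_coord_le (by simp) fun i => ?_
    rw [expansion_apply, expansion_apply]
    refine mul_abs_sub_le_of_le ht (fun hab => ?_) fun hab => ?_
    · linarith [Real.arctan_mono hab]
    · linarith [Real.arctan_mono hab]
  simpa using h

theorem mul_sub_le_arctan_sub {R a b : ℝ} (ha : |a| ≤ R) (hb : |b| ≤ R) (hab : a ≤ b) :
    1 / (1 + R ^ 2) * (b - a) ≤ Real.arctan b - Real.arctan a := by
  refine (convex_Icc (-R) R).mul_sub_le_image_sub_of_le_deriv Real.continuous_arctan.continuousOn
    Real.differentiable_arctan.differentiableOn (fun x hx => ?_) a (abs_le.1 ha) b (abs_le.1 hb) hab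
  rw [Real.deriv_arctan]
  have hx : |x| ≤ R := abs_le.2 (mem_Icc.1 (interior_subset hx))
  have : x ^ 2 ≤ R ^ 2 := sq_le_sq' (by linarith [abs_le.1 hx]) (abs_le.1 hx).2
  exact one_div_le_one_div_of_le (by positivity) (by linarith)

theorem mul_dist_le_dist_expansion {t R : ℝ} (ht : 0 ≤ t) {x y : Space d} (hx : x ∈ ball 0 R)
    (hy : y ∈ ball 0 R) :
    (1 + t * (1 / (1 + R ^ 2))) * dist x y ≤ dist (expansion t x) (expansion t y) := by
  refine dist_le_of_coord_le (by positivity) fun i => ?_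
  rw [expansion_apply, expansion_apply]
  have h1 : |x i| ≤ R := (abs_coord_le i x).trans (mem_ball_zero_iff.1 hx).le
  have h2 : |y i| ≤ R := (abs_coord_le i y).trans (mem_ball_zero_iff.1 hy).le
  exact mul_abs_sub_le_of_le ht (mul_sub_le_arctan_sub h1 h2) (mul_sub_le_arctan_sub h2 h1)

/-- A gain of `c` on every pair in `B × B` integrates to `c` times the squared mass of `B`. The gain
stands on the left so that nothing is subtracted in `ℝ≥0∞`. -/
theorem rieszEnergy_map_add_le {φ : Space d → Space d} (hφ : Measurable φ) (μ : Measure (Space d))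
    [SFinite μ] {B : Set (Space d)} (hB : MeasurableSet B) {c : ℝ≥0∞}
    (h1 : ∀ x y, edist (φ x) (φ y) ^ (-α) ≤ edist x y ^ (-α))
    (h2 : ∀ x ∈ B, ∀ y ∈ B, edist (φ x) (φ y) ^ (-α) + c ≤ edist x y ^ (-α)) :
    rieszEnergy α (μ.map φ) + c * μ B * μ B ≤ rieszEnergy α μ := by
  have e : c * μ B * μ B = ∫⁻ x, B.indicator (fun _ => c * μ B) x ∂μ := by
    rw [lintegral_indicator hB, setLIntegral_const]
  rw [rieszEnergy_map hφ, e, ← lintegral_add_right _ (measurable_const.indicator hB), rieszEnergy]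
  refine lintegral_mono fun x => ?_
  by_cases hx : x ∈ B
  · have e2 : c * μ B = ∫⁻ y, B.indicator (fun _ => c) y ∂μ := by
      rw [lintegral_indicator hB, setLIntegral_const]
    rw [indicator_of_mem hx, e2, ← lintegral_add_right _ (measurable_const.indicator hB)]
    refine lintegral_mono fun y => ?_
    by_cases hy : y ∈ B
    · simpa [hy] using h2 x hx y hy
    · simpa [hy] using h1 x y
  · rw [indicator_of_notMem hx, add_zero]
    exact lintegral_mono fun y => h1 x y

/-- The neighbourhoods of a set of positive Riesz energy have strictly smaller energy. -/
theorem exists_rieszEnergy_lt_thickening (hα : 0 < α) {E : Set (Space d)} (hE : MeasurableSet E)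
    (h0 : setEnergy α E ≠ 0) (hf : setEnergy α E ≠ ∞) {ε : ℝ} (hε : 0 < ε) :
    ∃ μ : Measure (Space d), IsProbabilityMeasure μ ∧ μ (thickening ε E)ᶜ = 0 ∧
      rieszEnergy α μ < setEnergy α E := by
  obtain ⟨R, hR, hball⟩ := exists_ball_measure_ge hα hE h0 hf
  set I := (setEnergy α E).toReal with hI
  have hI0 : 0 < I := ENNReal.toReal_pos h0 hf
  have hIE : setEnergy α E = ENNReal.ofReal I := (ENNReal.ofReal_toReal hf).symm
  -- Makes the displacement bound `t * (2 * d)` smaller than `ε`.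
  set t : ℝ := ε / (2 * (2 * d + 1))
  have ht : 0 < t := by positivity
  set b : ℝ := 1 + t * (1 / (1 + R ^ 2))
  have hb : 1 < b := by
    have : 0 < t * (1 / (1 + R ^ 2)) := by positivity
    simp only [b]; linarith
  have hb0 : 0 < b := by linarith
  set κ : ℝ := b ^ (-α)
  have hκ0 : 0 < κ := by positivity
  have hκ1 : κ < 1 := Real.rpow_lt_one_of_one_lt_of_neg hb (by linarith)
  -- Points of the ball are at distance at most `2 * R`; stretching their distance by the factor `b`
  -- lowers the kernel by at least `g`.
  set g : ℝ := (1 - κ) * (2 * R) ^ (-α)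
  have hg : 0 < g := mul_pos (by linarith) (by positivity)
  -- `g / 16` is the gain on pairs from a quarter of the mass, and `I / 8` keeps `μ` within the
  -- factor `9 / 8` for which that quarter is guaranteed.
  have hmin : 0 < min (g / 16) (I / 8) := by positivity
  obtain ⟨μ, hμ, hμE, hμe⟩ := exists_rieszEnergy_lt (α := α)
    (v := ENNReal.ofReal (I + min (g / 16) (I / 8))) hE
    (by rw [hIE]; exact (ENNReal.ofReal_lt_ofReal_iff (by positivity)).2 (by linarith))
  have hquarter := hball μ hμ hμE (hμe.le.trans (ENNReal.ofReal_le_ofReal (by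
    have := min_le_right (g / 16) (I / 8)
    linarith)))
  set φ : Space d → Space d := expansion t
  have hφ : Measurable φ := (continuous_expansion t).measurable
  have hmap := rieszEnergy_map_add_le (α := α) hφ μ (measurableSet_ball (x := (0 : Space d)) (ε := R))
    (c := ENNReal.ofReal g)
    (fun x y => rpow_neg_anti hα.le (by
      rw [edist_dist, edist_dist]
      exact ENNReal.ofReal_le_ofReal (dist_le_dist_expansion ht.le x y)))
    (fun x hx y hy => by
      -- On the diagonal the original kernel is infinite, so the inequality is free.
      by_cases hxy : x = y
      · have : -α < 0 := by linarith
        have h1 : edist x y ^ (-α) = ∞ := by rw [hxy, edist_self, ENNReal.zero_rpow_of_neg this]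
        exact le_top.trans_eq h1.symm
      have hD : 0 < dist x y := dist_pos.2 hxy
      have h1 := mul_dist_le_dist_expansion ht.le hx hy
      have hbD : 0 < b * dist x y := by positivity
      rw [edist_dist, edist_dist, ENNReal.ofReal_rpow_of_pos (hbD.trans_le h1),
        ENNReal.ofReal_rpow_of_pos hD, ← ENNReal.ofReal_add (by positivity) hg.le]
      refine ENNReal.ofReal_le_ofReal ?_
      have h2 : dist (φ x) (φ y) ^ (-α) ≤ κ * dist x y ^ (-α) := by
        rw [← Real.mul_rpow hb0.le hD.le]
        exact Real.rpow_le_rpow_of_nonpos hbD h1 (by linarith)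
      have h3 : (2 * R) ^ (-α) ≤ dist x y ^ (-α) := by
        refine Real.rpow_le_rpow_of_nonpos hD ?_ (by linarith)
        have := dist_triangle_right x y 0
        have hx' := mem_ball.1 hx
        have hy' := mem_ball.1 hy
        linarith
      have h4 : g ≤ (1 - κ) * dist x y ^ (-α) := by
        simp only [g]
        exact mul_le_mul_of_nonneg_left h3 (by linarith)
      linarith)
  refine ⟨μ.map φ, Measure.isProbabilityMeasure_map hφ.aemeasurable, ?_, ?_⟩
  · rw [Measure.map_apply hφ isOpen_thickening.measurableSet.compl]
    refine measure_mono_null (fun x hx => ?_) hμE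
    intro hxE
    refine hx (mem_thickening_iff.2 ⟨x, hxE, ?_⟩)
    refine (dist_expansion_self_le ht.le x).trans_lt ?_
    simp only [t]
    rw [div_mul_eq_mul_div, div_lt_iff₀ (by positivity)]
    have hd0 : (0 : ℝ) ≤ d := Nat.cast_nonneg d
    nlinarith
  · have hμB : ENNReal.ofReal (1 / 4) ≤ μ (ball 0 R) := by
      rw [← ofReal_measureReal]
      exact ENNReal.ofReal_le_ofReal hquarter
    have h5 : ENNReal.ofReal (g / 16) ≤ ENNReal.ofReal g * μ (ball 0 R) * μ (ball 0 R) := by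
      calc ENNReal.ofReal (g / 16)
          = ENNReal.ofReal g * ENNReal.ofReal (1 / 4) * ENNReal.ofReal (1 / 4) := by
            rw [← ENNReal.ofReal_mul hg.le, ← ENNReal.ofReal_mul (by positivity)]
            congr 1; ring
        _ ≤ _ := by gcongr
    have h6 : rieszEnergy α (μ.map φ) + ENNReal.ofReal (g / 16)
        < setEnergy α E + ENNReal.ofReal (g / 16) := by
      refine ((add_le_add le_rfl h5).trans hmap).trans_lt (hμe.trans_le ?_)
      rw [hIE, ← ENNReal.ofReal_add hI0.le (by positivity)]
      exact ENNReal.ofReal_le_ofReal (by linarith [min_le_left (g / 16) (I / 8)])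
    exact lt_of_add_lt_add_right h6


/-! ### Charging many tiny balls -/

/-- Two distinct coordinates are independent, so their joint law is `μ.prod μ`. -/
theorem lintegral_pi_pair {X : Type*} [MeasurableSpace X] (μ : Measure X)
    [IsProbabilityMeasure μ] {N : ℕ} {i j : Fin N} (hij : i ≠ j) {g : X × X → ℝ≥0∞}
    (hg : Measurable g) :
    ∫⁻ x : Fin N → X, g (x i, x j) ∂(Measure.pi fun _ => μ) = ∫⁻ p, g p ∂(μ.prod μ) := by
  have hind := (ProbabilityTheory.iIndepFun_pi (ι := Fin N) (μ := fun _ => μ)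
    (X := fun _ => (id : X → X)) fun _ => aemeasurable_id).indepFun hij
  simp only [id] at hind
  have h1 := (ProbabilityTheory.indepFun_iff_map_prod_eq_prod_map_map
    (measurable_pi_apply i).aemeasurable (measurable_pi_apply j).aemeasurable).1 hind
  have hmap : ∀ k : Fin N, (Measure.pi fun _ : Fin N => μ).map (fun x => x k) = μ := fun k =>
    (measurePreserving_eval (fun _ : Fin N => μ) k).map_eq
  have h1' : (Measure.pi fun _ : Fin N => μ).map (fun x => (x i, x j)) = μ.prod μ := by
    rw [h1, hmap i, hmap j]
  rw [← h1', lintegral_map hg ((measurable_pi_apply i).prodMk (measurable_pi_apply j))]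

/-- A pair interaction is at most its mean for a suitable choice of `N` points. -/
theorem exists_points_sum_le {X : Type*} [MeasurableSpace X] (μ : Measure X)
    [IsProbabilityMeasure μ] {U : Set X} (hU : μ Uᶜ = 0) {g : X × X → ℝ≥0∞} (hg : Measurable g)
    (N : ℕ) : ∃ x : Fin N → X, (∀ i, x i ∈ U) ∧
      ∑ i, ∑ j, (if i = j then 0 else g (x i, x j)) ≤ (N : ℝ≥0∞) ^ 2 * ∫⁻ p, g p ∂(μ.prod μ) := by
  set P := Measure.pi fun _ : Fin N => μ
  set F : (Fin N → X) → ℝ≥0∞ := fun x => ∑ i, ∑ j, (if i = j then 0 else g (x i, x j))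
  have hterm : ∀ i j : Fin N, Measurable fun x : Fin N → X =>
      (if i = j then 0 else g (x i, x j)) := by
    intro i j
    by_cases hij : i = j
    · simp [hij]
    · simp only [hij, if_false]
      exact hg.comp ((measurable_pi_apply i).prodMk (measurable_pi_apply j))
  have hF : Measurable F := Finset.measurable_sum _ fun i _ => Finset.measurable_sum _ fun j _ =>
    hterm i j
  have hintg : ∫⁻ x, F x ∂P ≤ (N : ℝ≥0∞) ^ 2 * ∫⁻ p, g p ∂(μ.prod μ) := by
    simp only [F]
    rw [lintegral_finsetSum _ fun i _ => Finset.measurable_sum _ fun j _ => hterm i j]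
    calc ∑ i, ∫⁻ x, ∑ j, (if i = j then 0 else g (x i, x j)) ∂P
        ≤ ∑ _i : Fin N, ∑ _j : Fin N, ∫⁻ p, g p ∂(μ.prod μ) := by
          refine Finset.sum_le_sum fun i _ => ?_
          rw [lintegral_finsetSum _ fun j _ => hterm i j]
          refine Finset.sum_le_sum fun j _ => ?_
          by_cases hij : i = j
          · simp [hij]
          · simp only [hij, if_false]
            exact (lintegral_pi_pair μ hij hg).le
      _ = _ := by simp [sq, mul_assoc]
  -- First-moment method: a random choice is at or below the mean with positive probability, and the
  -- almost sure event that all points lie in `U` can be imposed at the same time.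
  have hpos := measure_le_lintegral_pos (μ := P) hF.aemeasurable
  have hae : ∀ᵐ x ∂P, ∀ i, x i ∈ U := by
    rw [ae_all_iff]
    intro i
    have hU' : ∀ᵐ y ∂μ, y ∈ U := hU
    exact (measurePreserving_eval (fun _ : Fin N => μ) i).quasiMeasurePreserving.ae hU'
  obtain ⟨x, hx1, hx2⟩ := ((frequently_ae_iff.2 hpos.ne').and_eventually hae).exists
  exact ⟨x, hx2, hx1.trans hintg⟩

/-- The uniform probability measure on the ball of radius `r` around `x`. -/
def ballMeasure (r : ℝ) (x : Space d) : Measure (Space d) :=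
  (volume (ball (0 : Space d) r))⁻¹ • volume.restrict (ball x r)

theorem ballMeasure_ball {r : ℝ} (hr : 0 < r) (x : Space d) : ballMeasure r x (ball x r) = 1 := by
  rw [ballMeasure, Measure.smul_apply, Measure.restrict_apply_self, smul_eq_mul,
    Measure.addHaar_ball_center volume x r]
  exact ENNReal.inv_mul_cancel (measure_ball_pos volume 0 hr).ne' measure_ball_lt_top.ne

theorem lintegral_ballMeasure_le {r : ℝ} (hr : 0 < r) (x : Space d) {f : Space d → ℝ≥0∞}
    {c : ℝ≥0∞} (h : ∀ y ∈ ball x r, f y ≤ c) : ∫⁻ y, f y ∂(ballMeasure r x) ≤ c := by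
  rw [ballMeasure, lintegral_smul_measure, smul_eq_mul]
  calc _ ≤ (volume (ball (0 : Space d) r))⁻¹ * ∫⁻ y in ball x r, c := by
        exact mul_le_mul' le_rfl (setLIntegral_mono' measurableSet_ball h)
    _ = c := by
        rw [setLIntegral_const, Measure.addHaar_ball_center volume x r, mul_comm c, ← mul_assoc,
          ENNReal.inv_mul_cancel (measure_ball_pos volume 0 hr).ne' measure_ball_lt_top.ne, one_mul]

/-- Split the charged ball at distance `r` from the evaluation point `z`. The far part accounts for
the `+ 1` in the constant, which also secures `1 ≤ J`, needed for one bound to dominate both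
branches of `ballKernel`. -/
theorem exists_ballMeasure_potential_le (hd : 1 ≤ d) (hα₀ : 0 ≤ α) (hα : α < d) :
    ∃ J : ℝ≥0∞, J ≠ ∞ ∧ 1 ≤ J ∧ ∀ (x z : Space d) (r : ℝ), 0 < r →
      ∫⁻ y, edist z y ^ (-α) ∂(ballMeasure r x) ≤ J * ENNReal.ofReal r ^ (-α) := by
  obtain ⟨J, hJ, hball⟩ := exists_lintegral_kernel_ball_le hd hα
  refine ⟨J + 1, by simpa using hJ, by simp, fun x z r hr => ?_⟩
  rw [ballMeasure, lintegral_smul_measure, smul_eq_mul]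
  set B := volume (ball (0 : Space d) r)
  have hB0 : B ≠ 0 := (measure_ball_pos volume 0 hr).ne'
  have hBf : B ≠ ∞ := measure_ball_lt_top.ne
  calc _ ≤ B⁻¹ * (J * ENNReal.ofReal r ^ (-α) * B + ENNReal.ofReal r ^ (-α) * B) := by
        gcongr
        refine (lintegral_kernel_le_add hα₀ z r measurableSet_ball).trans ?_
        rw [Measure.addHaar_ball_center volume x r]
        exact add_le_add (hball z r hr) le_rfl
    _ = (J + 1) * ENNReal.ofReal r ^ (-α) * (B⁻¹ * B) := by ring
    _ = _ := by rw [ENNReal.inv_mul_cancel hB0 hBf, mul_one]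

/-- A bound for the interaction of two uniformly charged balls of radius `r`. -/
def ballKernel (α : ℝ) (J : ℝ≥0∞) (r : ℝ) (p : Space d × Space d) : ℝ≥0∞ :=
  if 4 * r ≤ dist p.1 p.2 then ENNReal.ofReal (dist p.1 p.2 - 2 * r) ^ (-α)
  else J * ENNReal.ofReal 4 ^ α * edist p.1 p.2 ^ (-α)

theorem measurable_ballKernel (J : ℝ≥0∞) (r : ℝ) :
    Measurable (ballKernel α J r : Space d × Space d → ℝ≥0∞) := by
  have hd : Measurable fun p : Space d × Space d => dist p.1 p.2 := measurable_dist
  refine Measurable.ite (measurableSet_le measurable_const hd) ?_ ?_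
  · exact ((hd.sub_const _).ennreal_ofReal).pow_const _
  · exact (measurable_kernel α).const_mul _

/-- For distant balls, points are at least the distance of the centres minus `2 * r` apart. For
close balls, the potential of one of them is of order `r ^ (-α)`, and `r` is at least a quarter of
the distance of the centres. -/
theorem lintegral_ballMeasure_kernel_le (hα₀ : 0 ≤ α) {J : ℝ≥0∞}
    (hJ : ∀ (x z : Space d) (r : ℝ), 0 < r →
      ∫⁻ y, edist z y ^ (-α) ∂(ballMeasure r x) ≤ J * ENNReal.ofReal r ^ (-α))
    {r : ℝ} (hr : 0 < r) (x y : Space d) :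
    ∫⁻ u, ∫⁻ v, edist u v ^ (-α) ∂(ballMeasure r y) ∂(ballMeasure r x)
      ≤ ballKernel α J r (x, y) := by
  unfold ballKernel
  split_ifs with h
  · refine lintegral_ballMeasure_le hr x fun u hu => lintegral_ballMeasure_le hr y fun v hv => ?_
    refine rpow_neg_anti hα₀ ?_
    rw [edist_dist]
    refine ENNReal.ofReal_le_ofReal ?_
    have h1 := dist_triangle4 x u v y
    have h2 := mem_ball'.1 hu
    have h3 := mem_ball.1 hv
    simp only at h ⊢
    linarith
  · refine (lintegral_ballMeasure_le hr x fun u _ => hJ y u r hr).trans ?_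
    rw [mul_assoc]
    gcongr
    have h4 : edist x y ≤ ENNReal.ofReal 4 * ENNReal.ofReal r := by
      rw [edist_dist, ← ENNReal.ofReal_mul (by norm_num)]
      exact ENNReal.ofReal_le_ofReal (not_le.1 h).le
    have h5 := rpow_neg_anti hα₀ h4
    rw [ENNReal.mul_rpow_of_ne_top ENNReal.ofReal_ne_top ENNReal.ofReal_ne_top] at h5
    calc ENNReal.ofReal r ^ (-α)
        = ENNReal.ofReal 4 ^ α * (ENNReal.ofReal 4 ^ (-α) * ENNReal.ofReal r ^ (-α)) := by
          rw [← mul_assoc, ← ENNReal.rpow_add _ _ (by simp) (by simp), add_neg_cancel,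
            ENNReal.rpow_zero, one_mul]
      _ ≤ _ := by gcongr

/-- In the first branch `dist - 2 * r` is at least half of the distance. The bound does not involve
`r` and serves as the dominating function when `r` tends to 0. -/
theorem ballKernel_le (hα₀ : 0 ≤ α) {J : ℝ≥0∞} (hJ1 : 1 ≤ J) {r : ℝ} (p : Space d × Space d) :
    ballKernel α J r p ≤ J * ENNReal.ofReal 4 ^ α * edist p.1 p.2 ^ (-α) := by
  unfold ballKernel
  split_ifs with h
  · have h1 : edist p.1 p.2 ≤ ENNReal.ofReal 4 * ENNReal.ofReal (dist p.1 p.2 - 2 * r) := by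
      rw [edist_dist, ← ENNReal.ofReal_mul (by norm_num)]
      refine ENNReal.ofReal_le_ofReal ?_
      have := dist_nonneg (x := p.1) (y := p.2)
      linarith
    have h5 := rpow_neg_anti hα₀ h1
    rw [ENNReal.mul_rpow_of_ne_top ENNReal.ofReal_ne_top ENNReal.ofReal_ne_top] at h5
    calc ENNReal.ofReal (dist p.1 p.2 - 2 * r) ^ (-α)
        = 1 * ENNReal.ofReal 4 ^ α * (ENNReal.ofReal 4 ^ (-α) *
          ENNReal.ofReal (dist p.1 p.2 - 2 * r) ^ (-α)) := by
          rw [one_mul, ← mul_assoc, ← ENNReal.rpow_add _ _ (by simp) (by simp), add_neg_cancel,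
            ENNReal.rpow_zero, one_mul]
      _ ≤ _ := by gcongr
  · exact le_rfl

/-- Off the diagonal the first branch eventually applies. On the diagonal the second branch always
applies and is infinite, like the limit, since `J` is nonzero. -/
theorem tendsto_ballKernel (hα : 0 < α) {J : ℝ≥0∞} (hJ1 : 1 ≤ J) {r : ℕ → ℝ} (hr : ∀ n, 0 < r n)
    (hlim : Tendsto r atTop (𝓝 0)) (p : Space d × Space d) :
    Tendsto (fun n => ballKernel α J (r n) p) atTop (𝓝 (edist p.1 p.2 ^ (-α))) := by
  by_cases hp : p.1 = p.2
  · have h1 : edist p.1 p.2 ^ (-α) = ∞ := by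
      rw [hp, edist_self, ENNReal.zero_rpow_of_neg (by linarith)]
    refine tendsto_const_nhds.congr fun n => ?_
    unfold ballKernel
    have h2 : ¬ 4 * r n ≤ dist p.1 p.2 := by rw [hp, dist_self]; linarith [hr n]
    rw [if_neg h2, h1, ENNReal.mul_top]
    exact mul_ne_zero (by positivity) (ENNReal.rpow_pos (by simp) (by simp)).ne'
  · have hD : 0 < dist p.1 p.2 := dist_pos.2 hp
    have h3 : Tendsto (fun n => dist p.1 p.2 - 2 * r n) atTop (𝓝 (dist p.1 p.2 - 2 * 0)) :=
      (hlim.const_mul 2).const_sub _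
    rw [mul_zero, sub_zero] at h3
    have h4 : Tendsto (fun n => ENNReal.ofReal (dist p.1 p.2 - 2 * r n) ^ (-α)) atTop
        (𝓝 (edist p.1 p.2 ^ (-α))) := by
      rw [edist_dist]
      exact (ENNReal.continuous_rpow_const.tendsto _).comp (ENNReal.tendsto_ofReal h3)
    refine h4.congr' ?_
    filter_upwards [hlim.eventually (p := fun s => s < dist p.1 p.2 / 4)
      (Iio_mem_nhds (by positivity))] with n hn
    unfold ballKernel
    rw [if_pos (by linarith)]

theorem tendsto_lintegral_ballKernel (hα : 0 < α) {J : ℝ≥0∞} (hJ1 : 1 ≤ J) (hJ : J ≠ ∞)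
    {r : ℕ → ℝ} (hr : ∀ n, 0 < r n) (hlim : Tendsto r atTop (𝓝 0)) (μ : Measure (Space d))
    [SFinite μ] (hμ : rieszEnergy α μ ≠ ∞) :
    Tendsto (fun n => ∫⁻ p, ballKernel α J (r n) p ∂(μ.prod μ)) atTop (𝓝 (rieszEnergy α μ)) := by
  have e : rieszEnergy α μ = ∫⁻ p : Space d × Space d, edist p.1 p.2 ^ (-α) ∂(μ.prod μ) := by
    rw [lintegral_prod _ (measurable_kernel α).aemeasurable]; rfl
  rw [e]
  have h4 : J * ENNReal.ofReal 4 ^ α ≠ ∞ :=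
    ENNReal.mul_ne_top hJ (ENNReal.rpow_ne_top_of_nonneg hα.le ENNReal.ofReal_ne_top)
  refine tendsto_lintegral_of_dominated_convergence
    (fun p => J * ENNReal.ofReal 4 ^ α * edist p.1 p.2 ^ (-α))
    (fun n => measurable_ballKernel J (r n))
    (fun n => Eventually.of_forall fun p => ballKernel_le hα.le hJ1 p) ?_
    (Eventually.of_forall fun p => tendsto_ballKernel hα hJ1 hr hlim p)
  rw [lintegral_const_mul' _ _ h4, ← e]
  exact ENNReal.mul_ne_top h4 hμ

theorem rieszEnergy_sum_smul {N : ℕ} (c : ℝ≥0∞) (hc : c ≠ ∞) (σ : Fin N → Measure (Space d))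
    [∀ i, SFinite (σ i)] :
    rieszEnergy α (c • ∑ i, σ i)
      = c ^ 2 * ∑ i, ∑ j, ∫⁻ x, ∫⁻ y, edist x y ^ (-α) ∂(σ j) ∂(σ i) := by
  rw [rieszEnergy_smul c hc, rieszEnergy]
  congr 1
  rw [lintegral_finsetSum_measure]
  refine Finset.sum_congr rfl fun i _ => ?_
  simp_rw [lintegral_finsetSum_measure]
  exact lintegral_finsetSum _ fun j _ => measurable_potential α (σ j)

instance (r : ℝ) (x : Space d) : SFinite (ballMeasure r x) := by
  unfold ballMeasure; infer_instance

/-- Put charge `1 / N` uniformly on each ball. The `N` diagonal terms, weighted by `N⁻²`, give the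
last summand; overlapping balls do no harm because the measures are simply added. -/
theorem setEnergy_iUnion_ball_le (hα₀ : 0 ≤ α) {J : ℝ≥0∞}
    (hJ : ∀ (x z : Space d) (r : ℝ), 0 < r →
      ∫⁻ y, edist z y ^ (-α) ∂(ballMeasure r x) ≤ J * ENNReal.ofReal r ^ (-α))
    {r : ℝ} (hr : 0 < r) {N : ℕ} (hN : N ≠ 0) (x : Fin N → Space d) :
    setEnergy α (⋃ i, ball (x i) r) ≤ ((N : ℝ≥0∞)⁻¹) ^ 2 *
      (∑ i, ∑ j, if i = j then 0 else ballKernel α J r (x i, x j))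
      + (N : ℝ≥0∞)⁻¹ * (J * ENNReal.ofReal r ^ (-α)) := by
  have hN0 : (N : ℝ≥0∞) ≠ 0 := by exact_mod_cast hN
  have hNf : (N : ℝ≥0∞) ≠ ∞ := ENNReal.natCast_ne_top N
  have hmass : ((N : ℝ≥0∞)⁻¹ • ∑ i, ballMeasure r (x i)) (⋃ i, ball (x i) r) = 1 := by
    have h1 : ∀ i, ballMeasure r (x i) (⋃ i, ball (x i) r) = 1 := by
      intro i
      have h2 := ballMeasure_ball hr (x i)
      refine le_antisymm ?_ (h2 ▸ measure_mono (subset_iUnion (fun i => ball (x i) r) i))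
      rw [← h2, ballMeasure, Measure.smul_apply, Measure.smul_apply, Measure.restrict_apply_self]
      refine mul_le_mul' le_rfl ?_
      exact (measure_mono (subset_univ _)).trans_eq (Measure.restrict_apply_univ _)
    rw [Measure.smul_apply, Measure.finsetSum_apply, Finset.sum_congr rfl fun i _ => h1 i]
    simp [ENNReal.inv_mul_cancel hN0 hNf]
  refine (setEnergy_le hmass).trans ?_
  rw [rieszEnergy_sum_smul _ (ENNReal.inv_ne_top.2 hN0)]
  calc _ ≤ ((N : ℝ≥0∞)⁻¹) ^ 2 * ∑ i, ∑ j, ((if i = j then 0 else ballKernel α J r (x i, x j))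
          + if i = j then J * ENNReal.ofReal r ^ (-α) else 0) := by
        gcongr with i _ j _
        by_cases hij : i = j
        · subst hij
          simp only [if_true, zero_add]
          exact lintegral_ballMeasure_le hr _ fun u _ => hJ _ u r hr
        · simp only [hij, if_false, add_zero]
          exact lintegral_ballMeasure_kernel_le hα₀ hJ hr _ _
    _ = _ := by
        simp_rw [Finset.sum_add_distrib]
        rw [mul_add]
        congr 1
        simp only [Finset.sum_ite_eq, Finset.mem_univ, if_true, Finset.sum_const, Finset.card_univ,
          Fintype.card_fin, nsmul_eq_mul]
        rw [sq, mul_assoc, ← mul_assoc _ (N : ℝ≥0∞), ENNReal.inv_mul_cancel hN0 hNf, one_mul]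

/-- The energy of a charge distribution on `U` is nearly achieved on finitely many balls centred
in `U` of arbitrarily small total perimeter. -/
theorem exists_balls_setEnergy_lt (hα : 0 < α) (hαd : α < (d : ℝ) - 1) {μ : Measure (Space d)}
    [IsProbabilityMeasure μ] {U : Set (Space d)} (hU : μ Uᶜ = 0) {v : ℝ≥0∞}
    (hv : rieszEnergy α μ < v) {δ : ℝ} (hδ : 0 < δ) :
    ∃ (N : ℕ) (x : Fin N → Space d) (r : ℝ), 0 < r ∧ r < δ ∧ N * r ^ (d - 1) < δ ∧
      (∀ i, x i ∈ U) ∧ setEnergy α (⋃ i, ball (x i) r) < v := by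
  have hd1 : (1 : ℝ) < d := by linarith
  have hd : 1 ≤ d := by exact_mod_cast hd1.le
  obtain ⟨J, hJf, hJ1, hJ⟩ := exists_ballMeasure_potential_le (α := α) hd hα.le (by linarith)
  -- The exponent separating the two scales: with about `r ^ (-p)` balls, the total perimeter is of
  -- order `r ^ (d - 1 - p)` and the total self-energy of order `r ^ (p - α)`, both tending to 0.
  obtain ⟨p, hp1, hp2⟩ := exists_between hαd
  set r : ℕ → ℝ := fun n => 1 / ((n : ℝ) + 1)
  have hr : ∀ n, 0 < r n := fun n => by positivity
  have hlim : Tendsto r atTop (𝓝 0) := tendsto_one_div_add_atTop_nhds_zero_nat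
  set N : ℕ → ℕ := fun n => ⌈r n ^ (-p)⌉₊
  have hN0 : ∀ n, N n ≠ 0 := fun n => by
    have : 0 < r n ^ (-p) := Real.rpow_pos_of_pos (hr n) _
    exact (Nat.ceil_pos.2 this).ne'
  have hrpow : ∀ q : ℝ, 0 < q → Tendsto (fun n => r n ^ q) atTop (𝓝 0) := fun q hq => by
    have h1 := (Real.continuousAt_rpow_const 0 q (Or.inr hq.le)).tendsto.comp hlim
    rw [Real.zero_rpow hq.ne'] at h1
    exact h1
  have hd1' : ((d - 1 : ℕ) : ℝ) = (d : ℝ) - 1 := by rw [Nat.cast_sub hd, Nat.cast_one]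
  have hper : Tendsto (fun n => (N n : ℝ) * r n ^ (d - 1)) atTop (𝓝 0) := by
    have h1 : Tendsto (fun n => r n ^ ((d : ℝ) - 1 - p) + r n ^ ((d : ℝ) - 1)) atTop (𝓝 (0 + 0)) :=
      (hrpow _ (by linarith)).add (hrpow _ (by linarith))
    rw [add_zero] at h1
    refine squeeze_zero (fun n => by have := hr n; positivity) (fun n => ?_) h1
    have h2 : (N n : ℝ) ≤ r n ^ (-p) + 1 := (Nat.ceil_lt_add_one (by have := hr n; positivity)).le
    have h3 : r n ^ (d - 1) = r n ^ ((d : ℝ) - 1) := by rw [← hd1', Real.rpow_natCast]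
    rw [h3]
    have h4 : 0 < r n ^ ((d : ℝ) - 1) := Real.rpow_pos_of_pos (hr n) _
    calc (N n : ℝ) * r n ^ ((d : ℝ) - 1) ≤ (r n ^ (-p) + 1) * r n ^ ((d : ℝ) - 1) := by gcongr
      _ = r n ^ ((d : ℝ) - 1 - p) + r n ^ ((d : ℝ) - 1) := by
        rw [add_mul, one_mul, ← Real.rpow_add (hr n)]
        ring_nf
  have hself : Tendsto (fun n => (N n : ℝ≥0∞)⁻¹ * (J * ENNReal.ofReal (r n) ^ (-α))) atTop
      (𝓝 0) := by
    have h1 : Tendsto (fun n => J * ENNReal.ofReal (r n ^ (p - α))) atTop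
        (𝓝 (J * ENNReal.ofReal 0)) :=
      ENNReal.Tendsto.const_mul (ENNReal.tendsto_ofReal (hrpow _ (by linarith))) (Or.inr hJf)
    rw [ENNReal.ofReal_zero, mul_zero] at h1
    refine tendsto_of_tendsto_of_tendsto_of_le_of_le tendsto_const_nhds h1 (fun n => zero_le)
      fun n => ?_
    simp only
    have h2 : ENNReal.ofReal (r n ^ (-p)) ≤ N n := by
      rw [← ENNReal.ofReal_natCast]
      exact ENNReal.ofReal_le_ofReal (Nat.le_ceil _)
    have h3 : (N n : ℝ≥0∞)⁻¹ ≤ ENNReal.ofReal (r n ^ p) := by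
      refine (ENNReal.inv_le_inv.2 h2).trans (le_of_eq ?_)
      rw [← ENNReal.ofReal_inv_of_pos (Real.rpow_pos_of_pos (hr n) _), ← Real.rpow_neg (hr n).le,
        neg_neg]
    calc (N n : ℝ≥0∞)⁻¹ * (J * ENNReal.ofReal (r n) ^ (-α))
        ≤ ENNReal.ofReal (r n ^ p) * (J * ENNReal.ofReal (r n) ^ (-α)) := by gcongr
      _ = J * ENNReal.ofReal (r n ^ (p - α)) := by
        rw [ENNReal.ofReal_rpow_of_pos (hr n), mul_left_comm,
          ← ENNReal.ofReal_mul (Real.rpow_nonneg (hr n).le _), ← Real.rpow_add (hr n),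
          sub_eq_add_neg]
  have htot := (tendsto_lintegral_ballKernel hα hJ1 hJf hr hlim μ hv.ne_top).add hself
  rw [add_zero] at htot
  obtain ⟨n, hn1, hn2, hn3⟩ := ((htot.eventually (p := fun s => s < v) (Iio_mem_nhds hv)).and
    ((hper.eventually (p := fun s => s < δ) (Iio_mem_nhds hδ)).and
      (hlim.eventually (p := fun s => s < δ) (Iio_mem_nhds hδ)))).exists
  obtain ⟨x, hxU, hx⟩ := exists_points_sum_le μ hU (measurable_ballKernel (α := α) J (r n)) (N n)
  refine ⟨N n, x, r n, hr n, hn3, hn2, hxU, ?_⟩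
  refine ((setEnergy_iUnion_ball_le hα.le hJ (hr n) (hN0 n) x).trans
    (add_le_add ?_ le_rfl)).trans_lt hn1
  have hN0' : (N n : ℝ≥0∞) ≠ 0 := by exact_mod_cast hN0 n
  have hNf : (N n : ℝ≥0∞) ≠ ∞ := ENNReal.natCast_ne_top _
  calc _ ≤ ((N n : ℝ≥0∞)⁻¹) ^ 2 *
        ((N n : ℝ≥0∞) ^ 2 * ∫⁻ p, ballKernel α J (r n) p ∂(μ.prod μ)) := by gcongr
    _ = _ := by rw [← mul_assoc, ← mul_pow, ENNReal.inv_mul_cancel hN0' hNf, one_pow, one_mul]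


/-! ### Competitors -/

/-- A small shear restores the volume, multiplying the perimeter by at most `1 + |t|` and the Riesz
energy by at most `(1 - |t|) ^ (-α)`. Having a homeomorphism keeps open sets open and compact sets
compact. -/
theorem exists_homeomorph_volume_eq (hd : 1 ≤ d) (hα : 0 ≤ α) (Q : ℝ) {E : Set (Space d)}
    (hE : MeasurableSet E) (hEf : volume E ≠ ∞) (hE0 : volume E ≠ 0) {ε : ℝ} (hε : 0 < ε) :
    ∃ δ : ℝ, 0 < δ ∧ ∀ A : Set (Space d), MeasurableSet A →
      volume (symmDiff A E) ≤ ENNReal.ofReal δ → ∃ φ : Space d ≃ₜ Space d,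
        (∀ x, dist (φ x) x ≤ ε) ∧ volume (φ '' A) = volume E ∧
        volume (symmDiff E (φ '' A)) ≤ ENNReal.ofReal ε ∧
        energy α Q (φ '' A) ≤ ENNReal.ofReal (1 + ε) * energy α Q A := by
  set i : Fin d := ⟨0, hd⟩
  obtain ⟨C, hC, hcorr⟩ := exists_shear_volume_eq i hE hEf hE0
  obtain ⟨t₀, ht₀, ht₁, hL1⟩ := exists_volume_symmDiff_shear_le i hE hEf
    (ε := ENNReal.ofReal (ε / 2)) (by simpa using hε)
  obtain ⟨τ, hτ, hpow⟩ : ∃ τ : ℝ, 0 < τ ∧ ∀ t, |t| < τ → (1 - |t|) ^ (-α) ≤ 1 + ε := by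
    have hc : ContinuousAt (fun t : ℝ => (1 - |t|) ^ (-α)) 0 :=
      (continuousAt_const.sub continuous_abs.continuousAt).rpow_const (by simp)
    have h1 := hc.eventually (p := fun y => y < 1 + ε) (Iio_mem_nhds (by simpa using hε))
    obtain ⟨τ, hτ, h2⟩ := Metric.eventually_nhds_iff.1 h1
    exact ⟨τ, hτ, fun t ht => (h2 (by simpa using ht)).le⟩
  set s : ℝ := min (min t₀ (τ / 2)) (min (ε / 2) (1 / 2))
  have hs : 0 < s := by positivity
  refine ⟨min (s / C) (ε / 4), by positivity, fun A hA hAE => ?_⟩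
  have hsdf : volume (symmDiff A E) ≠ ∞ := ne_top_of_le_ne_top ENNReal.ofReal_ne_top hAE
  have hAf : volume A ≠ ∞ := by
    refine ne_top_of_le_ne_top (ENNReal.add_ne_top.2 ⟨hsdf, hEf⟩)
      ((measure_mono fun x hx => ?_).trans (measure_union_le (symmDiff A E) E))
    by_cases hxE : x ∈ E
    exacts [Or.inr hxE, Or.inl (Or.inl ⟨hx, hxE⟩)]
  have hr : volume.real (symmDiff A E) ≤ min (s / C) (ε / 4) :=
    ENNReal.toReal_le_of_le_ofReal (by positivity) hAE
  have hCs : C * volume.real (symmDiff A E) ≤ s := by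
    have := hr.trans (min_le_left _ _)
    rw [le_div_iff₀ hC] at this
    linarith
  have s1 : s ≤ t₀ := (min_le_left _ _).trans (min_le_left _ _)
  have s2 : s ≤ τ / 2 := (min_le_left _ _).trans (min_le_right _ _)
  have s3 : s ≤ ε / 2 := (min_le_right _ _).trans (min_le_left _ _)
  have s4 : s ≤ 1 / 2 := (min_le_right _ _).trans (min_le_right _ _)
  obtain ⟨t, ht, hvol⟩ := hcorr A hA hAf (hCs.trans s4)
  have hts : |t| ≤ s := ht.trans hCs
  have ht1 : |t| < 1 := by linarith
  obtain ⟨φ, hφ⟩ := exists_homeomorph_shear i ht1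
  refine ⟨φ, fun x => ?_, ?_, ?_, ?_⟩
  · rw [hφ]; exact (dist_shear_self_le i t x).trans (by linarith)
  · rw [hφ]; exact hvol
  · rw [hφ]
    refine (volume_symmDiff_shear_image_le i ht1 hA hE).trans ?_
    calc _ ≤ ENNReal.ofReal (ε / 2) + 2 * ENNReal.ofReal (ε / 4) := by
          gcongr
          · exact hL1 t (hts.trans s1)
          · exact hAE.trans (ENNReal.ofReal_le_ofReal (min_le_right _ _))
      _ = ENNReal.ofReal ε := by
          rw [show (2 : ℝ≥0∞) = ENNReal.ofReal 2 by simp, ← ENNReal.ofReal_mul (by norm_num),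
            ← ENNReal.ofReal_add (by positivity) (by positivity)]
          congr 1; ring
  · rw [hφ]
    unfold energy
    rw [mul_add]
    refine add_le_add ?_ ?_
    · refine (perimeter_shear_image_le i ht1 hA).trans ?_
      gcongr
      linarith
    · rw [mul_left_comm]
      gcongr
      refine (setEnergy_shear_image_le hα i ht1 hA).trans ?_
      gcongr
      exact hpow t (by linarith)

theorem hausdorffEDist_image_le {φ : Space d → Space d} {ε : ℝ} (h : ∀ x, dist (φ x) x ≤ ε)
    (A : Set (Space d)) : hausdorffEDist A (φ '' A) ≤ ENNReal.ofReal ε := by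
  have h' : ∀ x, edist (φ x) x ≤ ENNReal.ofReal ε := fun x => by
    rw [edist_dist]; exact ENNReal.ofReal_le_ofReal (h x)
  refine hausdorffEDist_le_of_mem_edist (fun x hx => ⟨φ x, ⟨x, hx, rfl⟩, ?_⟩) ?_
  · rw [edist_comm]; exact h' x
  · rintro _ ⟨x, hx, rfl⟩
    exact ⟨x, hx, h' x⟩

/-- Approximate competitors, of nearly the right volume, yield competitors. -/
theorem exists_competitor (hd : 1 ≤ d) (hα : 0 ≤ α) (Q : ℝ) {𝒜 : Set (Set (Space d))}
    (hm : ∀ A ∈ 𝒜, MeasurableSet A) (h𝒜 : ∀ A ∈ 𝒜, ∀ φ : Space d ≃ₜ Space d, φ '' A ∈ 𝒜)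
    {E F : Set (Space d)} (hF : MeasurableSet F) (hFf : volume F ≠ ∞) (hF0 : volume F ≠ 0)
    {ε s : ℝ} (hε : 0 < ε) (hs : 0 < s)
    (h : ∀ δ : ℝ, 0 < δ → ∃ A ∈ 𝒜, volume (symmDiff A F) ≤ ENNReal.ofReal δ ∧
      hausdorffEDist E A ≤ ENNReal.ofReal ε ∧
        ENNReal.ofReal (1 + s) * energy α Q A < energy α Q E) :
    ∃ A ∈ 𝒜, volume A = volume F ∧ volume (symmDiff F A) ≤ ENNReal.ofReal ε ∧
      hausdorffEDist E A ≤ ENNReal.ofReal (2 * ε) ∧ energy α Q A < energy α Q E := by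
  -- The volume and the L¹ closeness refer to `F`, the Hausdorff closeness and the energy to `E`;
  -- the two sets differ only when the Riesz energy of `E` vanishes.
  obtain ⟨δ, hδ, hcorr⟩ := exists_homeomorph_volume_eq hd hα Q hF hFf hF0
    (ε := min ε s) (by positivity)
  obtain ⟨A, hA, hAF, hAE, hen⟩ := h δ hδ
  obtain ⟨φ, hφ1, hφ2, hφ3, hφ4⟩ := hcorr A (hm A hA) hAF
  refine ⟨φ '' A, h𝒜 A hA φ, hφ2, hφ3.trans (ENNReal.ofReal_le_ofReal (min_le_left _ _)), ?_, ?_⟩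
  · refine hausdorffEDist_triangle.trans ((add_le_add hAE
      (hausdorffEDist_image_le (fun x => (hφ1 x).trans (min_le_left _ _)) A)).trans (le_of_eq ?_))
    rw [← ENNReal.ofReal_add hε.le hε.le, two_mul]
  · refine lt_of_le_of_lt (hφ4.trans ?_) hen
    gcongr
    exact min_le_right _ _

/-- A strict inequality leaves room both for the factor `1 + s` of the volume correction and for an
additive error `η` from the pieces that are added. -/
theorem exists_one_add_mul_lt {a b : ℝ≥0∞} (h : a < b) : ∃ s : ℝ, 0 < s ∧ ∃ η : ℝ, 0 < η ∧
    ENNReal.ofReal (1 + s) * (a + ENNReal.ofReal η) < b := by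
  have ha : a ≠ ∞ := h.ne_top
  have h1 : Tendsto (fun s : ℝ => ENNReal.ofReal (1 + s) * (a + ENNReal.ofReal s)) (𝓝[>] 0)
      (𝓝 (ENNReal.ofReal (1 + 0) * (a + ENNReal.ofReal 0))) := by
    have t1 : Tendsto (fun s : ℝ => ENNReal.ofReal (1 + s)) (𝓝[>] 0) (𝓝 (ENNReal.ofReal (1 + 0))) :=
      (ENNReal.tendsto_ofReal (tendsto_id.const_add 1)).mono_left nhdsWithin_le_nhds
    have t2 : Tendsto (fun s : ℝ => a + ENNReal.ofReal s) (𝓝[>] 0) (𝓝 (a + ENNReal.ofReal 0)) :=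
      ((ENNReal.tendsto_ofReal tendsto_id).const_add a).mono_left nhdsWithin_le_nhds
    exact ENNReal.Tendsto.mul t1 (Or.inr (by simpa using ha)) t2 (Or.inr ENNReal.ofReal_ne_top)
  have h2 : ENNReal.ofReal (1 + 0) * (a + ENNReal.ofReal 0) < b := by simpa using h
  obtain ⟨s, hs, hs0⟩ := ((h1.eventually (p := fun y => y < b) (Iio_mem_nhds h2)).and
    self_mem_nhdsWithin).exists
  exact ⟨s, hs0, s, hs0, hs⟩

theorem volume_closedBall_le_mul (hd : 1 ≤ d) (x : Space d) {r : ℝ} (hr : 0 < r) :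
    volume (closedBall x r)
      = ENNReal.ofReal (r ^ (d - 1) * r) * volume (ball (0 : Space d) 1) := by
  rw [Measure.addHaar_closedBall _ _ hr.le, finrank_euclideanSpace_fin, ← pow_succ,
    Nat.sub_add_cancel hd]

/-- Small balls which carry a charge of energy less than `v`, have small perimeter and volume and
are close to `E`. -/
theorem exists_charged_balls (hα : 0 < α) (hαd : α < (d : ℝ) - 1) {μ : Measure (Space d)}
    [IsProbabilityMeasure μ] {E : Set (Space d)} {ε : ℝ} (hε : 0 < ε)
    (hU : μ (thickening ε E)ᶜ = 0) {v : ℝ≥0∞} (hv : rieszEnergy α μ < v) {δ : ℝ} (hδ : 0 < δ) :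
    ∃ (N : ℕ) (x : Fin N → Space d) (r : ℝ), 0 < r ∧
      (∀ A : Set (Space d), MeasurableSet A →
        perimeter (A ∪ ⋃ i, closedBall (x i) r) ≤ perimeter A + ENNReal.ofReal δ) ∧
      volume (⋃ i, closedBall (x i) r) ≤ ENNReal.ofReal δ ∧
      setEnergy α (⋃ i, ball (x i) r) < v ∧
      ∀ y ∈ ⋃ i, closedBall (x i) r, ∃ z ∈ E, dist y z ≤ 2 * ε := by
  have hd1 : (1 : ℝ) < d := by linarith
  have hd : 1 ≤ d := by exact_mod_cast hd1.le
  obtain ⟨C, hC, hper⟩ := exists_perimeter_union_closedBall_le hd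
  set ω : ℝ := volume.real (ball (0 : Space d) 1)
  have hω0 : 0 ≤ ω := measureReal_nonneg
  -- In order: closeness to `E`, radius at most 1, perimeter, volume.
  set δ' : ℝ := min (min ε 1) (min (δ / C) (δ / (ω + 1)))
  have hδ' : 0 < δ' := by positivity
  have b1 : δ' ≤ ε := (min_le_left _ _).trans (min_le_left _ _)
  have b2 : δ' ≤ 1 := (min_le_left _ _).trans (min_le_right _ _)
  have b3 : C * δ' ≤ δ := by
    have : δ' ≤ δ / C := (min_le_right _ _).trans (min_le_left _ _)
    rw [le_div_iff₀ hC] at this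
    linarith
  have b4 : δ' * ω ≤ δ := by
    have : δ' ≤ δ / (ω + 1) := (min_le_right _ _).trans (min_le_right _ _)
    rw [le_div_iff₀ (by positivity)] at this
    nlinarith
  obtain ⟨N, x, r, hr, hrδ, hN, hxU, hen⟩ := exists_balls_setEnergy_lt hα hαd hU hv hδ'
  refine ⟨N, x, r, hr, fun A hA => ?_, ?_, hen, ?_⟩
  · have h1 := perimeter_union_biUnion_closedBall_le hper Finset.univ hA x (fun _ => r) fun _ => hr
    simp only [Finset.mem_univ, iUnion_true, Finset.sum_const, Finset.card_univ, Fintype.card_fin,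
      nsmul_eq_mul] at h1
    refine h1.trans (add_le_add le_rfl ?_)
    rw [← ENNReal.ofReal_natCast, ← ENNReal.ofReal_mul (by positivity)]
    refine ENNReal.ofReal_le_ofReal ?_
    calc (N : ℝ) * (C * r ^ (d - 1)) = C * (N * r ^ (d - 1)) := by ring
      _ ≤ C * δ' := by gcongr
      _ ≤ δ := b3
  · refine (measure_iUnion_le _).trans ?_
    simp_rw [volume_closedBall_le_mul hd _ hr]
    rw [tsum_fintype, Finset.sum_const, Finset.card_univ, Fintype.card_fin, nsmul_eq_mul,
      ← ENNReal.ofReal_natCast, ← ofReal_measureReal (measure_ball_lt_top.ne),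
      ← ENNReal.ofReal_mul (by positivity), ← ENNReal.ofReal_mul (by positivity)]
    refine ENNReal.ofReal_le_ofReal ?_
    change (N : ℝ) * (r ^ (d - 1) * r * ω) ≤ δ
    calc (N : ℝ) * (r ^ (d - 1) * r * ω) = (N * r ^ (d - 1)) * r * ω := by ring
      _ ≤ δ' * 1 * ω := by gcongr; exact (hrδ.trans_le b2).le
      _ ≤ δ := by rw [mul_one]; exact b4
  · intro y hy
    obtain ⟨i, hi⟩ := mem_iUnion.1 hy
    obtain ⟨z, hz, hxz⟩ := mem_thickening_iff.1 (hxU i)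
    refine ⟨z, hz, ?_⟩
    have := mem_closedBall.1 hi
    linarith [dist_triangle y (x i) z]

theorem iUnion_ball_ae_eq (hd : 1 ≤ d) {ι : Type*} [Countable ι] (x : ι → Space d) (r : ι → ℝ) :
    (⋃ i, ball (x i) (r i)) =ᵐ[volume] (⋃ i, closedBall (x i) (r i) : Set (Space d)) :=
  Filter.EventuallyEq.countable_iUnion fun _ => ball_ae_eq_closedBall hd _ _

/-- An open set of small perimeter and volume which is close to `E` in the Hausdorff distance. -/
theorem exists_dust (hd : 2 ≤ d) {E : Set (Space d)} (hE : E.Nonempty) {ε δ : ℝ} (hε : 0 < ε)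
    (hδ : 0 < δ) : ∃ O : Set (Space d), IsOpen O ∧ O.Nonempty ∧
      (∀ A : Set (Space d), MeasurableSet A →
        perimeter (A ∪ O) ≤ perimeter A + ENNReal.ofReal δ) ∧
      volume O ≤ ENNReal.ofReal δ ∧ (∀ y ∈ O, ∃ z ∈ E, dist y z ≤ ε) ∧
      ∀ z ∈ E, ∃ y ∈ O, dist z y ≤ ε := by
  have hd1 : 1 ≤ d := by omega
  obtain ⟨C, hC, hper⟩ := exists_perimeter_union_iUnion_ball_le hd1
  set ω : ℝ := volume.real (ball (0 : Space d) 1)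
  have hω0 : 0 ≤ ω := measureReal_nonneg
  set η : ℝ := min (min ε 1) (min (δ / C) (δ / (ω + 1)))
  have hη : 0 < η := by positivity
  have b1 : η ≤ ε := (min_le_left _ _).trans (min_le_left _ _)
  have b2 : η ≤ 1 := (min_le_left _ _).trans (min_le_right _ _)
  have b3 : C * η ≤ δ := by
    have : η ≤ δ / C := (min_le_right _ _).trans (min_le_left _ _)
    rw [le_div_iff₀ hC] at this
    linarith
  have b4 : ω * η ≤ δ := by
    have : η ≤ δ / (ω + 1) := (min_le_right _ _).trans (min_le_right _ _)
    rw [le_div_iff₀ (by positivity)] at this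
    nlinarith
  -- The radii are summable and at most 1, so the sums of their powers `d - 1` and `d` are no
  -- larger; `2 ≤ d` makes the exponent `d - 1` nonzero.
  obtain ⟨ρ, hρ0, hρ⟩ := ENNReal.exists_pos_sum_of_countable (ε := ENNReal.ofReal η)
    (by simpa using hη) ℕ
  have hρη : ∀ i, (ρ i : ℝ) ≤ η := fun i => by
    have h1 : (ρ i : ℝ≥0∞) ≤ ENNReal.ofReal η := (ENNReal.le_tsum i).trans hρ.le
    rw [← ENNReal.ofReal_coe_nnreal] at h1
    exact (ENNReal.ofReal_le_ofReal_iff hη.le).1 h1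
  have hρ0' : ∀ i, (0 : ℝ) < ρ i := fun i => hρ0 i
  have hpow : ∀ (i : ℕ) (k : ℕ), k ≠ 0 → (ρ i : ℝ) ^ k ≤ ρ i := fun i k hk =>
    pow_le_of_le_one (hρ0' i).le ((hρη i).trans b2) hk
  have hsum : ∀ (c : ℝ), 0 ≤ c → c * η ≤ δ → ∀ k : ℕ, k ≠ 0 →
      ∑' i, ENNReal.ofReal (c * (ρ i : ℝ) ^ k) ≤ ENNReal.ofReal δ := by
    intro c hc hcη k hk
    calc ∑' i, ENNReal.ofReal (c * (ρ i : ℝ) ^ k) ≤ ∑' i, ENNReal.ofReal c * ρ i := by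
          refine ENNReal.tsum_le_tsum fun i => ?_
          rw [ENNReal.ofReal_mul hc]
          gcongr
          rw [← ENNReal.ofReal_coe_nnreal]
          exact ENNReal.ofReal_le_ofReal (hpow i k hk)
      _ ≤ ENNReal.ofReal c * ENNReal.ofReal η := by
          rw [ENNReal.tsum_mul_left]; gcongr
      _ ≤ ENNReal.ofReal δ := by
          rw [← ENNReal.ofReal_mul hc]; exact ENNReal.ofReal_le_ofReal hcη
  have : Nonempty E := hE.to_subtype
  -- Density of the centres in `E` puts every point of `E` near the dust, however small the balls
  -- are.
  obtain ⟨u, hu⟩ := TopologicalSpace.exists_dense_seq E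
  refine ⟨⋃ i, ball (u i : Space d) (ρ i), isOpen_iUnion fun i => isOpen_ball,
    ⟨u 0, mem_iUnion.2 ⟨0, mem_ball_self (hρ0' 0)⟩⟩, fun A hA => ?_, ?_, ?_, ?_⟩
  · exact (hper A hA _ _ hρ0').trans (add_le_add le_rfl (hsum C hC.le b3 (d - 1) (by omega)))
  · refine (measure_iUnion_le _).trans ?_
    refine le_trans (ENNReal.tsum_le_tsum fun i => ?_) (hsum ω hω0 b4 d (by omega))
    rw [Measure.addHaar_ball_of_pos _ _ (hρ0' i), finrank_euclideanSpace_fin,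
      ENNReal.ofReal_mul hω0, ofReal_measureReal (measure_ball_lt_top.ne), mul_comm]
  · intro y hy
    obtain ⟨i, hi⟩ := mem_iUnion.1 hy
    exact ⟨u i, (u i).2, (mem_ball.1 hi).le.trans ((hρη i).trans b1)⟩
  · intro z hz
    obtain ⟨i, hi⟩ := Metric.denseRange_iff.1 hu ⟨z, hz⟩ ε hε
    exact ⟨u i, mem_iUnion.2 ⟨i, mem_ball_self (hρ0' i)⟩, le_of_lt hi⟩

theorem hausdorffEDist_le_of_dist {A B : Set (Space d)} {ε : ℝ}
    (h1 : ∀ x ∈ A, ∃ y ∈ B, dist x y ≤ ε) (h2 : ∀ x ∈ B, ∃ y ∈ A, dist x y ≤ ε) :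
    hausdorffEDist A B ≤ ENNReal.ofReal ε := by
  refine hausdorffEDist_le_of_mem_edist (fun x hx => ?_) fun x hx => ?_
  · obtain ⟨y, hy, h⟩ := h1 x hx
    exact ⟨y, hy, by rw [edist_dist]; exact ENNReal.ofReal_le_ofReal h⟩
  · obtain ⟨y, hy, h⟩ := h2 x hx
    exact ⟨y, hy, by rw [edist_dist]; exact ENNReal.ofReal_le_ofReal h⟩

theorem volume_symmDiff_union_le (E W : Set (Space d)) :
    volume (symmDiff (E ∪ W) E) ≤ volume W := by
  refine measure_mono ?_
  rintro x (⟨hx | hx, hx'⟩ | ⟨hx, hx'⟩)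
  exacts [absurd hx hx', hx, absurd (Or.inl hx) hx']

/-- Competitors for sets of finite perimeter and positive Riesz energy. -/
theorem exists_competitor_of_setEnergy_pos (hα : 0 < α) (hαd : α < (d : ℝ) - 1) {Q : ℝ}
    (hQ : 0 < Q) {𝒜 : Set (Set (Space d))}
    (hm : ∀ A ∈ 𝒜, MeasurableSet A) (h𝒜 : ∀ A ∈ 𝒜, ∀ φ : Space d ≃ₜ Space d, φ '' A ∈ 𝒜)
    (hball : ∀ A ∈ 𝒜, ∀ (N : ℕ) (x : Fin N → Space d) (r : ℝ), 0 < r → ∃ W : Set (Space d),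
      ⋃ i, ball (x i) r ⊆ W ∧ W ⊆ ⋃ i, closedBall (x i) r ∧ A ∪ W ∈ 𝒜)
    {E : Set (Space d)} (hE : E ∈ 𝒜) (hEf : volume E ≠ ∞) (hE0 : volume E ≠ 0)
    (hP : perimeter E ≠ ∞) (hI : setEnergy α E ≠ 0) {ε : ℝ} (hε : 0 < ε) :
    ∃ A ∈ 𝒜, volume A = volume E ∧ volume (symmDiff E A) ≤ ENNReal.ofReal ε ∧
      hausdorffEDist E A ≤ ENNReal.ofReal (2 * ε) ∧ energy α Q A < energy α Q E := by
  have hd1 : (1 : ℝ) < d := by linarith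
  have hd : 1 ≤ d := by exact_mod_cast hd1.le
  have hEm := hm E hE
  have hIf := setEnergy_ne_top hd hα.le (by linarith) hEm hE0 hEf
  have hQ0 : ENNReal.ofReal (Q ^ 2) ≠ 0 := by
    rw [Ne, ENNReal.ofReal_eq_zero, not_le]; positivity
  obtain ⟨μ, hμ, hμE, hμe⟩ := exists_rieszEnergy_lt_thickening hα hEm hI hIf (half_pos hε)
  obtain ⟨v, hv1, hv2⟩ := exists_between hμe
  have hlt : perimeter E + ENNReal.ofReal (Q ^ 2) * v < energy α Q E := by
    unfold energy
    exact ENNReal.add_lt_add_left hP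
      ((ENNReal.mul_lt_mul_iff_right hQ0 ENNReal.ofReal_ne_top).2 hv2)
  -- The margins are fixed before `δ`, so the volume error can still be taken as small as the
  -- correction requires.
  obtain ⟨s, hs, η, hη, hsη⟩ := exists_one_add_mul_lt hlt
  refine exists_competitor hd hα.le Q hm h𝒜 hEm hEf hE0 hε hs fun δ hδ => ?_
  obtain ⟨N, x, r, hr, hper, hvol, hen, hnear⟩ := exists_charged_balls hα hαd (half_pos hε) hμE hv1
    (δ := min δ η) (by positivity)
  obtain ⟨W, hW1, hW2, hWA⟩ := hball E hE N x r hr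
  -- The class may require open or closed balls; `W` lies between the two unions, which agree up to
  -- null spheres.
  have hWae : W =ᵐ[volume] (⋃ i, closedBall (x i) r : Set (Space d)) := by
    have h1 := iUnion_ball_ae_eq hd x fun _ => r
    refine (LE.le.eventuallyLE hW2).antisymm ?_
    exact h1.symm.le.trans (LE.le.eventuallyLE hW1)
  refine ⟨E ∪ W, hWA, ?_, ?_, ?_⟩
  · exact ((volume_symmDiff_union_le E W).trans (measure_mono hW2)).trans
      (hvol.trans (ENNReal.ofReal_le_ofReal (min_le_left _ _)))
  · refine hausdorffEDist_le_of_dist (fun y hy => ⟨y, Or.inl hy, by simp [hε.le]⟩) ?_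
    rintro y (hy | hy)
    · exact ⟨y, hy, by simp [hε.le]⟩
    · obtain ⟨z, hz, h⟩ := hnear y (hW2 hy)
      exact ⟨z, hz, by linarith⟩
  · refine lt_of_le_of_lt ?_ hsη
    gcongr
    unfold energy
    have h1 : perimeter (E ∪ W) ≤ perimeter E + ENNReal.ofReal η := by
      rw [perimeter_congr_ae ((ae_eq_refl E).union hWae)]
      exact (hper E hEm).trans (add_le_add le_rfl (ENNReal.ofReal_le_ofReal (min_le_right _ _)))
    have h2 : setEnergy α (E ∪ W) ≤ v :=
      (setEnergy_anti (MeasurableSet.iUnion fun i => measurableSet_ball)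
        (hW1.trans subset_union_right)).trans hen.le
    calc _ ≤ perimeter E + ENNReal.ofReal η + ENNReal.ofReal (Q ^ 2) * v := by gcongr
      _ = _ := by ring

theorem energy_ne_top (hd : 1 ≤ d) (hα₀ : 0 ≤ α) (hα : α < d) (Q : ℝ) {A : Set (Space d)}
    (hA : MeasurableSet A) (hA0 : volume A ≠ 0) (hAf : volume A ≠ ∞) (hP : perimeter A ≠ ∞) :
    energy α Q A ≠ ∞ :=
  ENNReal.add_ne_top.2 ⟨hP, ENNReal.mul_ne_top ENNReal.ofReal_ne_top
    (setEnergy_ne_top hd hα₀ hα hA hA0 hAf)⟩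

theorem perimeter_biUnion_closedBall_ne_top (hd : 1 ≤ d) {t : Set (Space d)} (ht : t.Finite)
    {r : ℝ} (hr : 0 < r) : perimeter (⋃ x ∈ t, closedBall x r) ≠ ∞ := by
  obtain ⟨C, hC, hper⟩ := exists_perimeter_union_closedBall_le hd
  have h := perimeter_union_biUnion_closedBall_le hper ht.toFinset MeasurableSet.empty
    (fun x => x) (fun _ => r) fun _ => hr
  simp only [empty_union, perimeter_empty, zero_add, Finite.mem_toFinset] at h
  exact ne_top_of_le_ne_top (ENNReal.sum_ne_top.2 fun i _ => ENNReal.ofReal_ne_top) h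

/-- Competitors for compact sets of infinite perimeter. -/
theorem exists_compact_competitor_of_perimeter_eq_top (hd : 1 ≤ d) (hα₀ : 0 ≤ α) (hα : α < d)
    (Q : ℝ) {E : Set (Space d)} (hE : IsCompact E) (hE0 : volume E ≠ 0)
    (hP : perimeter E = ∞) {ε : ℝ} (hε : 0 < ε) :
    ∃ A ∈ {A : Set (Space d) | IsCompact A}, volume A = volume E ∧
      volume (symmDiff E A) ≤ ENNReal.ofReal ε ∧
      hausdorffEDist E A ≤ ENNReal.ofReal (2 * ε) ∧ energy α Q A < energy α Q E := by
  have htop : energy α Q E = ∞ := by simp [energy, hP]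
  have hEf : volume E ≠ ∞ := hE.measure_lt_top.ne
  -- Any finite energy beats the infinite one, so the factor `1 + s` is immaterial and `s = 1` is
  -- taken.
  refine exists_competitor hd hα₀ Q (fun A hA => IsCompact.measurableSet hA)
    (fun A hA φ => IsCompact.image (show IsCompact A from hA) φ.continuous) hE.measurableSet hEf hE0 hε one_pos fun δ hδ => ?_
  obtain ⟨U, hEU, hU, hUv⟩ := E.exists_isOpen_lt_add (μ := volume) hEf
    (ε := ENNReal.ofReal δ) (by simpa using hδ)
  obtain ⟨η, hη, hηU⟩ := hE.exists_cthickening_subset_open (hU.inter isOpen_thickening)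
    (subset_inter hEU (self_subset_thickening hε E))
  obtain ⟨t, htE, ht, hcov⟩ := hE.finite_cover_balls hη
  set A : Set (Space d) := ⋃ x ∈ t, closedBall x η
  have hEA : E ⊆ A := hcov.trans (iUnion₂_mono fun x _ => ball_subset_closedBall)
  have hAU : A ⊆ U ∩ thickening ε E :=
    (iUnion₂_subset fun x hx => closedBall_subset_cthickening (htE hx) η).trans hηU
  have hA : IsCompact A := ht.isCompact_biUnion fun x _ => isCompact_closedBall _ _
  refine ⟨A, hA, ?_, ?_, ?_⟩
  · have h1 : symmDiff A E ⊆ U \ E := by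
      rintro x (⟨hx, hx'⟩ | ⟨hx, hx'⟩)
      exacts [⟨(hAU hx).1, hx'⟩, absurd (hEA hx) hx']
    refine (measure_mono h1).trans ?_
    rw [measure_sdiff hEU hE.measurableSet.nullMeasurableSet hEf, tsub_le_iff_left]
    exact hUv.le
  · refine hausdorffEDist_le_of_dist (fun y hy => ⟨y, hEA hy, by simp [hε.le]⟩) fun y hy => ?_
    obtain ⟨z, hz, h⟩ := mem_thickening_iff.1 (hAU hy).2
    exact ⟨z, hz, h.le⟩
  · rw [htop]
    refine (ENNReal.mul_ne_top ENNReal.ofReal_ne_top (energy_ne_top hd hα₀ hα Q hA.measurableSet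
      (fun h0 => hE0 (measure_mono_null hEA h0)) hA.measure_lt_top.ne
      (perimeter_biUnion_closedBall_ne_top hd ht hη))).lt_top

/-- Competitors for open sets of infinite perimeter. -/
theorem exists_open_competitor_of_perimeter_eq_top (hd : 2 ≤ d) (hα₀ : 0 ≤ α) (hα : α < d)
    (Q : ℝ) {E : Set (Space d)} (hE : IsOpen E) (hE0 : volume E ≠ 0) (hEf : volume E ≠ ∞)
    (hP : perimeter E = ∞) {ε : ℝ} (hε : 0 < ε) :
    ∃ A ∈ {A : Set (Space d) | IsOpen A}, volume A = volume E ∧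
      volume (symmDiff E A) ≤ ENNReal.ofReal ε ∧
      hausdorffEDist E A ≤ ENNReal.ofReal (2 * ε) ∧ energy α Q A < energy α Q E := by
  have hd1 : 1 ≤ d := by omega
  have htop : energy α Q E = ∞ := by simp [energy, hP]
  refine exists_competitor hd1 hα₀ Q (fun A hA => IsOpen.measurableSet hA)
    (fun A hA φ => φ.isOpenMap A hA) hE.measurableSet hEf hE0 hε one_pos fun δ hδ => ?_
  obtain ⟨K, hKE, hK, hKv⟩ := hE.measurableSet.exists_isCompact_lt_add hEf
    (ε := ENNReal.ofReal (δ / 2)) (by simpa using hδ)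
  obtain ⟨η, hη, hηE⟩ := hK.exists_cthickening_subset_open hE hKE
  obtain ⟨t, htK, ht, hcov⟩ := hK.finite_cover_balls hη
  set G : Set (Space d) := ⋃ x ∈ t, ball x η
  have hG : IsOpen G := isOpen_biUnion fun x _ => isOpen_ball
  have hGE : G ⊆ E := (iUnion₂_subset fun x hx =>
    ball_subset_closedBall.trans (closedBall_subset_cthickening (htK hx) η)).trans hηE
  have hPG : perimeter G ≠ ∞ := by
    have : G =ᵐ[volume] (⋃ x ∈ t, closedBall x η : Set (Space d)) :=
      Filter.EventuallyEq.countable_bUnion ht.countable fun x _ => ball_ae_eq_closedBall hd1 x η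
    rw [perimeter_congr_ae this]
    exact perimeter_biUnion_closedBall_ne_top hd1 ht hη
  have hEne : E.Nonempty := nonempty_of_measure_ne_zero hE0
  -- The finite union `G` approximates `E` in volume but may miss thin or distant parts; the dust
  -- makes the union Hausdorff-close to `E`.
  obtain ⟨O, hO, hOne, hOper, hOvol, hO1, hO2⟩ := exists_dust hd hEne hε (half_pos hδ)
  refine ⟨G ∪ O, hG.union hO, ?_, ?_, ?_⟩
  · have h1 : symmDiff (G ∪ O) E ⊆ O ∪ E \ K := by
      rintro x (⟨hx | hx, hx'⟩ | ⟨hx, hx'⟩)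
      exacts [absurd (hGE hx) hx', Or.inl hx, Or.inr ⟨hx, fun h => hx' (Or.inl (hcov h))⟩]
    refine (measure_mono h1).trans ((measure_union_le _ _).trans ?_)
    rw [measure_sdiff hKE hK.measurableSet.nullMeasurableSet hK.measure_lt_top.ne]
    calc _ ≤ ENNReal.ofReal (δ / 2) + ENNReal.ofReal (δ / 2) := by
          gcongr
          rw [tsub_le_iff_left]
          exact hKv.le
      _ = ENNReal.ofReal δ := by
          rw [← ENNReal.ofReal_add (by positivity) (by positivity), add_halves]
  · refine hausdorffEDist_le_of_dist (fun z hz => ?_) ?_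
    · obtain ⟨y, hy, h⟩ := hO2 z hz
      exact ⟨y, Or.inr hy, h⟩
    · rintro y (hy | hy)
      exacts [⟨y, hGE hy, by simp [hε.le]⟩, hO1 y hy]
  · rw [htop]
    refine (ENNReal.mul_ne_top ENNReal.ofReal_ne_top (energy_ne_top hd1 hα₀ hα Q
      (hG.union hO).measurableSet ?_ ?_ ?_)).lt_top
    · exact ((hG.union hO).measure_pos volume (hOne.mono subset_union_right)).ne'
    · exact measure_union_ne_top (ne_top_of_le_ne_top hEf (measure_mono hGE))
        (ne_top_of_le_ne_top ENNReal.ofReal_ne_top hOvol)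
    · exact ne_top_of_le_ne_top (ENNReal.add_ne_top.2 ⟨hPG, ENNReal.ofReal_ne_top⟩)
        (hOper G hG.measurableSet)

/-- Competitors for unbounded open sets of vanishing Riesz energy. -/
theorem exists_open_competitor_of_setEnergy_eq_zero (hα : 0 < α) (hαd : α < (d : ℝ) - 1) (Q : ℝ)
    {E : Set (Space d)} (hE : IsOpen E) (hE0 : volume E ≠ 0) (hEf : volume E ≠ ∞)
    (hP : perimeter E ≠ ∞) (hI : setEnergy α E = 0) {ε : ℝ} (hε : 0 < ε) :
    ∃ A ∈ {A : Set (Space d) | IsOpen A}, volume A = volume E ∧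
      volume (symmDiff E A) ≤ ENNReal.ofReal (2 * ε) ∧
      hausdorffEDist E A ≤ ENNReal.ofReal (2 * ε) ∧ energy α Q A < energy α Q E := by
  have hd1' : (1 : ℝ) < d := by linarith
  have hd2 : 2 ≤ d := by exact_mod_cast hd1'
  have hd1 : 1 ≤ d := by omega
  have hub : ¬ Bornology.IsBounded E := fun hb =>
    (setEnergy_pos_of_isBounded hα.le hE.measurableSet hb).ne' hI
  -- With zero Riesz energy there is nothing to gain from charges, so the strict decrease must come
  -- from the perimeter.
  obtain ⟨F, hF, hFvol, hEF, hFnear, hFP⟩ := exists_perimeter_lt_of_unbounded hd1 hE hEf hE0 hP hub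
    (ε := ENNReal.ofReal ε) (by simpa using hε) hε
  have hlt : perimeter F < energy α Q E := hFP.trans_le le_self_add
  obtain ⟨s, hs, η, hη, hsη⟩ := exists_one_add_mul_lt hlt
  -- The margin `η` is shared in thirds by the perimeter of the dust, the perimeter of the charged
  -- balls and the remaining Riesz energy `Q ^ 2 * v`.
  obtain ⟨v, hv0, hv⟩ : ∃ v : ℝ≥0∞, 0 < v ∧ ENNReal.ofReal (Q ^ 2) * v ≤ ENNReal.ofReal (η / 3) := by
    refine ⟨ENNReal.ofReal (η / 3 / (Q ^ 2 + 1)), by simpa using by positivity, ?_⟩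
    rw [← ENNReal.ofReal_mul (by positivity)]
    refine ENNReal.ofReal_le_ofReal ?_
    rw [mul_div_assoc', div_le_iff₀ (by positivity)]
    nlinarith [sq_nonneg Q]
  -- `F` itself may have large Riesz energy; a charge on `E` of tiny energy is transferred to balls
  -- added to `F`.
  obtain ⟨μ, hμ, hμE, hμe⟩ := exists_rieszEnergy_lt hE.measurableSet (hI.trans_lt hv0)
  have hμE' : μ (thickening (ε / 2) E)ᶜ = 0 :=
    measure_mono_null (compl_subset_compl.2 (self_subset_thickening (half_pos hε) E)) hμE
  have hcomp := exists_competitor (E := E) (𝒜 := {A : Set (Space d) | IsOpen A}) hd1 hα.le Q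
    (fun A hA => IsOpen.measurableSet hA)
    (fun A hA φ => φ.isOpenMap A hA) hF.measurableSet (hFvol ▸ hEf) (hFvol ▸ hE0) hε hs
    fun δ hδ => by
    obtain ⟨N, x, r, hr, hper, hvol, hen, hnear⟩ := exists_charged_balls hα hαd (half_pos hε) hμE'
      hμe (δ := min (δ / 2) (η / 3)) (by positivity)
    obtain ⟨O, hO, hOne, hOper, hOvol, hO1, hO2⟩ := exists_dust hd2
      (nonempty_of_measure_ne_zero hE0) hε (δ := min (δ / 2) (η / 3)) (by positivity)
    set W : Set (Space d) := ⋃ i, ball (x i) r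
    have hW : IsOpen W := isOpen_iUnion fun i => isOpen_ball
    have hWae := iUnion_ball_ae_eq hd1 x fun _ => r
    have hWsub : W ⊆ ⋃ i, closedBall (x i) r := iUnion_mono fun i => ball_subset_closedBall
    refine ⟨F ∪ (O ∪ W), hF.union (hO.union hW), ?_, ?_, ?_⟩
    · refine (volume_symmDiff_union_le F _).trans ((measure_union_le _ _).trans ?_)
      calc _ ≤ ENNReal.ofReal (δ / 2) + ENNReal.ofReal (δ / 2) := by
            gcongr
            · exact hOvol.trans (ENNReal.ofReal_le_ofReal (min_le_left _ _))
            · exact (measure_mono hWsub).trans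
                (hvol.trans (ENNReal.ofReal_le_ofReal (min_le_left _ _)))
        _ = ENNReal.ofReal δ := by
            rw [← ENNReal.ofReal_add (by positivity) (by positivity), add_halves]
    · refine hausdorffEDist_le_of_dist (fun z hz => ?_) ?_
      · obtain ⟨y, hy, h⟩ := hO2 z hz
        exact ⟨y, Or.inr (Or.inl hy), h⟩
      · rintro y (hy | hy | hy)
        · exact hFnear y hy
        · exact hO1 y hy
        · obtain ⟨z, hz, h⟩ := hnear y (hWsub hy)
          exact ⟨z, hz, by linarith⟩
    · refine lt_of_le_of_lt ?_ hsη
      gcongr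
      unfold energy
      have h1 : perimeter (F ∪ (O ∪ W))
          ≤ perimeter F + ENNReal.ofReal (η / 3) + ENNReal.ofReal (η / 3) := by
        rw [← union_assoc, perimeter_congr_ae ((ae_eq_refl (F ∪ O : Set (Space d))).union hWae)]
        refine (hper _ (hF.union hO).measurableSet).trans (add_le_add ?_
          (ENNReal.ofReal_le_ofReal (min_le_right _ _)))
        exact (hOper F hF.measurableSet).trans (add_le_add le_rfl
          (ENNReal.ofReal_le_ofReal (min_le_right _ _)))
      have h2 : setEnergy α (F ∪ (O ∪ W)) ≤ v :=
        (setEnergy_anti hW.measurableSet (subset_union_right.trans subset_union_right)).trans hen.le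
      calc _ ≤ perimeter F + ENNReal.ofReal (η / 3) + ENNReal.ofReal (η / 3)
            + ENNReal.ofReal (η / 3) := add_le_add h1 ((by gcongr : _ ≤ _ * v).trans hv)
        _ = perimeter F + ENNReal.ofReal η := by
            rw [add_assoc, add_assoc, ← ENNReal.ofReal_add (by positivity) (by positivity),
              ← ENNReal.ofReal_add (by positivity) (by positivity)]
            congr 2; ring
  obtain ⟨A, hA, hA1, hA2, hA3, hA4⟩ := hcomp
  refine ⟨A, hA, hA1.trans hFvol, ?_, hA3, hA4⟩
  refine (measure_symmDiff_le E F A).trans ((add_le_add hEF.le hA2).trans (le_of_eq ?_))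
  rw [← ENNReal.ofReal_add hε.le hε.le, two_mul]

theorem exists_open_competitor (hα : 0 < α) (hαd : α < (d : ℝ) - 1) {Q : ℝ} (hQ : 0 < Q)
    {E : Set (Space d)} (hE : IsOpen E) (hE0 : volume E ≠ 0) (hEf : volume E ≠ ∞)
    {ε : ℝ} (hε : 0 < ε) :
    ∃ A ∈ {A : Set (Space d) | IsOpen A}, volume A = volume E ∧
      volume (symmDiff E A) ≤ ENNReal.ofReal (2 * ε) ∧
      hausdorffEDist E A ≤ ENNReal.ofReal (2 * ε) ∧ energy α Q A < energy α Q E := by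
  have hd1' : (1 : ℝ) < d := by linarith
  have hd2 : 2 ≤ d := by exact_mod_cast hd1'
  have hmono : ENNReal.ofReal ε ≤ ENNReal.ofReal (2 * ε) :=
    ENNReal.ofReal_le_ofReal (by linarith)
  by_cases hP : perimeter E = ∞
  · obtain ⟨A, hA, h1, h2, h3, h4⟩ := exists_open_competitor_of_perimeter_eq_top hd2 hα.le
      (by linarith) Q hE hE0 hEf hP hε
    exact ⟨A, hA, h1, h2.trans hmono, h3, h4⟩
  by_cases hI : setEnergy α E = 0
  · exact exists_open_competitor_of_setEnergy_eq_zero hα hαd Q hE hE0 hEf hP hI hε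
  · obtain ⟨A, hA, h1, h2, h3, h4⟩ := exists_competitor_of_setEnergy_pos
      (𝒜 := {A : Set (Space d) | IsOpen A}) hα hαd hQ
      (fun A hA => IsOpen.measurableSet hA) (fun A hA φ => φ.isOpenMap A hA)
      (fun A hA N x r _ => ⟨⋃ i, ball (x i) r, subset_rfl, iUnion_mono fun i =>
        ball_subset_closedBall, (show IsOpen A from hA).union (isOpen_iUnion fun i => isOpen_ball)⟩)
      hE hEf hE0 hP hI hε
    exact ⟨A, hA, h1, h2.trans hmono, h3, h4⟩

/-- Boundedness excludes vanishing Riesz energy, so only two cases arise, whereas open sets need a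
third. -/
theorem exists_compact_competitor (hα : 0 < α) (hαd : α < (d : ℝ) - 1) {Q : ℝ} (hQ : 0 < Q)
    {E : Set (Space d)} (hE : IsCompact E) (hE0 : volume E ≠ 0) {ε : ℝ} (hε : 0 < ε) :
    ∃ A ∈ {A : Set (Space d) | IsCompact A}, volume A = volume E ∧
      volume (symmDiff E A) ≤ ENNReal.ofReal (2 * ε) ∧
      hausdorffEDist E A ≤ ENNReal.ofReal (2 * ε) ∧ energy α Q A < energy α Q E := by
  have hd1' : (1 : ℝ) < d := by linarith
  have hd1 : 1 ≤ d := by exact_mod_cast hd1'.le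
  have hmono : ENNReal.ofReal ε ≤ ENNReal.ofReal (2 * ε) :=
    ENNReal.ofReal_le_ofReal (by linarith)
  by_cases hP : perimeter E = ∞
  · obtain ⟨A, hA, h1, h2, h3, h4⟩ := exists_compact_competitor_of_perimeter_eq_top hd1 hα.le
      (by linarith) Q hE hE0 hP hε
    exact ⟨A, hA, h1, h2.trans hmono, h3, h4⟩
  · obtain ⟨A, hA, h1, h2, h3, h4⟩ := exists_competitor_of_setEnergy_pos
      (𝒜 := {A : Set (Space d) | IsCompact A}) hα hαd hQ
      (fun A hA => IsCompact.measurableSet hA) (fun A hA φ => IsCompact.image (show IsCompact A from hA) φ.continuous)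
      (fun A hA N x r _ => ⟨⋃ i, closedBall (x i) r, iUnion_mono fun i => ball_subset_closedBall,
        subset_rfl, (show IsCompact A from hA).union (isCompact_iUnion fun i => isCompact_closedBall _ _)⟩)
      hE hE.measure_lt_top.ne hE0 hP
      (setEnergy_pos_of_isBounded hα.le hE.measurableSet hE.isBounded).ne' hε
    exact ⟨A, hA, h1, h2.trans hmono, h3, h4⟩

theorem exists_pos_ofReal_two_mul_lt {ε : ℝ≥0∞} (hε : 0 < ε) :
    ∃ s : ℝ, 0 < s ∧ ENNReal.ofReal (2 * s) < ε := by
  obtain ⟨s, hs0, hs⟩ := ENNReal.lt_iff_exists_nnreal_btwn.1 hε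
  refine ⟨s / 2, by have : 0 < s := by exact_mod_cast hs0
                    positivity, ?_⟩
  rw [mul_div_cancel₀ _ (two_ne_zero), ENNReal.ofReal_coe_nnreal]
  exact hs

end ChargedDrop

end

theorem mainTheorem3 (d : ℕ) (α Q m : ℝ) (hα₀ : 0 < α) (hα₁ : α < (d : ℝ) - 1)
    (hQ : 0 < Q) (hm : 0 < m) :
    ((¬ ∃ E : Set (ChargedDrop.Space d),
        ChargedDrop.IsL1LocalMinimizer {A | IsOpen A} α Q m E) ∧
      (¬ ∃ E : Set (ChargedDrop.Space d),
        ChargedDrop.IsHausdorffLocalMinimizer {A | IsOpen A} α Q m E)) ∧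
    ((¬ ∃ E : Set (ChargedDrop.Space d),
        ChargedDrop.IsL1LocalMinimizer {A | IsCompact A} α Q m E) ∧
      (¬ ∃ E : Set (ChargedDrop.Space d),
        ChargedDrop.IsHausdorffLocalMinimizer {A | IsCompact A} α Q m E)) := by
  have hm0 : ENNReal.ofReal m ≠ 0 := by
    rw [Ne, ENNReal.ofReal_eq_zero, not_le]; exact hm
  have hmt : ENNReal.ofReal m ≠ ∞ := ENNReal.ofReal_ne_top
  refine ⟨⟨?_, ?_⟩, ?_, ?_⟩
  · rintro ⟨E, hE, hv, ε, hε, hmin⟩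
    obtain ⟨s, hs, hsε⟩ := ChargedDrop.exists_pos_ofReal_two_mul_lt hε
    obtain ⟨A, hA, h1, h2, -, h4⟩ := ChargedDrop.exists_open_competitor hα₀ hα₁ hQ hE
      (hv ▸ hm0) (hv ▸ hmt) hs
    exact (hmin A hA (h1.trans hv) (h2.trans_lt hsε)).not_gt h4
  · rintro ⟨E, hE, hv, ε, hε, hmin⟩
    obtain ⟨s, hs, hsε⟩ := ChargedDrop.exists_pos_ofReal_two_mul_lt hε
    obtain ⟨A, hA, h1, -, h3, h4⟩ := ChargedDrop.exists_open_competitor hα₀ hα₁ hQ hE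
      (hv ▸ hm0) (hv ▸ hmt) hs
    exact (hmin A hA (h1.trans hv) (h3.trans_lt hsε)).not_gt h4
  · rintro ⟨E, hE, hv, ε, hε, hmin⟩
    obtain ⟨s, hs, hsε⟩ := ChargedDrop.exists_pos_ofReal_two_mul_lt hε
    obtain ⟨A, hA, h1, h2, -, h4⟩ := ChargedDrop.exists_compact_competitor hα₀ hα₁ hQ hE
      (hv ▸ hm0) hs
    exact (hmin A hA (h1.trans hv) (h2.trans_lt hsε)).not_gt h4
  · rintro ⟨E, hE, hv, ε, hε, hmin⟩
    obtain ⟨s, hs, hsε⟩ := ChargedDrop.exists_pos_ofReal_two_mul_lt hε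
    obtain ⟨A, hA, h1, -, h3, h4⟩ := ChargedDrop.exists_compact_competitor hα₀ hα₁ hQ hE
      (hv ▸ hm0) hs
    exact (hmin A hA (h1.trans hv) (h3.trans_lt hsε)).not_gt h4
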